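/- Let $\mathbb H$ be the quaternions with basis $e_0=1,e_1,e_2,e_3$ (the units $1,i,j,k$) and coordinates $X=\sum x^ie_i$, $N(X)=\sum (x^i)^2$, $X^+$ the conjugate, $\partial_i=\partial/\partial x^i$, realized in $M_2(\mathbb C)$ by $$X\mapsto \begin{pmatrix} x^0-ix^3 & -ix^1-x^2\\ -ix^1+x^2 & x^0+ix^3\end{pmatrix};$$ it acts from the left on columns $\mathbb S=\mathbb C^2$ and from the right on rows $\mathbb S'=\mathbb C^2$. Let $\langle\cdot,\cdot\rangle:\mathbb S'\times\mathbb S\to\mathbb C$ be the bilinear pairing $\langle s',s\rangle=s'_1s_1+s'_2s_2$, and let $^+$ also denote the conjugate transpose $\mathbb S\leftrightarrow\mathbb S'$. Let $\mathbb C[x^0,x^1,x^2,x^3,N^{-1}]_n$ be the Laurent polynomials on $\mathbb H^\times=\mathbb H\setminus\{0\}$ of degree $n\in\mathbb Z$ ($x^i$ has degree $1$, $N^{-1}$ degree $-2$). Let $\mathcal H(n)$ be the harmonic ones ($\sum\partial_i^2\phi=0$), $\mathcal V(n)$ the left-regular $\mathbb S$-valued ones ($\sum e_i\,\partial_if=0$),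 and $\mathcal V'(n)$ the right-regular $\mathbb S'$-valued ones ($\sum(\partial_ig)\,e_i=0$). Put $\mathcal H^+=\bigoplus_{n\ge0}\mathcal H(n)$, $\mathcal H^-=\bigoplus_{n<0}\mathcal H(n)$, and similarly $\mathcal V^\pm$, $\mathcal V'^\pm$. For $h=\begin{pmatrix}a'&b'\\c'&d'\end{pmatrix}\in GL(2,\mathbb H)$, $h^{-1}=\begin{pmatrix}a&b\\c&d\end{pmatrix}$, put $$(\pi^0_l(h)\phi)(X)=\tfrac{1}{N(cX+d)}\,\phi\bigl((aX+b)(cX+d)^{-1}\bigr),\qquad (\pi^0_r(h)\phi)(X)=\tfrac{1}{N(a'-Xc')}\,\phi\bigl((a'-Xc')^{-1}(-b'+Xd')\bigr),$$ $$(\pi_l(h)f)(X)=\tfrac{(cX+d)^{-1}}{N(cX+d)}\,f\bigl((aX+b)(cX+d)^{-1}\bigr),\qquad (\pi_r(h)g)(X)=g\bigl((a'-Xc')^{-1}(-b'+Xd')\bigr)\,\tfrac{(a'-Xc')^{-1}}{N(a'-Xc')}.$$ The matrix realization of $\mathbb H$ identifies $\mathbb C\otimes\mathfrak{gl}(2,\mathbb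 H)$ with $\mathfrak{gl}(4,\mathbb C)$ and the complexification of $\mathfrak{sl}(2,\mathbb H)=\{x:\operatorname{Re}\operatorname{Tr}x=0\}$ with $\mathfrak{sl}(4,\mathbb C)$. Let $\mathfrak u(2,2)\subset\mathfrak{gl}(4,\mathbb C)$ be the real Lie subalgebra of the matrices $\begin{pmatrix}A&B\\B^*&D\end{pmatrix}$ in $2\times2$ blocks with $A^*=-A$, $D^*=-D$. Finally let $\widetilde{\deg}=1+\sum x^i\partial_i$, let $S_R=\{|X|=R\}$, $S^3=S_1$, and let $dS$ be the Euclidean surface measure. **Theorem.** 1. Differentiating the actions and extending complex-linearly gives representations of $\mathfrak{gl}(4,\mathbb C)$ on $\mathcal H^+$ and $\mathcal H^-$ (each with $\pi^0_l$ and with $\pi^0_r$), on $\mathcal V^+$ and $\mathcal V^-$ (with $\pi_l$) and on $\mathcal V'^+$ and $\mathcal V'^-$ (with $\pi_r$). All of them are irreducible, also as representations of $\mathfrak{sl}(4,\mathbb C)$. 2. Each of these spaces has a unitary structure (Hermitian inner product) with respect to which $\mathfrak u(2,2)$ acts by skew-Hermitian operators, namely $$(f_1,f_2)=\int_{S^3}\langle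 f_2^+(X),f_1(X)\rangle\,dS\ \text{ on }\mathcal V^\pm,\qquad (g_1,g_2)=\int_{S^3}\langle g_1(X),g_2^+(X)\rangle\,dS\ \text{ on }\mathcal V'^\pm,$$ $$(\phi_1,\phi_2)=\pm\int_{S^3}(\widetilde{\deg}\phi_1)(X)\,\overline{\phi_2(X)}\,dS\ \text{ on }\mathcal H^\pm .$$ 3. For every $R>0$ the formula $$\langle\phi_1,\phi_2\rangle=\frac1{2\pi^2}\int_{S_R}(\widetilde{\deg}\phi_1)(X)\,\phi_2(X)\,\frac{dS}{R},\qquad\phi_1\in\mathcal H^+,\ \phi_2\in\mathcal H^-,$$ defines a nondegenerate complex bilinear pairing between $(\pi^0_l,\mathcal H^+)$ and $(\pi^0_r,\mathcal H^-)$ which is $\mathfrak u(2,2)$-invariant, i.e. $\langle\pi^0_l(x)\phi_1,\phi_2\rangle+\langle\phi_1,\pi^0_r(x)\phi_2\rangle=0$ for $x\in\mathfrak u(2,2)$, and it does not depend on $R$. -/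

import Mathlib

open scoped Quaternion Matrix

attribute [local instance 100] LieRing.ofAssociativeRing

noncomputable section

namespace QuatConf

/-! ### Quaternions as `2 × 2` complex matrices, coordinates -/

/-- The basis `e₀, e₁, e₂, e₃` of the quaternions. -/
def e : Fin 4 → ℍ[ℝ] :=
  ![⟨1, 0, 0, 0⟩, ⟨0, 1, 0, 0⟩, ⟨0, 0, 1, 0⟩, ⟨0, 0, 0, 1⟩]

/-- The real coordinates `x⁰, x¹, x², x³` of a quaternion. -/
def coord (i : Fin 4) (X : ℍ[ℝ]) : ℝ := ![X.re, X.imI, X.imJ, X.imK] i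

/-- The realization of quaternions as `2 × 2` complex matrices. -/
def toMat (X : ℍ[ℝ]) : Matrix (Fin 2) (Fin 2) ℂ :=
  !![(X.re : ℂ) - Complex.I * X.imK, -Complex.I * X.imI - X.imJ;
     -Complex.I * X.imI + X.imJ, (X.re : ℂ) + Complex.I * X.imK]

/-- The space `𝕊` of spinors (columns); the dual space `𝕊'` (rows) has the same underlying type. -/
abbrev Spinor : Type := Fin 2 → ℂ

/-- The left action of the quaternions on columns. -/
def lact (X : ℍ[ℝ]) (s : Spinor) : Spinor := toMat X *ᵥ s

/-- The right action of the quaternions on rows. -/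
def ract (s : Spinor) (X : ℍ[ℝ]) : Spinor := s ᵥ* toMat X

/-! ### Functions on `ℍˣ = ℍ \ {0}` and differential operators -/

/-- The function on `ℍ` that agrees with `f` on `ℍˣ`; the value at `0` is a dummy. -/
def ext {F : Type*} [Zero F] (f : ℍ[ℝ]ˣ → F) (X : ℍ[ℝ]) : F := by
  classical exact if h : X ≠ 0 then f (Units.mk0 X h) else 0

/-- The partial derivative `∂ / ∂xⁱ` of a function on `ℍˣ`. -/
def pd {F : Type*} [NormedAddCommGroup F] [NormedSpace ℝ F] (i : Fin 4)
    (f : ℍ[ℝ]ˣ → F) (X : ℍ[ℝ]ˣ) : F :=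
  fderiv ℝ (ext f) (X : ℍ[ℝ]) (e i)

/-- The Laplacian in four variables. -/
def laplacian (φ : ℍ[ℝ]ˣ → ℂ) (X : ℍ[ℝ]ˣ) : ℂ := ∑ i, pd i (pd i φ) X

/-- The operator `1 + deg`, where `deg = ∑ xⁱ ∂ᵢ`. -/
def degT (φ : ℍ[ℝ]ˣ → ℂ) (X : ℍ[ℝ]ˣ) : ℂ :=
  φ X + ∑ i, (coord i (X : ℍ[ℝ]) : ℂ) * pd i φ X

/-- `f` is left-regular: `∑ eᵢ ∂ᵢ f = 0`. -/
def LeftRegular (f : ℍ[ℝ]ˣ → Spinor) : Prop :=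
  ∀ X, ∑ i, lact (e i) (pd i f X) = 0

/-- `g` is right-regular: `∑ (∂ᵢ g) eᵢ = 0`. -/
def RightRegular (g : ℍ[ℝ]ˣ → Spinor) : Prop :=
  ∀ X, ∑ i, ract (pd i g X) (e i) = 0

/-! ### Laurent polynomials and the spaces `𝓗^±`, `𝓥^±`, `𝓥'^±` -/

/-- The complex Laurent polynomials on `ℍˣ` (polynomials in the coordinates and `N⁻¹`)
that are homogeneous of degree `d`; the coordinates have degree `1`, and `N⁻¹` has degree `-2`. -/
def laurentDeg (d : ℤ) : Submodule ℂ (ℍ[ℝ]ˣ → ℂ) :=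
  Submodule.span ℂ {φ | ∃ (m : Fin 4 → ℕ) (k : ℕ), (∑ i, (m i : ℤ)) - 2 * (k : ℤ) = d ∧
    φ = fun X : ℍ[ℝ]ˣ =>
      (∏ i, (coord i (X : ℍ[ℝ]) : ℂ) ^ m i) * (((Quaternion.normSq (X : ℍ[ℝ]) : ℝ) : ℂ)⁻¹) ^ k}

/-- `𝓗(n)`: harmonic Laurent polynomials of degree `n`. -/
def harm (n : ℤ) : Set (ℍ[ℝ]ˣ → ℂ) :=
  {φ | φ ∈ laurentDeg n ∧ ∀ X, laplacian φ X = 0}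

/-- `𝓥(n)`: left-regular `𝕊`-valued Laurent polynomials of degree `n`. -/
def leftReg (n : ℤ) : Set (ℍ[ℝ]ˣ → Spinor) :=
  {f | (∀ j, (fun X => f X j) ∈ laurentDeg n) ∧ LeftRegular f}

/-- `𝓥'(n)`: right-regular `𝕊'`-valued Laurent polynomials of degree `n`. -/
def rightReg (n : ℤ) : Set (ℍ[ℝ]ˣ → Spinor) :=
  {g | (∀ j, (fun X => g X j) ∈ laurentDeg n) ∧ RightRegular g}

/-- `𝓗⁺`, the sum of the `𝓗(n)` with `n ≥ 0`. -/
def HPlus : Submodule ℂ (ℍ[ℝ]ˣ → ℂ) := Submodule.span ℂ {φ | ∃ n : ℤ, 0 ≤ n ∧ φ ∈ harm n}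

/-- `𝓗⁻`, the sum of the `𝓗(n)` with `n < 0`. -/
def HMinus : Submodule ℂ (ℍ[ℝ]ˣ → ℂ) := Submodule.span ℂ {φ | ∃ n : ℤ, n < 0 ∧ φ ∈ harm n}

/-- `𝓥⁺`, the sum of the `𝓥(n)` with `n ≥ 0`. -/
def VPlus : Submodule ℂ (ℍ[ℝ]ˣ → Spinor) :=
  Submodule.span ℂ {f | ∃ n : ℤ, 0 ≤ n ∧ f ∈ leftReg n}

/-- `𝓥⁻`, the sum of the `𝓥(n)` with `n < 0`. -/
def VMinus : Submodule ℂ (ℍ[ℝ]ˣ → Spinor) :=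
  Submodule.span ℂ {f | ∃ n : ℤ, n < 0 ∧ f ∈ leftReg n}

/-- `𝓥'⁺`, the sum of the `𝓥'(n)` with `n ≥ 0`. -/
def VPlus' : Submodule ℂ (ℍ[ℝ]ˣ → Spinor) :=
  Submodule.span ℂ {g | ∃ n : ℤ, 0 ≤ n ∧ g ∈ rightReg n}

/-- `𝓥'⁻`, the sum of the `𝓥'(n)` with `n < 0`. -/
def VMinus' : Submodule ℂ (ℍ[ℝ]ˣ → Spinor) :=
  Submodule.span ℂ {g | ∃ n : ℤ, n < 0 ∧ g ∈ rightReg n}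

/-! ### The conformal actions of `GL(2, ℍ)` -/

/-- The real Lie algebra `𝔤𝔩(2, ℍ)`. -/
abbrev glH : Type := Matrix (Fin 2) (Fin 2) ℍ[ℝ]

/-- The group `GL(2, ℍ)`. -/
abbrev GLH : Type := (Matrix (Fin 2) (Fin 2) ℍ[ℝ])ˣ

/-- `(π_l⁰(h) φ)(X) = N(cX+d)⁻¹ φ((aX+b)(cX+d)⁻¹)`, where `h⁻¹ = (a, b; c, d)`. -/
def actH_l (h : GLH) (φ : ℍ[ℝ] → ℂ) (X : ℍ[ℝ]) : ℂ :=
  let k : glH := (h⁻¹ : GLH)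
  ((Quaternion.normSq (k 1 0 * X + k 1 1))⁻¹ : ℝ) •
    φ ((k 0 0 * X + k 0 1) * (k 1 0 * X + k 1 1)⁻¹)

/-- `(π_r⁰(h) φ)(X) = N(a'-Xc')⁻¹ φ((a'-Xc')⁻¹(-b'+Xd'))`, where `h = (a', b'; c', d')`. -/
def actH_r (h : GLH) (φ : ℍ[ℝ] → ℂ) (X : ℍ[ℝ]) : ℂ :=
  let k : glH := h
  ((Quaternion.normSq (k 0 0 - X * k 1 0))⁻¹ : ℝ) •
    φ ((k 0 0 - X * k 1 0)⁻¹ * (-k 0 1 + X * k 1 1))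

/-- `(π_l(h) f)(X) = N(cX+d)⁻¹ (cX+d)⁻¹ f((aX+b)(cX+d)⁻¹)`, where `h⁻¹ = (a, b; c, d)`. -/
def actV (h : GLH) (f : ℍ[ℝ] → Spinor) (X : ℍ[ℝ]) : Spinor :=
  let k : glH := (h⁻¹ : GLH)
  ((Quaternion.normSq (k 1 0 * X + k 1 1))⁻¹ : ℝ) •
    lact (k 1 0 * X + k 1 1)⁻¹ (f ((k 0 0 * X + k 0 1) * (k 1 0 * X + k 1 1)⁻¹))

/-- `(π_r(h) g)(X) = g((a'-Xc')⁻¹(-b'+Xd')) (a'-Xc')⁻¹ N(a'-Xc')⁻¹`,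
where `h = (a', b'; c', d')`. -/
def actV' (h : GLH) (g : ℍ[ℝ] → Spinor) (X : ℍ[ℝ]) : Spinor :=
  let k : glH := h
  ((Quaternion.normSq (k 0 0 - X * k 1 0))⁻¹ : ℝ) •
    ract (g ((k 0 0 - X * k 1 0)⁻¹ * (-k 0 1 + X * k 1 1))) (k 0 0 - X * k 1 0)⁻¹

theorem exp_mul_exp_neg (x : glH) : NormedSpace.exp x * NormedSpace.exp (-x) = 1 := by
  let _ : NormedAlgebra ℚ ℍ[ℝ] := NormedAlgebra.restrictScalars ℚ ℝ ℍ[ℝ]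
  rw [← Matrix.exp_add_of_commute _ _ (Commute.neg_right (Commute.refl x)), add_neg_cancel,
    NormedSpace.exp_zero]

/-- The exponential map `𝔤𝔩(2, ℍ) → GL(2, ℍ)`. -/
def expGL (x : glH) : GLH where
  val := NormedSpace.exp x
  inv := NormedSpace.exp (-x)
  val_inv := exp_mul_exp_neg x
  inv_val := by simpa using exp_mul_exp_neg (-x)

/-! ### Complexification and real forms -/

/-- `𝔤𝔩(4, ℂ)`, in `2 × 2` blocks. -/
abbrev gl4 : Type := Matrix (Fin 2 ⊕ Fin 2) (Fin 2 ⊕ Fin 2) ℂ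

/-- The embedding of `𝔤𝔩(2, ℍ)` into `𝔤𝔩(4, ℂ)`. -/
def ι (x : glH) : gl4 :=
  Matrix.fromBlocks (toMat (x 0 0)) (toMat (x 0 1)) (toMat (x 1 0)) (toMat (x 1 1))

/-- `𝔰𝔩(4, ℂ)`. -/
def sl4 : Set gl4 := {x | x.trace = 0}

/-- `𝔲(2, 2)`, the Lie algebra of the group preserving the Hermitian form `diag(1, 1, -1, -1)`;
equivalently the matrices `(A, B; B*, D)` with `A* = -A` and `D* = -D`. -/
def u22 : Set gl4 :=
  {x | xᴴ * Matrix.fromBlocks 1 0 0 (-1) + Matrix.fromBlocks 1 0 0 (-1) * x = 0}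

/-- `ρ` is the complex-linear extension to `𝔤𝔩(4, ℂ)` of the derivative of the
action `act` of the group `GL(2, ℍ)` on functions from the space `W`. -/
def IsDerivedRep {F : Type*} [NormedAddCommGroup F] [NormedSpace ℂ F]
    (act : GLH → (ℍ[ℝ] → F) → ℍ[ℝ] → F) (W : Submodule ℂ (ℍ[ℝ]ˣ → F))
    (ρ : gl4 →ₗ⁅ℂ⁆ Module.End ℂ W) : Prop :=
  ∀ (x : glH) (f : W) (X : ℍ[ℝ]ˣ),
    HasDerivAt (fun t : ℝ => act (expGL (t • x)) (ext (f : ℍ[ℝ]ˣ → F)) (X : ℍ[ℝ]))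
      ((ρ (ι x) f : ℍ[ℝ]ˣ → F) X) 0

/-- `W` is nonzero and has no proper nonzero subspace stable under `ρ(x)`, `x ∈ s`. -/
def IsIrreducibleUnder {W : Type*} [AddCommGroup W] [Module ℂ W]
    (s : Set gl4) (ρ : gl4 →ₗ⁅ℂ⁆ Module.End ℂ W) : Prop :=
  Nontrivial W ∧ ∀ U : Submodule ℂ W, (∀ x ∈ s, ∀ f ∈ U, ρ x f ∈ U) → U = ⊥ ∨ U = ⊤

/-- `B` is a Hermitian inner product on `W` (linear in the first argument) for which
`𝔲(2, 2)` acts by skew-Hermitian operators. -/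
structure IsUnitaryStructure {W : Type*} [AddCommGroup W] [Module ℂ W]
    (ρ : gl4 →ₗ⁅ℂ⁆ Module.End ℂ W) (B : W → W → ℂ) : Prop where
  add_left : ∀ f g h, B (f + g) h = B f h + B g h
  smul_left : ∀ (c : ℂ) f h, B (c • f) h = c * B f h
  conj_symm : ∀ f h, B h f = star (B f h)
  pos : ∀ f, f ≠ 0 → 0 < (B f f).re
  skew : ∀ x ∈ u22, ∀ f h, B (ρ x f) h + B f (ρ x h) = 0

/-! ### Integrals over spheres and the forms -/

/-- The integral `∫_{S_R} F dS` over the sphere of radius `R` centered at the origin with respect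
to the Euclidean surface measure, which is `R³` times the surface measure
of the unit sphere transported by `ω ↦ R ω`. -/
def sphereIntegral (R : ℝ) (F : ℍ[ℝ] → ℂ) : ℂ :=
  (R : ℂ) ^ 3 * ∫ ω : Metric.sphere (0 : EuclideanSpace ℝ (Fin 4)) 1,
    F (Quaternion.linearIsometryEquivTuple.symm (R • (ω : EuclideanSpace ℝ (Fin 4))))
      ∂((MeasureTheory.volume : MeasureTheory.Measure (EuclideanSpace ℝ (Fin 4))).toSphere)

/-- `∫_{S³} (1 + deg)φ₁ · conj φ₂ dS`. -/
def formH (φ₁ φ₂ : ℍ[ℝ]ˣ → ℂ) : ℂ :=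
  sphereIntegral 1 fun X => ext (degT φ₁) X * star (ext φ₂ X)

/-- `∫_{S³} ⟨f₂⁺, f₁⟩ dS` for spinors in columns, and `∫_{S³} ⟨f₁, f₂⁺⟩ dS` for rows: in both
cases the integrand is the sum of the `f₁ⱼ · conj f₂ⱼ`. -/
def formV (f₁ f₂ : ℍ[ℝ]ˣ → Spinor) : ℂ :=
  sphereIntegral 1 fun X => ∑ j, star (ext f₂ X j) * ext f₁ X j

/-- `(2π²)⁻¹ ∫_{S_R} (1 + deg)φ₁ · φ₂ dS / R`. -/
def pairingH (R : ℝ) (φ₁ φ₂ : ℍ[ℝ]ˣ → ℂ) : ℂ :=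
  1 / (2 * (Real.pi : ℂ) ^ 2) *
    sphereIntegral R fun X => ext (degT φ₁) X * ext φ₂ X / (R : ℂ)

/-- `P` is a nondegenerate complex bilinear pairing of `W₁` and `W₂`, invariant under
`𝔲(2, 2)`, which acts on `W₁` by `ρ₁` and on `W₂` by `ρ₂`. -/
structure IsInvariantPairing {W₁ W₂ : Type*} [AddCommGroup W₁] [Module ℂ W₁]
    [AddCommGroup W₂] [Module ℂ W₂] (ρ₁ : gl4 →ₗ⁅ℂ⁆ Module.End ℂ W₁)
    (ρ₂ : gl4 →ₗ⁅ℂ⁆ Module.End ℂ W₂) (P : W₁ → W₂ → ℂ) : Prop where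
  add_left : ∀ f g h, P (f + g) h = P f h + P g h
  smul_left : ∀ (c : ℂ) f h, P (c • f) h = c * P f h
  add_right : ∀ f g h, P f (g + h) = P f g + P f h
  smul_right : ∀ (c : ℂ) f h, P f (c • h) = c * P f h
  nondeg_left : ∀ f, (∀ h, P f h = 0) → f = 0
  nondeg_right : ∀ h, (∀ f, P f h = 0) → h = 0
  invariant : ∀ x ∈ u22, ∀ f h, P (ρ₁ x f) h + P f (ρ₂ x h) = 0

end QuatConf

end

noncomputable section
namespace QuatConf

/-! ### An abstract differential calculus in the matrix coordinates of `ℍ` -/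

/-! Let `z` be the quaternion variable as a 2 × 2 matrix and `P a b` the derivative dual to the
entry `z a b`. An element x = (A, B; C, D) of 𝔤𝔩(4, ℂ) acts by the vector field z C z + z D - A z -
B plus a multiplier: tr(C z + D) on functions under π_l⁰ (`repH`), and in addition the matrix C z +
D on spinors (`repV`). The action π_r⁰ has the same vector field and differs by the character -tr
(`twist`). The action on rows becomes the one on columns after transposing z and applying the
automorphism `theta`. All that is needed about functions on ℍˣ is collected in `ConformalCalculus`;
its analytic content is that rotational derivatives integrate to zero over S³ and that ℍ \ {0} is
connected.

Degrees. B acts through the `P a b`, which lower the degree by one, C through the quadratic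
operators `opK`, which raise it by one, and A, D preserve it. The Casimir operator of the left
rotations is n(n+2) on harmonic functions of degree n. It is symmetric for the integral, so degrees
n ≠ m are orthogonal unless n + m = -2 (`I_mul_eq_zero`). It is nonnegative for the Hermitian
product, so there is nothing in degree -1 (`harmonic_neg_one`), and this gap keeps the halves n ≥ 0
and n < 0 apart. A regular spinor f has harmonic components and z f is harmonic of degree one
higher; hence spinors also miss degree -2.

Irreducibility. The sum of the products `opK` ∘ `P` is n² on harmonic functions and n(n+1) on
regular spinors; in the reverse order it is (n+2)² and (n+2)(n+3). On each half one of these sums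
separates the degrees and vanishes only on the extreme piece. An invariant subspace thus contains
the homogeneous components of its elements, reaches the extreme piece by lowering and recovers
everything by raising (`eq_bot_or_le_of_ladder`). The extreme pieces are the constants, the
multiples of N⁻¹, the constant spinors and the spinors z⁻¹ s / N.

Unitarity. On each half the bilinear forms ∫ ((1 + deg) φ) ψ and ∫ (f₀ l₁ - f₁ l₀) are invariant if
x acts on the first argument and `sharp x` on the second (`formB_repH`, `formW_repV`). Complex
conjugation, respectively the quaternionic structure of spinors, turns the action of x ∈ 𝔲(2, 2)
into that of `sharp x`; composing gives the Hermitian forms. They are definite because different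
degrees are orthogonal and n + 1 has a constant sign on each half.

Pairing. Between the two halves the form ∫ ((1 + deg) φ) ψ is invariant under all of 𝔤𝔩(4, ℂ), with
π_r⁰ on the second factor. Only degrees with n + m = -2 contribute, whence the independence of R;
the radicals are invariant subspaces, so irreducibility gives nondegeneracy. -/

/-- The algebraic and integral properties of the functions on `ℍˣ` that are used below: the matrix
coordinates `z`, the dual derivations `P`, the inverse of the norm, the homogeneous Laurent
polynomials `L n`, and the integral `I` over the unit sphere. -/
structure ConformalCalculus (A : Type*) [CommRing A] [StarRing A] [Algebra ℂ A]
    [StarModule ℂ A] where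
  z : Matrix (Fin 2) (Fin 2) A
  P : Fin 2 → Fin 2 → Derivation ℂ A A
  Ninv : A
  L : ℤ → Submodule ℂ A
  I : A →ₗ[ℂ] ℂ
  P_z : ∀ a b c d, P a b (z c d) = if a = c ∧ b = d then 1 else 0
  P_comm : ∀ a b c d φ, P a b (P c d φ) = P c d (P a b φ)
  det_mul_Ninv : (z 0 0 * z 1 1 - z 0 1 * z 1 0) * Ninv = 1
  -- Reality of the quaternions: the entrywise conjugate of `z` is the transposed adjugate of `z`,
  -- and the dual derivations are conjugated accordingly.
  star_z00 : star (z 0 0) = z 1 1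
  star_z01 : star (z 0 1) = -z 1 0
  star_P00 : ∀ φ, star (P 0 0 φ) = P 1 1 (star φ)
  star_P01 : ∀ φ, star (P 0 1 φ) = -P 1 0 (star φ)
  one_mem : (1 : A) ∈ L 0
  z_mul_mem : ∀ {n φ}, φ ∈ L n → ∀ a b, z a b * φ ∈ L (n + 1)
  Ninv_mul_mem : ∀ {n φ}, φ ∈ L n → Ninv * φ ∈ L (n - 2)
  P_mem : ∀ {n φ}, φ ∈ L n → ∀ a b, P a b φ ∈ L (n - 1)
  star_mem : ∀ {n φ}, φ ∈ L n → star φ ∈ L n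
  euler : ∀ {n φ}, φ ∈ L n →
    z 0 0 * P 0 0 φ + z 0 1 * P 0 1 φ + z 1 0 * P 1 0 φ + z 1 1 * P 1 1 φ = (n : A) * φ
  exists_const : ∀ φ, (∀ a b, P a b φ = 0) → ∃ c, φ = algebraMap ℂ A c
  I_star : ∀ φ, I (star φ) = star (I φ)
  -- The next six fields say that the vector fields of left and right rotations have integral zero;
  -- `I_det` says that the norm is 1 on the sphere.
  I_left01 : ∀ φ, I (z 1 0 * P 0 0 φ + z 1 1 * P 0 1 φ) = 0
  I_left10 : ∀ φ, I (z 0 0 * P 1 0 φ + z 0 1 * P 1 1 φ) = 0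
  I_left_diag : ∀ φ, I (z 0 0 * P 0 0 φ + z 0 1 * P 0 1 φ) = I (z 1 0 * P 1 0 φ + z 1 1 * P 1 1 φ)
  I_right10 : ∀ φ, I (z 0 1 * P 0 0 φ + z 1 1 * P 1 0 φ) = 0
  I_right01 : ∀ φ, I (z 0 0 * P 0 1 φ + z 1 0 * P 1 1 φ) = 0
  I_right_diag : ∀ φ,
    I (z 0 0 * P 0 0 φ + z 1 0 * P 1 0 φ) = I (z 0 1 * P 0 1 φ + z 1 1 * P 1 1 φ)
  I_det : ∀ φ, I ((z 0 0 * z 1 1 - z 0 1 * z 1 0) * φ) = I φ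
  I_pos : ∀ {n φ}, φ ∈ L n → φ ≠ 0 → 0 < (I (φ * star φ)).re

namespace ConformalCalculus

section

variable {A : Type*} [CommRing A] [Algebra ℂ A]

/-- Complex matrices as matrices over `A`. -/
def K : Matrix (Fin 2) (Fin 2) ℂ →+* Matrix (Fin 2) (Fin 2) A := (algebraMap ℂ A).mapMatrix

theorem K_apply (M : Matrix (Fin 2) (Fin 2) ℂ) (a b : Fin 2) :
    (K M : Matrix (Fin 2) (Fin 2) A) a b = algebraMap ℂ A (M a b) := rfl

theorem K_smul (c : ℂ) (M : Matrix (Fin 2) (Fin 2) ℂ) :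
    (K (c • M) : Matrix (Fin 2) (Fin 2) A) = c • K M := by
  ext a b; simp only [K_apply, Matrix.smul_apply, smul_eq_mul, map_mul]; rw [Algebra.smul_def]

theorem map_der_mul (δ : Derivation ℂ A A) (M N : Matrix (Fin 2) (Fin 2) A) :
    (M * N).map δ = M.map δ * N + M * N.map δ := by
  ext a b; simp [Matrix.mul_apply, Fin.sum_univ_two]; ring

theorem map_der_K (δ : Derivation ℂ A A) (M : Matrix (Fin 2) (Fin 2) ℂ) :
    (K M : Matrix (Fin 2) (Fin 2) A).map δ = 0 := by
  ext a b; simp [K_apply]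

theorem map_der_sub (δ : Derivation ℂ A A) (M N : Matrix (Fin 2) (Fin 2) A) :
    (M - N).map δ = M.map δ - N.map δ := by ext a b; simp

theorem map_der_add (δ : Derivation ℂ A A) (M N : Matrix (Fin 2) (Fin 2) A) :
    (M + N).map δ = M.map δ + N.map δ := by ext a b; simp

end

variable {A : Type*} [CommRing A] [StarRing A] [Algebra ℂ A] [StarModule ℂ A]
  (𝒟 : ConformalCalculus A)

/-- The calculus in the transposed coordinates. -/
def transpose : ConformalCalculus A where
  z := 𝒟.zᵀ
  P a b := 𝒟.P b a
  Ninv := 𝒟.Ninv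
  L := 𝒟.L
  I := 𝒟.I
  P_z a b c d := by rw [Matrix.transpose_apply, 𝒟.P_z]; simp only [and_comm]
  P_comm a b c d φ := 𝒟.P_comm _ _ _ _ φ
  det_mul_Ninv := by
    rw [← 𝒟.det_mul_Ninv]; simp only [Matrix.transpose_apply]; ring
  star_z00 := 𝒟.star_z00
  star_z01 := by
    rw [Matrix.transpose_apply, Matrix.transpose_apply, ← star_star (𝒟.z 0 1), 𝒟.star_z01]; simp
  star_P00 := 𝒟.star_P00
  star_P01 φ := by
    have := 𝒟.star_P01 (star φ)
    rw [star_star] at this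
    rw [← star_star (𝒟.P 0 1 (star φ)), this]; simp
  one_mem := 𝒟.one_mem
  z_mul_mem h a b := 𝒟.z_mul_mem h b a
  Ninv_mul_mem := 𝒟.Ninv_mul_mem
  P_mem h a b := 𝒟.P_mem h b a
  star_mem := 𝒟.star_mem
  euler h := by rw [← 𝒟.euler h]; simp only [Matrix.transpose_apply]; ring
  exists_const φ h := 𝒟.exists_const φ fun a b => h b a
  I_star := 𝒟.I_star
  -- Transposition exchanges left and right multiplication, so each identity for left rotations
  -- yields the one for right rotations.
  I_left01 := 𝒟.I_right10
  I_left10 := 𝒟.I_right01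
  I_left_diag := 𝒟.I_right_diag
  I_right10 := 𝒟.I_left01
  I_right01 := 𝒟.I_left10
  I_right_diag := 𝒟.I_left_diag
  I_det φ := by rw [← 𝒟.I_det φ]; simp only [Matrix.transpose_apply]; ring_nf
  I_pos := 𝒟.I_pos

/-! ### The conformal vector fields and the two representations by differential operators -/

/-- The value at `z` of the vector field of `x ∈ 𝔤𝔩(4, ℂ)`. -/
def vec (x : gl4) : Matrix (Fin 2) (Fin 2) A :=
  𝒟.z * K x.toBlocks₂₁ * 𝒟.z + 𝒟.z * K x.toBlocks₂₂ - K x.toBlocks₁₁ * 𝒟.z - K x.toBlocks₁₂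

/-- The derivation with coefficient matrix `v`. -/
def der : Matrix (Fin 2) (Fin 2) A →ₗ[A] Derivation ℂ A A where
  toFun v := ∑ a, ∑ b, v a b • 𝒟.P a b
  map_add' v w := by simp [add_smul, Finset.sum_add_distrib]
  map_smul' c v := by simp [mul_smul]

theorem der_apply (v : Matrix (Fin 2) (Fin 2) A) (φ : A) :
    𝒟.der v φ = v 0 0 * 𝒟.P 0 0 φ + v 0 1 * 𝒟.P 0 1 φ + v 1 0 * 𝒟.P 1 0 φ + v 1 1 * 𝒟.P 1 1 φ := by
  simp [der, Fin.sum_univ_two]; ring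

theorem der_z (v : Matrix (Fin 2) (Fin 2) A) (a b : Fin 2) : 𝒟.der v (𝒟.z a b) = v a b := by
  fin_cases a <;> fin_cases b <;> simp [der_apply, P_z]

/-- The `P a b` commute, so the second-order terms cancel. -/
theorem der_lie (v w : Matrix (Fin 2) (Fin 2) A) :
    ⁅𝒟.der v, 𝒟.der w⁆ =
      𝒟.der (Matrix.of fun a b => 𝒟.der v (w a b) - 𝒟.der w (v a b)) := by
  ext φ
  simp only [Derivation.commutator_apply, der_apply, map_add, Derivation.leibniz, smul_eq_mul,
    Matrix.of_apply]
  rw [𝒟.P_comm 0 1 0 0, 𝒟.P_comm 1 0 0 0, 𝒟.P_comm 1 1 0 0, 𝒟.P_comm 1 0 0 1, 𝒟.P_comm 1 1 0 1,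
    𝒟.P_comm 1 1 1 0]
  ring

theorem map_der_z (v : Matrix (Fin 2) (Fin 2) A) : 𝒟.z.map (𝒟.der v) = v := by
  ext a b; simp [der_z]

/-- The matrix multiplier `c z + d` of `x ∈ 𝔤𝔩(4, ℂ)`. -/
def mult (x : gl4) : Matrix (Fin 2) (Fin 2) A := K x.toBlocks₂₁ * 𝒟.z + K x.toBlocks₂₂

theorem lie_toBlocks (x y : gl4) :
    ⁅x, y⁆.toBlocks₁₁ = x.toBlocks₁₁ * y.toBlocks₁₁ + x.toBlocks₁₂ * y.toBlocks₂₁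
        - (y.toBlocks₁₁ * x.toBlocks₁₁ + y.toBlocks₁₂ * x.toBlocks₂₁) ∧
      ⁅x, y⁆.toBlocks₁₂ = x.toBlocks₁₁ * y.toBlocks₁₂ + x.toBlocks₁₂ * y.toBlocks₂₂
        - (y.toBlocks₁₁ * x.toBlocks₁₂ + y.toBlocks₁₂ * x.toBlocks₂₂) ∧
      ⁅x, y⁆.toBlocks₂₁ = x.toBlocks₂₁ * y.toBlocks₁₁ + x.toBlocks₂₂ * y.toBlocks₂₁
        - (y.toBlocks₂₁ * x.toBlocks₁₁ + y.toBlocks₂₂ * x.toBlocks₂₁) ∧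
      ⁅x, y⁆.toBlocks₂₂ = x.toBlocks₂₁ * y.toBlocks₁₂ + x.toBlocks₂₂ * y.toBlocks₂₂
        - (y.toBlocks₂₁ * x.toBlocks₁₂ + y.toBlocks₂₂ * x.toBlocks₂₂) := by
  refine ⟨?_, ?_, ?_, ?_⟩ <;> ext a b <;>
    simp [Ring.lie_def, Matrix.mul_apply, Matrix.toBlocks₁₁, Matrix.toBlocks₁₂, Matrix.toBlocks₂₁,
      Matrix.toBlocks₂₂]

/-- A homomorphism and not an antihomomorphism, because the group element acts on the variable
through its inverse. Both sides are noncommutative polynomials in `z` and the blocks of x and y. -/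
theorem vec_lie (x y : gl4) :
    𝒟.vec ⁅x, y⁆ = (𝒟.vec y).map (𝒟.der (𝒟.vec x)) - (𝒟.vec x).map (𝒟.der (𝒟.vec y)) := by
  obtain ⟨h1, h2, h3, h4⟩ := lie_toBlocks x y
  have hx (x y : gl4) : (𝒟.vec y).map (𝒟.der (𝒟.vec x)) =
      𝒟.vec x * K y.toBlocks₂₁ * 𝒟.z + 𝒟.z * K y.toBlocks₂₁ * 𝒟.vec x + 𝒟.vec x * K y.toBlocks₂₂
        - K y.toBlocks₁₁ * 𝒟.vec x := by
    conv_lhs => rw [vec]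
    simp [map_der_sub, map_der_add, map_der_mul, map_der_K, map_der_z]
  rw [hx, hx, vec, h1, h2, h3, h4]
  simp only [vec, map_add, map_sub, map_mul]
  noncomm_ring

/-- The infinitesimal cocycle identity of the multiplier. The commutator makes C z + D act on
spinors compatibly with brackets; it disappears in the trace, which is the multiplier on functions.
-/
theorem mult_lie (x y : gl4) :
    𝒟.mult ⁅x, y⁆ = (𝒟.mult y).map (𝒟.der (𝒟.vec x)) - (𝒟.mult x).map (𝒟.der (𝒟.vec y))
      + (𝒟.mult x * 𝒟.mult y - 𝒟.mult y * 𝒟.mult x) := by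
  obtain ⟨h1, h2, h3, h4⟩ := lie_toBlocks x y
  have hx (x y : gl4) : (𝒟.mult y).map (𝒟.der (𝒟.vec x)) = K y.toBlocks₂₁ * 𝒟.vec x := by
    conv_lhs => rw [mult]
    simp [map_der_add, map_der_mul, map_der_K, map_der_z]
  rw [hx, hx]
  simp only [vec, mult, h3, h4, map_add, map_sub, map_mul]
  noncomm_ring

theorem vec_add (x y : gl4) : 𝒟.vec (x + y) = 𝒟.vec x + 𝒟.vec y := by
  have h : (x + y).toBlocks₁₁ = x.toBlocks₁₁ + y.toBlocks₁₁ ∧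
    (x + y).toBlocks₁₂ = x.toBlocks₁₂ + y.toBlocks₁₂ ∧
    (x + y).toBlocks₂₁ = x.toBlocks₂₁ + y.toBlocks₂₁ ∧
    (x + y).toBlocks₂₂ = x.toBlocks₂₂ + y.toBlocks₂₂ := ⟨rfl, rfl, rfl, rfl⟩
  simp only [vec, h, map_add]; noncomm_ring

theorem mult_add (x y : gl4) : 𝒟.mult (x + y) = 𝒟.mult x + 𝒟.mult y := by
  have h : (x + y).toBlocks₂₁ = x.toBlocks₂₁ + y.toBlocks₂₁ ∧
    (x + y).toBlocks₂₂ = x.toBlocks₂₂ + y.toBlocks₂₂ := ⟨rfl, rfl⟩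
  simp only [mult, h, map_add]; noncomm_ring

theorem vec_smul (c : ℂ) (x : gl4) : 𝒟.vec (c • x) = algebraMap ℂ A c • 𝒟.vec x := by
  have h : (c • x).toBlocks₁₁ = c • x.toBlocks₁₁ ∧ (c • x).toBlocks₁₂ = c • x.toBlocks₁₂ ∧
    (c • x).toBlocks₂₁ = c • x.toBlocks₂₁ ∧ (c • x).toBlocks₂₂ = c • x.toBlocks₂₂ :=
    ⟨rfl, rfl, rfl, rfl⟩
  simp only [vec, h, K_smul, algebraMap_smul, Matrix.mul_smul, Matrix.smul_mul, smul_add, smul_sub]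

theorem mult_smul (c : ℂ) (x : gl4) : 𝒟.mult (c • x) = algebraMap ℂ A c • 𝒟.mult x := by
  have h : (c • x).toBlocks₂₁ = c • x.toBlocks₂₁ ∧ (c • x).toBlocks₂₂ = c • x.toBlocks₂₂ :=
    ⟨rfl, rfl⟩
  simp only [mult, h, K_smul, algebraMap_smul, Matrix.smul_mul, smul_add]

theorem der_vec_lie (x y : gl4) (φ : A) :
    𝒟.der (𝒟.vec ⁅x, y⁆) φ = 𝒟.der (𝒟.vec x) (𝒟.der (𝒟.vec y) φ)
      - 𝒟.der (𝒟.vec y) (𝒟.der (𝒟.vec x) φ) := by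
  rw [← Derivation.commutator_apply, der_lie, vec_lie]
  rfl

theorem mult_lie_apply (x y : gl4) (a b : Fin 2) :
    𝒟.mult ⁅x, y⁆ a b = 𝒟.der (𝒟.vec x) (𝒟.mult y a b) - 𝒟.der (𝒟.vec y) (𝒟.mult x a b)
      + (𝒟.mult x a 0 * 𝒟.mult y 0 b + 𝒟.mult x a 1 * 𝒟.mult y 1 b
        - (𝒟.mult y a 0 * 𝒟.mult x 0 b + 𝒟.mult y a 1 * 𝒟.mult x 1 b)) := by
  rw [mult_lie]; simp [Matrix.mul_apply, Fin.sum_univ_two]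

/-- The operators `∂_v + tr(c z + d)` on scalar functions. -/
def repH : gl4 →ₗ⁅ℂ⁆ Module.End ℂ A where
  toFun x := (𝒟.der (𝒟.vec x)).toLinearMap + LinearMap.mulLeft ℂ (𝒟.mult x 0 0 + 𝒟.mult x 1 1)
  map_add' x y := by
    ext φ
    simp [vec_add, mult_add]; ring
  map_smul' c x := by
    ext φ
    simp only [vec_smul, mult_smul, map_smul, Matrix.smul_apply, LinearMap.add_apply, LinearMap.mulLeft_apply,
      Derivation.coeFn_coe, Derivation.smul_apply, smul_eq_mul, LinearMap.smul_apply, RingHom.id_apply]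
    simp only [Algebra.smul_def]; ring
  map_lie' {x y} := by
    ext φ
    simp only [Ring.lie_def, LinearMap.add_apply, LinearMap.sub_apply, Module.End.mul_apply,
      LinearMap.mulLeft_apply, Derivation.coeFn_coe, map_add, Derivation.leibniz, smul_eq_mul]
    rw [← Ring.lie_def, der_vec_lie, mult_lie_apply, mult_lie_apply]
    ring

theorem repH_apply (x : gl4) (φ : A) :
    𝒟.repH x φ = 𝒟.der (𝒟.vec x) φ + (𝒟.mult x 0 0 + 𝒟.mult x 1 1) * φ := rfl

/-- The operators `∂_v + tr(c z + d) + (c z + d)` on spinors. -/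
def repV : gl4 →ₗ⁅ℂ⁆ Module.End ℂ (Fin 2 → A) where
  toFun x :=
    { toFun := fun f j => 𝒟.der (𝒟.vec x) (f j) + (𝒟.mult x 0 0 + 𝒟.mult x 1 1) * f j
        + (𝒟.mult x j 0 * f 0 + 𝒟.mult x j 1 * f 1)
      map_add' := fun f g => by ext j; simp; ring
      map_smul' := fun c f => by ext j; simp [Algebra.smul_def]; ring }
  map_add' x y := by
    refine LinearMap.ext fun f => funext fun j => ?_
    simp [vec_add, mult_add]; ring
  map_smul' c x := by
    refine LinearMap.ext fun f => funext fun j => ?_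
    simp only [vec_smul, mult_smul, map_smul, Matrix.smul_apply, LinearMap.coe_mk, AddHom.coe_mk,
      Derivation.smul_apply, smul_eq_mul, LinearMap.smul_apply, RingHom.id_apply, Pi.smul_apply]
    simp only [Algebra.smul_def]; ring
  map_lie' {x y} := by
    refine LinearMap.ext fun f => funext fun j => ?_
    simp only [Ring.lie_def, LinearMap.sub_apply, Module.End.mul_apply, LinearMap.coe_mk,
      AddHom.coe_mk, map_add, Derivation.leibniz, smul_eq_mul, Pi.sub_apply]
    rw [← Ring.lie_def, der_vec_lie]
    simp only [mult_lie_apply]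
    ring

theorem repV_apply (x : gl4) (f : Fin 2 → A) (j : Fin 2) :
    𝒟.repV x f j = 𝒟.der (𝒟.vec x) (f j) + (𝒟.mult x 0 0 + 𝒟.mult x 1 1) * f j
        + (𝒟.mult x j 0 * f 0 + 𝒟.mult x j 1 * f 1) := rfl

end ConformalCalculus

/-! ### Passing from left to right actions: the twist and the automorphism `theta` -/

/-- The twist of a representation of `𝔤𝔩(4, ℂ)` by the character `-tr`. -/
def twist {E : Type*} [AddCommGroup E] [Module ℂ E] (ρ : gl4 →ₗ⁅ℂ⁆ Module.End ℂ E) :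
    gl4 →ₗ⁅ℂ⁆ Module.End ℂ E where
  toFun x := ρ x - x.trace • 1
  map_add' x y := by simp only [map_add, Matrix.trace_add, add_smul]; abel
  map_smul' c x := by simp [smul_sub, mul_smul]
  map_lie' {x y} := by
    have h : ⁅x, y⁆.trace = 0 := by simp [Ring.lie_def, Matrix.trace_mul_comm x y]
    simp only [LieHom.map_lie, h, zero_smul, sub_zero]
    simp only [Ring.lie_def, sub_mul, mul_sub, smul_mul_assoc, mul_smul_comm, one_mul, mul_one]
    module

theorem twist_apply {E : Type*} [AddCommGroup E] [Module ℂ E] (ρ : gl4 →ₗ⁅ℂ⁆ Module.End ℂ E)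
    (x : gl4) (f : E) : twist ρ x f = ρ x f - x.trace • f := rfl

/-- The automorphism of `𝔤𝔩(4, ℂ)` that intertwines the actions on rows and on columns. -/
def theta : gl4 →ₗ⁅ℂ⁆ gl4 where
  toFun x := Matrix.fromBlocks (-x.toBlocks₂₂ᵀ) x.toBlocks₁₂ᵀ x.toBlocks₂₁ᵀ (-x.toBlocks₁₁ᵀ)
  map_add' x y := by
    ext (a | a) (b | b) <;> simp [Matrix.toBlocks₁₁, Matrix.toBlocks₁₂, Matrix.toBlocks₂₁,
      Matrix.toBlocks₂₂] <;> ring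
  map_smul' c x := by
    ext (a | a) (b | b) <;> simp [Matrix.toBlocks₁₁, Matrix.toBlocks₁₂, Matrix.toBlocks₂₁,
      Matrix.toBlocks₂₂]
  map_lie' {x y} := by
    ext (a | a) (b | b) <;> simp [Matrix.toBlocks₁₁, Matrix.toBlocks₁₂, Matrix.toBlocks₂₁,
      Matrix.toBlocks₂₂, Ring.lie_def, Matrix.mul_apply] <;> ring

/-- As `theta` is an involution, a subspace stable under ρ ∘ `theta` is stable under ρ. -/
theorem theta_theta (x : gl4) : theta (theta x) = x := by
  ext (a | a) (b | b) <;> simp [theta, Matrix.toBlocks₁₁, Matrix.toBlocks₁₂, Matrix.toBlocks₂₁,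
      Matrix.toBlocks₂₂]

end QuatConf
end
noncomputable section
namespace QuatConf
namespace ConformalCalculus

variable {A : Type*} [CommRing A] [StarRing A] [Algebra ℂ A] [StarModule ℂ A]
  (𝒟 : ConformalCalculus A)

/-! ### Harmonic functions and regular spinors -/

/-- The norm `N = det z`. -/
def det : A := 𝒟.z 0 0 * 𝒟.z 1 1 - 𝒟.z 0 1 * 𝒟.z 1 0

/-- The harmonic functions that are homogeneous of degree `n`. -/
def harmonic (n : ℤ) : Submodule ℂ A where
  carrier := {φ | φ ∈ 𝒟.L n ∧ 𝒟.P 0 0 (𝒟.P 1 1 φ) = 𝒟.P 0 1 (𝒟.P 1 0 φ)}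
  add_mem' h h' := ⟨add_mem h.1 h'.1, by simp only [map_add, h.2, h'.2]⟩
  zero_mem' := ⟨zero_mem _, by simp⟩
  smul_mem' c φ h := ⟨Submodule.smul_mem _ c h.1, by simp only [Derivation.map_smul, h.2]⟩

/-- The left-regular spinors that are homogeneous of degree `n`. -/
def regular (n : ℤ) : Submodule ℂ (Fin 2 → A) where
  carrier := {f | (∀ j, f j ∈ 𝒟.L n) ∧ ∀ c, 𝒟.P c 1 (f 0) = 𝒟.P c 0 (f 1)}
  add_mem' h h' := ⟨fun j => add_mem (h.1 j) (h'.1 j), fun c => by simp [h.2, h'.2]⟩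
  zero_mem' := ⟨fun _ => zero_mem _, by simp⟩
  smul_mem' c φ h := ⟨fun j => Submodule.smul_mem _ c (h.1 j), fun d => by simp [h.2]⟩

variable {𝒟}

theorem L_cast {n m : ℤ} {φ : A} (h : φ ∈ 𝒟.L n) (e : n = m) : φ ∈ 𝒟.L m := e ▸ h

theorem harmonic_P {n : ℤ} {φ : A} (h : φ ∈ 𝒟.harmonic n) (a b : Fin 2) :
    𝒟.P a b φ ∈ 𝒟.harmonic (n - 1) :=
  ⟨𝒟.P_mem h.1 a b, by
    rw [𝒟.P_comm 1 1 a b, 𝒟.P_comm 0 0 a b, h.2, 𝒟.P_comm a b 0 1, 𝒟.P_comm a b 1 0]⟩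

theorem regular_P {n : ℤ} {f : Fin 2 → A} (h : f ∈ 𝒟.regular n) (a b : Fin 2) :
    (fun j => 𝒟.P a b (f j)) ∈ 𝒟.regular (n - 1) :=
  ⟨fun j => 𝒟.P_mem (h.1 j) a b, fun c => by
    rw [𝒟.P_comm c 1 a b, h.2, 𝒟.P_comm a b c 0]⟩

/-- Cross differentiation of the two regularity equations. Most facts about spinors reduce through
this to facts about functions. -/
theorem regular_harmonic {n : ℤ} {f : Fin 2 → A} (h : f ∈ 𝒟.regular n) (j : Fin 2) :
    f j ∈ 𝒟.harmonic n := by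
  refine ⟨h.1 j, ?_⟩
  fin_cases j
  · show 𝒟.P 0 0 (𝒟.P 1 1 (f 0)) = 𝒟.P 0 1 (𝒟.P 1 0 (f 0))
    rw [h.2 1, 𝒟.P_comm 0 0 1 0, ← h.2 0, 𝒟.P_comm 1 0 0 1]
  · show 𝒟.P 0 0 (𝒟.P 1 1 (f 1)) = 𝒟.P 0 1 (𝒟.P 1 0 (f 1))
    rw [𝒟.P_comm 0 0 1 1, ← h.2 0, 𝒟.P_comm 1 1 0 1, h.2 1]

theorem intCast_mul_mem {n m : ℤ} {φ : A} (h : φ ∈ 𝒟.L n) : (m : A) * φ ∈ 𝒟.L n := by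
  rw [← map_intCast (algebraMap ℂ A), ← Algebra.smul_def]; exact Submodule.smul_mem _ _ h

theorem det_mul_mem {n : ℤ} {φ : A} (h : φ ∈ 𝒟.L n) : 𝒟.det * φ ∈ 𝒟.L (n + 2) := by
  have h1 := L_cast (𝒟.z_mul_mem (𝒟.z_mul_mem h 1 1) 0 0) (by ring : n + 1 + 1 = n + 2)
  have h2 := L_cast (𝒟.z_mul_mem (𝒟.z_mul_mem h 1 0) 0 1) (by ring : n + 1 + 1 = n + 2)
  have := sub_mem h1 h2
  rw [det]; convert this using 1; ring

/-! ### Matrix units as operators, and their effect on degree, harmonicity and regularity -/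

/-- The action of a matrix unit in the upper left block, up to sign. -/
def opL (𝒟 : ConformalCalculus A) (a b : Fin 2) : A →ₗ[ℂ] A :=
  LinearMap.mulLeft ℂ (𝒟.z b 0) ∘ₗ (𝒟.P a 0).toLinearMap +
    LinearMap.mulLeft ℂ (𝒟.z b 1) ∘ₗ (𝒟.P a 1).toLinearMap

theorem opL_apply (a b : Fin 2) (φ : A) :
    𝒟.opL a b φ = 𝒟.z b 0 * 𝒟.P a 0 φ + 𝒟.z b 1 * 𝒟.P a 1 φ := rfl

/-- The vector field of a matrix unit in the lower right block. -/
def opR (𝒟 : ConformalCalculus A) (a b : Fin 2) : A →ₗ[ℂ] A :=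
  LinearMap.mulLeft ℂ (𝒟.z 0 a) ∘ₗ (𝒟.P 0 b).toLinearMap +
    LinearMap.mulLeft ℂ (𝒟.z 1 a) ∘ₗ (𝒟.P 1 b).toLinearMap

theorem opR_apply (a b : Fin 2) (φ : A) :
    𝒟.opR a b φ = 𝒟.z 0 a * 𝒟.P 0 b φ + 𝒟.z 1 a * 𝒟.P 1 b φ := rfl

/-- The action of a matrix unit in the lower left block on functions. -/
def opK (𝒟 : ConformalCalculus A) (a b : Fin 2) : A →ₗ[ℂ] A :=
  LinearMap.mulLeft ℂ (𝒟.z 0 a * 𝒟.z b 0) ∘ₗ (𝒟.P 0 0).toLinearMap +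
    LinearMap.mulLeft ℂ (𝒟.z 0 a * 𝒟.z b 1) ∘ₗ (𝒟.P 0 1).toLinearMap +
    LinearMap.mulLeft ℂ (𝒟.z 1 a * 𝒟.z b 0) ∘ₗ (𝒟.P 1 0).toLinearMap +
    LinearMap.mulLeft ℂ (𝒟.z 1 a * 𝒟.z b 1) ∘ₗ (𝒟.P 1 1).toLinearMap +
    LinearMap.mulLeft ℂ (𝒟.z b a)

theorem opK_apply (a b : Fin 2) (φ : A) :
    𝒟.opK a b φ = 𝒟.z 0 a * 𝒟.z b 0 * 𝒟.P 0 0 φ + 𝒟.z 0 a * 𝒟.z b 1 * 𝒟.P 0 1 φ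
      + 𝒟.z 1 a * 𝒟.z b 0 * 𝒟.P 1 0 φ + 𝒟.z 1 a * 𝒟.z b 1 * 𝒟.P 1 1 φ + 𝒟.z b a * φ := rfl

/-- The action of a matrix unit in the lower left block on spinors. -/
def opKV (𝒟 : ConformalCalculus A) (a b : Fin 2) (f : Fin 2 → A) (j : Fin 2) : A :=
  𝒟.opK a b (f j) + if j = a then 𝒟.z b 0 * f 0 + 𝒟.z b 1 * f 1 else 0

/-- The action of a matrix unit in the lower right block on spinors, without the trace. -/
def opRV (𝒟 : ConformalCalculus A) (a b : Fin 2) (f : Fin 2 → A) (j : Fin 2) : A :=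
  𝒟.opR a b (f j) + if j = a then f b else 0

/-- Expansion in matrix units: questions of stability, invariance and reality of `repH` reduce to
the families `P`, `opL`, `opR` and `opK`. -/
theorem repH_eq (x : gl4) (φ : A) :
    𝒟.repH x φ = ∑ a, ∑ b, (-(x (.inl a) (.inr b) • 𝒟.P a b φ) - x (.inl a) (.inl b) • 𝒟.opL a b φ
      + x (.inr a) (.inr b) • 𝒟.opR a b φ + x (.inr a) (.inl b) • 𝒟.opK a b φ)
      + (x (.inr 0) (.inr 0) + x (.inr 1) (.inr 1)) • φ := by
  simp only [repH_apply, der_apply, vec, mult, Matrix.sub_apply, Matrix.add_apply, Matrix.mul_apply,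
    Fin.sum_univ_two, K_apply, Matrix.toBlocks₁₁, Matrix.toBlocks₁₂, Matrix.toBlocks₂₁,
    Matrix.toBlocks₂₂, Matrix.of_apply, opL_apply, opR_apply, opK_apply, Algebra.smul_def, map_add]
  ring

theorem repV_eq (x : gl4) (f : Fin 2 → A) :
    𝒟.repV x f = ∑ a, ∑ b, (-(x (.inl a) (.inr b) • fun j => 𝒟.P a b (f j))
      - (x (.inl a) (.inl b) • fun j => 𝒟.opL a b (f j))
      + x (.inr a) (.inr b) • 𝒟.opRV a b f + x (.inr a) (.inl b) • 𝒟.opKV a b f)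
      + (x (.inr 0) (.inr 0) + x (.inr 1) (.inr 1)) • f := by
  ext j
  fin_cases j <;>
  simp only [repV_apply, der_apply, vec, mult, Matrix.sub_apply, Matrix.add_apply, Matrix.mul_apply,
    Fin.sum_univ_two, K_apply, Matrix.toBlocks₁₁, Matrix.toBlocks₁₂, Matrix.toBlocks₂₁,
    Matrix.toBlocks₂₂, Matrix.of_apply, opL_apply, opR_apply, opK_apply, Algebra.smul_def, map_add,
    opKV, opRV, Pi.add_apply, Pi.sub_apply, Pi.neg_apply, Pi.mul_apply, Pi.algebraMap_apply,
    Fin.isValue, Fin.zero_eta, Fin.mk_one, zero_ne_one, one_ne_zero, if_true, if_false] <;>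
  ring

/-- The derivative dual to the entries of the adjugate of `z`. -/
def cP (𝒟 : ConformalCalculus A) (a b : Fin 2) : A →ₗ[ℂ] A :=
  if a = b then (𝒟.P (1 - a) (1 - b)).toLinearMap else -(𝒟.P (1 - a) (1 - b)).toLinearMap

theorem cP_00 (φ : A) : 𝒟.cP 0 0 φ = 𝒟.P 1 1 φ := rfl
theorem cP_11 (φ : A) : 𝒟.cP 1 1 φ = 𝒟.P 0 0 φ := rfl
theorem cP_01 (φ : A) : 𝒟.cP 0 1 φ = -𝒟.P 1 0 φ := rfl
theorem cP_10 (φ : A) : 𝒟.cP 1 0 φ = -𝒟.P 0 1 φ := rfl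

theorem harmonic_cP {n : ℤ} {φ : A} (h : φ ∈ 𝒟.harmonic n) (a b : Fin 2) :
    𝒟.cP a b φ ∈ 𝒟.harmonic (n - 1) := by
  rw [cP]; split_ifs
  · exact harmonic_P h _ _
  · exact neg_mem (harmonic_P h _ _)

/-- The coefficient `z i a * z b j` differs from `z b a * z i j` by a 2 × 2 minor of `z`, which is
zero or ± det. The first part is then summed by Euler's identity. -/
theorem opK_eq {n : ℤ} {φ : A} (h : φ ∈ 𝒟.L n) (a b : Fin 2) :
    𝒟.opK a b φ = (n + 1) * (𝒟.z b a * φ) - 𝒟.det * 𝒟.cP b a φ := by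
  have e := 𝒟.euler h
  fin_cases a <;> fin_cases b <;>
    simp only [Fin.zero_eta, Fin.mk_one, opK_apply, cP_00, cP_11, cP_01, cP_10, det]
  · linear_combination 𝒟.z 0 0 * e
  · linear_combination 𝒟.z 1 0 * e
  · linear_combination 𝒟.z 0 1 * e
  · linear_combination 𝒟.z 1 1 * e

/-- A quarter of the Laplacian. -/
def lap (𝒟 : ConformalCalculus A) (φ : A) : A := 𝒟.P 0 0 (𝒟.P 1 1 φ) - 𝒟.P 0 1 (𝒟.P 1 0 φ)

theorem mem_harmonic_iff {n : ℤ} {φ : A} : φ ∈ 𝒟.harmonic n ↔ φ ∈ 𝒟.L n ∧ 𝒟.lap φ = 0 := by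
  rw [lap, sub_eq_zero]; rfl

theorem lap_z_mul (a b : Fin 2) (φ : A) : 𝒟.lap (𝒟.z a b * φ) = 𝒟.z a b * 𝒟.lap φ + 𝒟.cP a b φ := by
  fin_cases a <;> fin_cases b <;>
    simp [lap, cP_00, cP_11, cP_01, cP_10, P_z] <;> ring

theorem lap_det_mul {n : ℤ} {φ : A} (h : φ ∈ 𝒟.L n) :
    𝒟.lap (𝒟.det * φ) = 𝒟.det * 𝒟.lap φ + (n + 2) * φ := by
  have e := 𝒟.euler h
  simp only [lap, det, sub_mul, map_sub, map_add, Derivation.leibniz, P_z, smul_eq_mul]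
  simp
  linear_combination e

theorem lap_intCast_mul (m : ℤ) (φ : A) : 𝒟.lap ((m : A) * φ) = m * 𝒟.lap φ := by
  simp [lap]; ring

theorem lap_sub (φ ψ : A) : 𝒟.lap (φ - ψ) = 𝒟.lap φ - 𝒟.lap ψ := by
  simp [lap]; ring

theorem lap_add (φ ψ : A) : 𝒟.lap (φ + ψ) = 𝒟.lap φ + 𝒟.lap ψ := by
  simp [lap]; ring

/-- The Laplacian of the first term of `opK_eq` gives (n+1) times `cP b a φ`. In the second term `cP
b a φ` has degree n - 1, and multiplication by det contributes (n - 1) + 2 = n + 1 times the same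
function, so the two cancel. The multiplier is what makes the constants agree. -/
theorem harmonic_opK {n : ℤ} {φ : A} (h : φ ∈ 𝒟.harmonic n) (a b : Fin 2) :
    𝒟.opK a b φ ∈ 𝒟.harmonic (n + 1) := by
  have h' := harmonic_cP h b a
  have hl := (mem_harmonic_iff.1 h).2
  have hl' := (mem_harmonic_iff.1 h').2
  have e : 𝒟.opK a b φ = ((n + 1 : ℤ) : A) * (𝒟.z b a * φ) - 𝒟.det * 𝒟.cP b a φ := by
    rw [opK_eq h.1]; push_cast; rfl
  rw [e, mem_harmonic_iff]
  refine ⟨sub_mem (intCast_mul_mem (𝒟.z_mul_mem h.1 _ _))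
    (L_cast (det_mul_mem h'.1) (by ring)), ?_⟩
  rw [lap_sub, lap_intCast_mul, lap_z_mul, lap_det_mul h'.1, hl, hl']
  push_cast; ring

theorem harmonic_opL {n : ℤ} {φ : A} (h : φ ∈ 𝒟.harmonic n) (a b : Fin 2) :
    𝒟.opL a b φ ∈ 𝒟.harmonic n := by
  have h0 := mem_harmonic_iff.1 (harmonic_P h a 0)
  have h1 := mem_harmonic_iff.1 (harmonic_P h a 1)
  rw [opL_apply, mem_harmonic_iff]
  refine ⟨add_mem (L_cast (𝒟.z_mul_mem h0.1 _ _) (by ring))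
    (L_cast (𝒟.z_mul_mem h1.1 _ _) (by ring)), ?_⟩
  rw [lap_add, lap_z_mul, lap_z_mul, h0.2, h1.2]
  have := h.2
  fin_cases a <;> fin_cases b <;>
    simp [cP_00, cP_11, cP_01, cP_10, this, 𝒟.P_comm 1 1 0 0, 𝒟.P_comm 1 0 0 1,
      𝒟.P_comm 0 1 0 0, 𝒟.P_comm 1 1 1 0]

theorem harmonic_transpose (n : ℤ) : 𝒟.transpose.harmonic n = 𝒟.harmonic n := by
  ext φ
  show _ ∧ 𝒟.P 0 0 (𝒟.P 1 1 φ) = 𝒟.P 1 0 (𝒟.P 0 1 φ) ↔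
    _ ∧ 𝒟.P 0 0 (𝒟.P 1 1 φ) = 𝒟.P 0 1 (𝒟.P 1 0 φ)
  rw [𝒟.P_comm 1 0 0 1]; rfl

theorem harmonic_opR {n : ℤ} {φ : A} (h : φ ∈ 𝒟.harmonic n) (a b : Fin 2) :
    𝒟.opR a b φ ∈ 𝒟.harmonic n := by
  rw [← harmonic_transpose] at h ⊢
  exact harmonic_opL (𝒟 := 𝒟.transpose) h b a

theorem harmonic_star {n : ℤ} {φ : A} (h : φ ∈ 𝒟.harmonic n) : star φ ∈ 𝒟.harmonic n := by
  refine ⟨𝒟.star_mem h.1, ?_⟩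
  have e (ψ : A) : star (𝒟.P 1 0 ψ) = -𝒟.P 0 1 (star ψ) := 𝒟.transpose.star_P01 ψ
  have h2 := congrArg star h.2
  rw [𝒟.star_P00, 𝒟.star_P01, e, ← star_star (𝒟.P 1 1 (star (𝒟.P 1 1 φ)))] at h2
  rw [𝒟.P_comm 0 0 1 1]
  have e' (ψ : A) : star (𝒟.P 1 1 ψ) = 𝒟.P 0 0 (star ψ) := by
    rw [← star_star (𝒟.P 0 0 (star ψ)), 𝒟.star_P00, star_star]
  rw [star_star, e'] at h2
  rw [h2, map_neg, neg_neg, 𝒟.P_comm 1 0 0 1]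

/-- As the components are harmonic, only first derivatives survive in the Laplacian of a row of z f,
and their sum is one of the regularity equations. -/
theorem harmonic_z_mul_regular {n : ℤ} {f : Fin 2 → A} (h : f ∈ 𝒟.regular n) (j : Fin 2) :
    𝒟.z j 0 * f 0 + 𝒟.z j 1 * f 1 ∈ 𝒟.harmonic (n + 1) := by
  rw [mem_harmonic_iff]
  refine ⟨add_mem (𝒟.z_mul_mem (h.1 0) _ _) (𝒟.z_mul_mem (h.1 1) _ _), ?_⟩
  have h0 := (mem_harmonic_iff.1 (regular_harmonic h 0)).2
  have h1 := (mem_harmonic_iff.1 (regular_harmonic h 1)).2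
  rw [lap_add, lap_z_mul, lap_z_mul, h0, h1]
  fin_cases j <;> simp [cP_00, cP_11, cP_01, cP_10, h.2]

theorem regular_opL {n : ℤ} {f : Fin 2 → A} (h : f ∈ 𝒟.regular n) (a b : Fin 2) :
    (fun j => 𝒟.opL a b (f j)) ∈ 𝒟.regular n := by
  refine ⟨fun j => (harmonic_opL (regular_harmonic h j) a b).1, fun c => ?_⟩
  have e (i d : Fin 2) : 𝒟.P c 1 (𝒟.P i d (f 0)) = 𝒟.P c 0 (𝒟.P i d (f 1)) :=
    (regular_P h i d).2 c
  have h0 := h.2 a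
  simp only [opL_apply, map_add, Derivation.leibniz, smul_eq_mul, e, P_z]
  fin_cases b <;> fin_cases c <;> simp [h0] <;> ring

theorem regular_opRV {n : ℤ} {f : Fin 2 → A} (h : f ∈ 𝒟.regular n) (a b : Fin 2) :
    𝒟.opRV a b f ∈ 𝒟.regular n := by
  refine ⟨fun j => add_mem (harmonic_opR (regular_harmonic h j) a b).1 ?_, fun c => ?_⟩
  · split_ifs
    exacts [h.1 b, zero_mem _]
  have e (i d : Fin 2) : 𝒟.P c 1 (𝒟.P i d (f 0)) = 𝒟.P c 0 (𝒟.P i d (f 1)) :=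
    (regular_P h i d).2 c
  have h0 := h.2 0
  have h1 := h.2 1
  simp only [opRV, opR_apply, map_add, Derivation.leibniz, smul_eq_mul, e, P_z]
  fin_cases a <;> fin_cases b <;> fin_cases c <;> simp [h0, h1] <;> ring

theorem regular_opKV {n : ℤ} {f : Fin 2 → A} (h : f ∈ 𝒟.regular n) (a b : Fin 2) :
    𝒟.opKV a b f ∈ 𝒟.regular (n + 1) := by
  refine ⟨fun j => add_mem (harmonic_opK (regular_harmonic h j) a b).1 ?_, fun c => ?_⟩
  · split_ifs
    exacts [add_mem (𝒟.z_mul_mem (h.1 0) _ _) (𝒟.z_mul_mem (h.1 1) _ _), zero_mem _]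
  have e (i d : Fin 2) : 𝒟.P c 1 (𝒟.P i d (f 0)) = 𝒟.P c 0 (𝒟.P i d (f 1)) :=
    (regular_P h i d).2 c
  have h0 := h.2 0
  have h1 := h.2 1
  simp only [opKV, opK_apply, map_add, Derivation.leibniz, smul_eq_mul, e, P_z]
  fin_cases a <;> fin_cases b <;> fin_cases c <;> simp [P_z, h0, h1] <;> ring

/-! ### The quadratic operators -/

/-- By `opK_eq` in degree n - 1, the det terms add up to a multiple of the Laplacian of φ and
vanish; the remaining terms are n times the Euler operator. In `sum_P_opK` the product rule shifts
this to (n+2)². -/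
theorem sum_opK_P {n : ℤ} {φ : A} (h : φ ∈ 𝒟.harmonic n) :
    ∑ a, ∑ b, 𝒟.opK b a (𝒟.P a b φ) = (n : A) ^ 2 * φ := by
  have e := 𝒟.euler h.1
  simp only [fun a b => opK_eq (harmonic_P h a b).1 b a, Fin.sum_univ_two, cP_00, cP_01, cP_10, cP_11,
    𝒟.P_comm 1 1 0 0, 𝒟.P_comm 1 0 0 1, h.2]
  push_cast
  linear_combination (n : A) * e

theorem sum_P_opK {n : ℤ} {φ : A} (h : φ ∈ 𝒟.harmonic n) :
    ∑ a, ∑ b, 𝒟.P a b (𝒟.opK b a φ) = ((n : A) + 2) ^ 2 * φ := by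
  have e := 𝒟.euler h.1
  simp [fun a b => opK_eq h.1 b a, Fin.sum_univ_two, cP_00, cP_01, cP_10, cP_11, det, P_z,
    𝒟.P_comm 1 1 0 0, 𝒟.P_comm 1 0 0 1, h.2]
  linear_combination (n : A) * e

/-- The spin part of `opKV` adds to n² the Euler operator, by regularity, hence another n; in the
reverse order it adds n + 2 to (n+2)². -/
theorem sum_opKV_P {n : ℤ} {f : Fin 2 → A} (h : f ∈ 𝒟.regular n) (j : Fin 2) :
    ∑ a, ∑ b, 𝒟.opKV b a (fun i => 𝒟.P a b (f i)) j = (n : A) * (n + 1) * f j := by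
  have e := 𝒟.euler (h.1 j)
  have e1 := sum_opK_P (regular_harmonic h j)
  simp only [opKV, Finset.sum_add_distrib, e1]
  have h0 := h.2 0
  have h1 := h.2 1
  fin_cases j <;> simp [Fin.sum_univ_two, h0, h1] at e ⊢ <;> linear_combination e

theorem sum_P_opKV {n : ℤ} {f : Fin 2 → A} (h : f ∈ 𝒟.regular n) (j : Fin 2) :
    ∑ a, ∑ b, 𝒟.P a b (𝒟.opKV b a f j) = ((n : A) + 2) * (n + 3) * f j := by
  have e := 𝒟.euler (h.1 j)
  have e1 := sum_P_opK (regular_harmonic h j)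
  simp only [opKV, Finset.sum_add_distrib, e1, map_add]
  have h0 := h.2 0
  have h1 := h.2 1
  fin_cases j <;> simp [Fin.sum_univ_two, h0, h1, P_z] at e ⊢ <;> linear_combination e

end ConformalCalculus
end QuatConf
end
noncomputable section
namespace QuatConf
namespace ConformalCalculus

variable {A : Type*} [CommRing A] [StarRing A] [Algebra ℂ A] [StarModule ℂ A]
  {𝒟 : ConformalCalculus A}

/-! ### Integrals over the sphere -/

theorem opL_mul (a b : Fin 2) (φ ψ : A) :
    𝒟.opL a b (φ * ψ) = 𝒟.opL a b φ * ψ + φ * 𝒟.opL a b ψ := by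
  simp [opL_apply]; ring

theorem opL_add_opL {n : ℤ} {φ : A} (h : φ ∈ 𝒟.L n) :
    𝒟.opL 0 0 φ + 𝒟.opL 1 1 φ = (n : A) * φ := by
  rw [← 𝒟.euler h]; simp only [opL_apply]; ring

theorem I_intCast_mul (n : ℤ) (φ : A) : 𝒟.I ((n : A) * φ) = n * 𝒟.I φ := by
  rw [← map_intCast (algebraMap ℂ A), ← Algebra.smul_def, map_smul, smul_eq_mul]

theorem I_opL01 (φ : A) : 𝒟.I (𝒟.opL 0 1 φ) = 0 := 𝒟.I_left01 φ
theorem I_opL10 (φ : A) : 𝒟.I (𝒟.opL 1 0 φ) = 0 := 𝒟.I_left10 φ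
theorem I_opL_diag (φ : A) : 𝒟.I (𝒟.opL 0 0 φ) = 𝒟.I (𝒟.opL 1 1 φ) := 𝒟.I_left_diag φ

/-- Applied to φψ: the off-diagonal operators integrate to zero, while the two diagonal ones have
equal integrals and their sum is the Euler operator. This is why the factor 2 appears. -/
theorem I_opL {n m : ℤ} {φ ψ : A} (hφ : φ ∈ 𝒟.L n) (hψ : ψ ∈ 𝒟.L m) (a b : Fin 2) :
    2 * (𝒟.I (𝒟.opL a b φ * ψ) + 𝒟.I (φ * 𝒟.opL a b ψ))
      = if a = b then (n + m) * 𝒟.I (φ * ψ) else 0 := by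
  have h1 := congrArg (fun t => 𝒟.I (t * ψ)) (opL_add_opL hφ)
  have h2 := congrArg (fun t => 𝒟.I (φ * t)) (opL_add_opL hψ)
  have h3 := 𝒟.I_opL_diag (φ * ψ)
  simp only [mul_assoc, mul_left_comm φ, I_intCast_mul, add_mul, mul_add, map_add, opL_mul] at h1 h2 h3
  have h01 := 𝒟.I_opL01 (φ * ψ)
  have h10 := 𝒟.I_opL10 (φ * ψ)
  simp only [opL_mul, map_add] at h01 h10
  fin_cases a <;> fin_cases b <;> simp
  · linear_combination h1 + h2 + h3
  · exact h01
  · exact h10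
  · linear_combination h1 + h2 - h3

theorem I_opR {n m : ℤ} {φ ψ : A} (hφ : φ ∈ 𝒟.L n) (hψ : ψ ∈ 𝒟.L m) (a b : Fin 2) :
    2 * (𝒟.I (𝒟.opR a b φ * ψ) + 𝒟.I (φ * 𝒟.opR a b ψ))
      = if a = b then (n + m) * 𝒟.I (φ * ψ) else 0 := by
  have := I_opL (𝒟 := 𝒟.transpose) hφ hψ b a
  rw [if_congr (eq_comm (a := b) (b := a)) rfl rfl] at this
  exact this

/-! ### Orthogonality of degrees and the gap in degree -1 -/

/-- The Casimir operator of the left rotations. -/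
def casimir (𝒟 : ConformalCalculus A) (φ : A) : A :=
  2 * 𝒟.opL 0 1 (𝒟.opL 1 0 φ) + 2 * 𝒟.opL 1 0 (𝒟.opL 0 1 φ)
    + (𝒟.opL 0 0 (𝒟.opL 0 0 φ - 𝒟.opL 1 1 φ) - 𝒟.opL 1 1 (𝒟.opL 0 0 φ - 𝒟.opL 1 1 φ))

/-- A form of Capelli's identity: with E the Euler operator, the Casimir operator equals E(E + 2) up
to a multiple of det times the Laplacian. -/
theorem casimir_harmonic {n : ℤ} {φ : A} (h : φ ∈ 𝒟.harmonic n) :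
    𝒟.casimir φ = (n : A) * (n + 2) * φ := by
  have e := 𝒟.euler h.1
  have e' (a b : Fin 2) := 𝒟.euler (𝒟.P_mem h.1 a b)
  have e00 := e' 0 0
  have e01 := e' 0 1
  have e10 := e' 1 0
  have e11 := e' 1 1
  simp only [casimir, opL_apply, map_add, map_sub, Derivation.leibniz, smul_eq_mul, P_z]
  simp [𝒟.P_comm 1 1 0 0, 𝒟.P_comm 1 0 0 1, 𝒟.P_comm 1 0 0 0, 𝒟.P_comm 0 1 0 0, 𝒟.P_comm 1 1 1 0,
    𝒟.P_comm 1 1 0 1, h.2] at e00 e01 e10 e11 ⊢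
  linear_combination 𝒟.z 0 0 * e00 + 𝒟.z 0 1 * e01 + 𝒟.z 1 0 * e10 + 𝒟.z 1 1 * e11 + (n + 2) * e

theorem I_opL01_mul (φ ψ : A) : 𝒟.I (𝒟.opL 0 1 φ * ψ) = -𝒟.I (φ * 𝒟.opL 0 1 ψ) := by
  have := 𝒟.I_opL01 (φ * ψ)
  rw [opL_mul, map_add] at this
  linear_combination this

theorem I_opL10_mul (φ ψ : A) : 𝒟.I (𝒟.opL 1 0 φ * ψ) = -𝒟.I (φ * 𝒟.opL 1 0 ψ) := by
  have := 𝒟.I_opL10 (φ * ψ)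
  rw [opL_mul, map_add] at this
  linear_combination this

theorem I_opL_diag_mul (φ ψ : A) : 𝒟.I ((𝒟.opL 0 0 φ - 𝒟.opL 1 1 φ) * ψ)
    = -𝒟.I (φ * (𝒟.opL 0 0 ψ - 𝒟.opL 1 1 ψ)) := by
  have := 𝒟.I_opL_diag (φ * ψ)
  simp only [opL_mul, map_add, sub_mul, mul_sub, map_sub] at this ⊢
  linear_combination this

theorem I_two_mul (φ : A) : 𝒟.I (2 * φ) = 2 * 𝒟.I φ := by
  simpa using I_intCast_mul (𝒟 := 𝒟) 2 φ

/-- One integration by parts. The right side is symmetric in φ and ψ, and for ψ = `star φ` it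
becomes a sum of squared norms. -/
theorem I_casimir_mul (φ ψ : A) :
    𝒟.I (𝒟.casimir φ * ψ) = -(2 * 𝒟.I (𝒟.opL 1 0 φ * 𝒟.opL 0 1 ψ)
      + 2 * 𝒟.I (𝒟.opL 0 1 φ * 𝒟.opL 1 0 ψ)
      + 𝒟.I ((𝒟.opL 0 0 φ - 𝒟.opL 1 1 φ) * (𝒟.opL 0 0 ψ - 𝒟.opL 1 1 ψ))) := by
  simp only [casimir, add_mul, mul_assoc, map_add, I_two_mul, I_opL01_mul, I_opL10_mul,
    I_opL_diag_mul]
  ring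

/-- Harmonic functions of different degrees are orthogonal. -/
theorem I_mul_eq_zero {n m : ℤ} {φ ψ : A} (hφ : φ ∈ 𝒟.harmonic n) (hψ : ψ ∈ 𝒟.harmonic m)
    (h1 : n ≠ m) (h2 : n + m ≠ -2) : 𝒟.I (φ * ψ) = 0 := by
  -- Symmetry forces the eigenvalues n(n+2) and m(m+2) to agree unless the integral vanishes; their
  -- difference is (n - m)(n + m + 2).
  have e : 𝒟.I (𝒟.casimir φ * ψ) = 𝒟.I (𝒟.casimir ψ * φ) := by
    rw [I_casimir_mul, I_casimir_mul]
    simp only [mul_comm (𝒟.opL _ _ ψ), mul_comm (𝒟.opL _ _ ψ - _)]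
    ring
  have c1 : ((n : A) * (n + 2)) = ((n * (n + 2) : ℤ) : A) := by push_cast; ring
  have c2 : ((m : A) * (m + 2)) = ((m * (m + 2) : ℤ) : A) := by push_cast; ring
  rw [casimir_harmonic hφ, casimir_harmonic hψ, c1, c2, mul_assoc, mul_assoc, I_intCast_mul,
    I_intCast_mul, mul_comm ψ] at e
  have h : ((n * (n + 2) - m * (m + 2) : ℤ) : ℂ) * 𝒟.I (φ * ψ) = 0 := by
    push_cast at e ⊢; linear_combination e
  refine (mul_eq_zero.1 h).resolve_left ?_
  refine Int.cast_ne_zero.2 ?_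
  have : n * (n + 2) - m * (m + 2) = (n - m) * (n + m + 2) := by ring
  rw [this]
  exact mul_ne_zero (sub_ne_zero.2 h1) (by omega)

theorem star_z11 : star (𝒟.z 1 1) = 𝒟.z 0 0 := by rw [← 𝒟.star_z00, star_star]

theorem star_z10 : star (𝒟.z 1 0) = -𝒟.z 0 1 := 𝒟.transpose.star_z01

theorem star_P10 (φ : A) : star (𝒟.P 1 0 φ) = -𝒟.P 0 1 (star φ) := 𝒟.transpose.star_P01 φ

theorem star_P11 (φ : A) : star (𝒟.P 1 1 φ) = 𝒟.P 0 0 (star φ) := by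
  rw [← star_star (𝒟.P 0 0 (star φ)), 𝒟.star_P00, star_star]

theorem star_opL00 (φ : A) : star (𝒟.opL 0 0 φ) = 𝒟.opL 1 1 (star φ) := by
  simp [opL_apply, star_P00, star_P01, star_z00, star_z01]; ring

theorem star_opL11 (φ : A) : star (𝒟.opL 1 1 φ) = 𝒟.opL 0 0 (star φ) := by
  simp [opL_apply, star_P10, star_P11, star_z10, star_z11]; ring

theorem star_opL01 (φ : A) : star (𝒟.opL 0 1 φ) = -𝒟.opL 1 0 (star φ) := by
  simp [opL_apply, star_P00, star_P01, star_z10, star_z11]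

theorem star_opL10 (φ : A) : star (𝒟.opL 1 0 φ) = -𝒟.opL 0 1 (star φ) := by
  simp [opL_apply, star_P10, star_P11, star_z00, star_z01]

theorem I_pos' {n : ℤ} {φ : A} (h : φ ∈ 𝒟.L n) : 0 ≤ (𝒟.I (φ * star φ)).re := by
  by_cases h0 : φ = 0
  · simp [h0]
  · exact (𝒟.I_pos h h0).le

/-- There are no harmonic functions of degree `-1`. -/
theorem harmonic_neg_one {φ : A} (h : φ ∈ 𝒟.harmonic (-1)) : φ = 0 := by
  by_contra h0
  -- Paired with `star φ`, the Casimir operator gives a nonnegative number, whereas its eigenvalue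
  -- n(n+2) at n = -1 is -1.
  have e := I_casimir_mul (𝒟 := 𝒟) φ (star φ)
  have e1 : 𝒟.opL 0 1 (star φ) = -star (𝒟.opL 1 0 φ) := by rw [star_opL10, neg_neg]
  have e2 : 𝒟.opL 1 0 (star φ) = -star (𝒟.opL 0 1 φ) := by rw [star_opL01, neg_neg]
  have e3 : 𝒟.opL 0 0 (star φ) - 𝒟.opL 1 1 (star φ) = -star (𝒟.opL 0 0 φ - 𝒟.opL 1 1 φ) := by
    rw [star_sub, star_opL00, star_opL11]; ring
  rw [casimir_harmonic h, e1, e2, e3] at e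
  simp only [mul_neg, map_neg] at e
  have e4 : ((-1 : ℤ) : A) * (((-1 : ℤ) : A) + 2) * φ * star φ = -(φ * star φ) := by
    push_cast; ring
  rw [e4, map_neg] at e
  have p0 := 𝒟.I_pos h.1 h0
  have p1 := I_pos' (𝒟 := 𝒟) (harmonic_opL h 1 0).1
  have p2 := I_pos' (𝒟 := 𝒟) (harmonic_opL h 0 1).1
  have p3 := I_pos' (𝒟 := 𝒟) (sub_mem (harmonic_opL h 0 0).1 (harmonic_opL h 1 1).1)
  have := congrArg Complex.re e
  simp only [Complex.neg_re, Complex.add_re, Complex.mul_re, Complex.re_ofNat, Complex.im_ofNat,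
    zero_mul, sub_zero] at this
  linarith

/-! ### Integration by parts for the derivatives `P a b` on the sphere -/

/-- The derivative of the norm. -/
def cof (𝒟 : ConformalCalculus A) (a b : Fin 2) : A :=
  if a = b then 𝒟.z (1 - a) (1 - b) else -𝒟.z (1 - a) (1 - b)

/-- `P a b` is not tangent to the sphere. As det = 1 there, it may be replaced by det · `P a b`,
which is a combination of rotation operators applied to multiples of F by entries of `z`, plus a
multiple of `cof a b * F`. -/
theorem I_P_aux {n : ℤ} {F : A} (h : 𝒟.opL 0 0 F + 𝒟.opL 1 1 F = (n : A) * F) (a b : Fin 2) :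
    2 * 𝒟.I (𝒟.P a b F) = (n + 3) * 𝒟.I (𝒟.cof a b * F) := by
  -- For linear w, the product w F has degree n + 1, and the diagonal operator carries half of the
  -- Euler operator under the integral. Together with the zeroth-order term, worth 2, this makes n +
  -- 3.
  have key (w : A) (hw : 𝒟.opL 0 0 w + 𝒟.opL 1 1 w = w) :
      2 * 𝒟.I (𝒟.opL 0 0 (w * F)) = (n + 1) * 𝒟.I (w * F) := by
    have h1 := 𝒟.I_opL_diag (w * F)
    have h2 : 𝒟.opL 0 0 (w * F) + 𝒟.opL 1 1 (w * F) = ((n + 1 : ℤ) : A) * (w * F) := by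
      rw [opL_mul, opL_mul]; push_cast; linear_combination F * hw + w * h
    have h3 := congrArg 𝒟.I h2
    rw [map_add, I_intCast_mul] at h3
    push_cast at h3
    linear_combination h1 + h3
  rw [← 𝒟.I_det (𝒟.P a b F)]
  fin_cases a <;> fin_cases b
  · have k := key (𝒟.z 1 1) (by simp [opL_apply, P_z])
    have e : (𝒟.z 0 0 * 𝒟.z 1 1 - 𝒟.z 0 1 * 𝒟.z 1 0) * 𝒟.P 0 0 F =
        𝒟.opL 0 0 (𝒟.z 1 1 * F) - 𝒟.opL 0 1 (𝒟.z 0 1 * F) + 𝒟.z 1 1 * F := by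
      simp [opL_apply, P_z]; ring
    show 2 * 𝒟.I ((𝒟.z 0 0 * 𝒟.z 1 1 - 𝒟.z 0 1 * 𝒟.z 1 0) * 𝒟.P 0 0 F)
      = (n + 3) * 𝒟.I (𝒟.z 1 1 * F)
    rw [e, map_add, map_sub, I_opL01]
    linear_combination k
  · have k := key (𝒟.z 1 0) (by simp [opL_apply, P_z])
    have e : (𝒟.z 0 0 * 𝒟.z 1 1 - 𝒟.z 0 1 * 𝒟.z 1 0) * 𝒟.P 0 1 F =
        -𝒟.opL 0 0 (𝒟.z 1 0 * F) + 𝒟.opL 0 1 (𝒟.z 0 0 * F) - 𝒟.z 1 0 * F := by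
      simp [opL_apply, P_z]; ring
    show 2 * 𝒟.I ((𝒟.z 0 0 * 𝒟.z 1 1 - 𝒟.z 0 1 * 𝒟.z 1 0) * 𝒟.P 0 1 F)
      = (n + 3) * 𝒟.I (-𝒟.z 1 0 * F)
    rw [e, map_sub, map_add, map_neg, I_opL01, neg_mul, map_neg]
    linear_combination -k
  · have k := key (𝒟.z 0 1) (by simp [opL_apply, P_z])
    have e : (𝒟.z 0 0 * 𝒟.z 1 1 - 𝒟.z 0 1 * 𝒟.z 1 0) * 𝒟.P 1 0 F =
        -𝒟.opL 1 1 (𝒟.z 0 1 * F) + 𝒟.opL 1 0 (𝒟.z 1 1 * F) - 𝒟.z 0 1 * F := by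
      simp [opL_apply, P_z]; ring
    show 2 * 𝒟.I ((𝒟.z 0 0 * 𝒟.z 1 1 - 𝒟.z 0 1 * 𝒟.z 1 0) * 𝒟.P 1 0 F)
      = (n + 3) * 𝒟.I (-𝒟.z 0 1 * F)
    rw [e, map_sub, map_add, map_neg, I_opL10, neg_mul, map_neg, ← I_opL_diag]
    linear_combination -k
  · have k := key (𝒟.z 0 0) (by simp [opL_apply, P_z])
    have e : (𝒟.z 0 0 * 𝒟.z 1 1 - 𝒟.z 0 1 * 𝒟.z 1 0) * 𝒟.P 1 1 F =
        𝒟.opL 1 1 (𝒟.z 0 0 * F) - 𝒟.opL 1 0 (𝒟.z 1 0 * F) + 𝒟.z 0 0 * F := by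
      simp [opL_apply, P_z]; ring
    show 2 * 𝒟.I ((𝒟.z 0 0 * 𝒟.z 1 1 - 𝒟.z 0 1 * 𝒟.z 1 0) * 𝒟.P 1 1 F)
      = (n + 3) * 𝒟.I (𝒟.z 0 0 * F)
    rw [e, map_add, map_sub, I_opL10, ← I_opL_diag]
    linear_combination k

theorem I_P {n m : ℤ} {φ ψ : A} (hφ : φ ∈ 𝒟.L n) (hψ : ψ ∈ 𝒟.L m) (a b : Fin 2) :
    2 * (𝒟.I (𝒟.P a b φ * ψ) + 𝒟.I (φ * 𝒟.P a b ψ))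
      = (n + m + 3) * 𝒟.I (𝒟.cof a b * (φ * ψ)) := by
  have e : 𝒟.opL 0 0 (φ * ψ) + 𝒟.opL 1 1 (φ * ψ) = ((n + m : ℤ) : A) * (φ * ψ) := by
    have h1 := opL_add_opL hφ
    have h2 := opL_add_opL hψ
    rw [opL_mul, opL_mul]; push_cast; linear_combination ψ * h1 + φ * h2
  have := I_P_aux e a b
  rw [Derivation.leibniz, smul_eq_mul, smul_eq_mul, map_add, mul_comm ψ] at this
  push_cast at this
  linear_combination this

end ConformalCalculus
end QuatConf
end
noncomputable section
namespace QuatConf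
namespace ConformalCalculus

variable {A : Type*} [CommRing A] [StarRing A] [Algebra ℂ A] [StarModule ℂ A]
  {𝒟 : ConformalCalculus A}

/-! ### Invariant bilinear forms -/

theorem I_det_mul (φ : A) : 𝒟.I (𝒟.det * φ) = 𝒟.I φ := 𝒟.I_det φ

/-- Within one half the exceptional case n + m = -2 occurs only for n = m = -1. -/
theorem I_mul_eq_zero_of_ne {n m : ℤ} {φ ψ : A} (hφ : φ ∈ 𝒟.harmonic n) (hψ : ψ ∈ 𝒟.harmonic m)
    (hs : 0 ≤ n ↔ 0 ≤ m) (h : n ≠ m) : 𝒟.I (φ * ψ) = 0 :=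
  I_mul_eq_zero hφ hψ h (by omega)

/-- The operator `1 + deg`. -/
def degOp (𝒟 : ConformalCalculus A) : A →ₗ[ℂ] A := LinearMap.id + (𝒟.opL 0 0 + 𝒟.opL 1 1)

theorem degOp_apply {n : ℤ} {φ : A} (h : φ ∈ 𝒟.L n) : 𝒟.degOp φ = ((n + 1 : ℤ) : A) * φ := by
  rw [degOp, LinearMap.add_apply, LinearMap.add_apply, opL_add_opL h]
  push_cast; simp; ring

/-- The bilinear form `∫ ((1 + deg) φ) ψ`. -/
def formB (𝒟 : ConformalCalculus A) : A →ₗ[ℂ] A →ₗ[ℂ] ℂ :=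
  ((LinearMap.mul ℂ A).compr₂ 𝒟.I).comp 𝒟.degOp

theorem formB_def (φ ψ : A) : 𝒟.formB φ ψ = 𝒟.I (𝒟.degOp φ * ψ) := rfl

theorem formB_apply {n : ℤ} {φ : A} (h : φ ∈ 𝒟.L n) (ψ : A) :
    𝒟.formB φ ψ = (n + 1) * 𝒟.I (φ * ψ) := by
  rw [formB_def, degOp_apply h, mul_assoc, I_intCast_mul]; push_cast; rfl

/-- The operator adjoint to `P a b`. -/
def opKs (𝒟 : ConformalCalculus A) (a b : Fin 2) : A →ₗ[ℂ] A :=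
  if a = b then 𝒟.opK (1 - a) (1 - b) else -𝒟.opK a b

theorem opKs_eq {n : ℤ} {φ : A} (h : φ ∈ 𝒟.L n) (a b : Fin 2) :
    𝒟.opKs a b φ = ((n + 1 : ℤ) : A) * (𝒟.cof a b * φ) - 𝒟.det * 𝒟.P a b φ := by
  have e (a b : Fin 2) := opK_eq h a b
  push_cast
  fin_cases a <;> fin_cases b
  · exact e 1 1
  · show -𝒟.opK 0 1 φ = (n + 1) * (-𝒟.z 1 0 * φ) - 𝒟.det * 𝒟.P 0 1 φ
    rw [e, cP_10]; ring
  · show -𝒟.opK 1 0 φ = (n + 1) * (-𝒟.z 0 1 * φ) - 𝒟.det * 𝒟.P 1 0 φ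
    rw [e, cP_01]; ring
  · exact e 0 0

theorem harmonic_opKs {n : ℤ} {φ : A} (h : φ ∈ 𝒟.harmonic n) (a b : Fin 2) :
    𝒟.opKs a b φ ∈ 𝒟.harmonic (n + 1) := by
  rw [opKs]; split_ifs
  · exact harmonic_opK h _ _
  · exact neg_mem (harmonic_opK h _ _)

theorem eq_zero_of_harmonic {n : ℤ} {φ : A} (h : φ ∈ 𝒟.harmonic n) (hn : n = -1) : φ = 0 :=
  harmonic_neg_one (hn ▸ h)

theorem I_P_mul {n m : ℤ} {φ ψ : A} (hφ : φ ∈ 𝒟.harmonic n) (hψ : ψ ∈ 𝒟.harmonic m)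
    (hs : 0 ≤ n ↔ 0 ≤ m) (hm : m = n - 1) (a b : Fin 2) :
    𝒟.I (φ * 𝒟.P a b ψ) = 0 ∧
      𝒟.I (𝒟.P a b φ * ψ) = (n + 1) * 𝒟.I (𝒟.cof a b * (φ * ψ)) := by
  have h0 : 𝒟.I (φ * 𝒟.P a b ψ) = 0 :=
    I_mul_eq_zero hφ (harmonic_P hψ a b) (by omega) (by omega)
  have := I_P hφ.1 hψ.1 a b
  rw [h0, hm] at this
  push_cast at this
  exact ⟨h0, by linear_combination this / 2⟩

/-- Only m = n - 1 contributes. There φ is orthogonal to `P a b ψ`, of degree n - 2, so integration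
by parts makes both sides n(n+1) times the integral of `cof a b * (φ * ψ)`. -/
theorem formB_P {n m : ℤ} {φ ψ : A} (hφ : φ ∈ 𝒟.harmonic n) (hψ : ψ ∈ 𝒟.harmonic m)
    (hs : 0 ≤ n ↔ 0 ≤ m) (a b : Fin 2) :
    𝒟.formB (𝒟.P a b φ) ψ = 𝒟.formB φ (𝒟.opKs a b ψ) := by
  rw [formB_apply hφ.1, formB_apply (𝒟.P_mem hφ.1 a b)]
  by_cases hn : n = -1
  · simp [eq_zero_of_harmonic hφ hn]
  by_cases hm : m = -1
  · simp [eq_zero_of_harmonic hψ hm]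
  by_cases hnm : m = n - 1
  · obtain ⟨h0, h1⟩ := I_P_mul hφ hψ hs hnm a b
    rw [h1, opKs_eq hψ.1, mul_sub, map_sub, mul_left_comm φ, mul_left_comm φ, I_intCast_mul,
      mul_left_comm φ 𝒟.det, I_det_mul, h0, hnm]
    push_cast
    ring
  · rw [I_mul_eq_zero (harmonic_P hφ a b) hψ (by omega) (by omega),
      I_mul_eq_zero hφ (harmonic_opKs hψ a b) (by omega) (by omega), mul_zero, mul_zero]

/-- The asymmetric factor n + 1 is harmless: distinct degrees in one half are orthogonal. -/
theorem formB_comm {n m : ℤ} {φ ψ : A} (hφ : φ ∈ 𝒟.harmonic n) (hψ : ψ ∈ 𝒟.harmonic m)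
    (hs : 0 ≤ n ↔ 0 ≤ m) : 𝒟.formB φ ψ = 𝒟.formB ψ φ := by
  rw [formB_apply hφ.1, formB_apply hψ.1, mul_comm ψ]
  by_cases h : n = m
  · rw [h]
  · rw [I_mul_eq_zero_of_ne hφ hψ hs h, mul_zero, mul_zero]

theorem formB_opKs {n m : ℤ} {φ ψ : A} (hφ : φ ∈ 𝒟.harmonic n) (hψ : ψ ∈ 𝒟.harmonic m)
    (hs : 0 ≤ n ↔ 0 ≤ m) (a b : Fin 2) :
    𝒟.formB (𝒟.opKs a b φ) ψ = 𝒟.formB φ (𝒟.P a b ψ) := by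
  by_cases hn : n = -1
  · simp [eq_zero_of_harmonic hφ hn]
  -- Here `P a b ψ` would leave the half n ≥ 0, but it has degree -1 and so vanishes.
  by_cases hm : m = 0
  · have : 𝒟.P a b ψ = 0 := eq_zero_of_harmonic (harmonic_P hψ a b) (by omega)
    rw [this, map_zero, formB_apply (harmonic_opKs hφ a b).1,
      I_mul_eq_zero (harmonic_opKs hφ a b) hψ (by omega) (by omega), mul_zero]
  rw [formB_comm (harmonic_opKs hφ a b) hψ (by omega), ← formB_P hψ hφ (by omega),
    formB_comm hφ (harmonic_P hψ a b) (by omega)]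

theorem formB_opL {n m : ℤ} {φ ψ : A} (hφ : φ ∈ 𝒟.harmonic n) (hψ : ψ ∈ 𝒟.harmonic m)
    (hs : 0 ≤ n ↔ 0 ≤ m) :
    𝒟.formB (𝒟.opL 0 0 φ) ψ = 𝒟.formB φ (𝒟.opL 1 1 ψ) ∧
    𝒟.formB (𝒟.opL 1 1 φ) ψ = 𝒟.formB φ (𝒟.opL 0 0 ψ) ∧
    𝒟.formB (𝒟.opL 0 1 φ) ψ = -𝒟.formB φ (𝒟.opL 0 1 ψ) ∧
    𝒟.formB (𝒟.opL 1 0 φ) ψ = -𝒟.formB φ (𝒟.opL 1 0 ψ) := by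
  have e (a b : Fin 2) := formB_apply (harmonic_opL hφ a b).1 ψ
  have k (a b : Fin 2) := I_opL hφ.1 hψ.1 a b
  have d := congrArg (fun t => 𝒟.I (φ * t)) (opL_add_opL hψ.1)
  simp only [mul_left_comm φ, I_intCast_mul, mul_add, map_add] at d
  have hz : ((n : ℂ) - m) * 𝒟.I (φ * ψ) = 0 := by
    by_cases h : n = m
    · simp [h]
    · rw [I_mul_eq_zero_of_ne hφ hψ hs h, mul_zero]
  have k00 := k 0 0
  have k11 := k 1 1
  have k01 := k 0 1
  have k10 := k 1 0
  simp at k00 k11 k01 k10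
  simp only [e, formB_apply hφ.1]
  refine ⟨?_, ?_, ?_, ?_⟩
  · linear_combination (n + 1) / 2 * k00 - (n + 1) * d + (n + 1) / 2 * hz
  · linear_combination (n + 1) / 2 * k11 - (n + 1) * d + (n + 1) / 2 * hz
  · linear_combination (n + 1) * k01
  · linear_combination (n + 1) * k10

theorem degOp_transpose (φ : A) : 𝒟.transpose.degOp φ = 𝒟.degOp φ := by
  show φ + (𝒟.opR 0 0 φ + 𝒟.opR 1 1 φ) = φ + (𝒟.opL 0 0 φ + 𝒟.opL 1 1 φ)
  simp only [opL_apply, opR_apply]; ring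

theorem formB_transpose (φ ψ : A) : 𝒟.transpose.formB φ ψ = 𝒟.formB φ ψ := by
  rw [formB_def, formB_def, degOp_transpose]; rfl

theorem formB_opR {n m : ℤ} {φ ψ : A} (hφ : φ ∈ 𝒟.harmonic n) (hψ : ψ ∈ 𝒟.harmonic m)
    (hs : 0 ≤ n ↔ 0 ≤ m) :
    𝒟.formB (𝒟.opR 0 0 φ) ψ = 𝒟.formB φ (𝒟.opR 1 1 ψ) ∧
    𝒟.formB (𝒟.opR 1 1 φ) ψ = 𝒟.formB φ (𝒟.opR 0 0 ψ) ∧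
    𝒟.formB (𝒟.opR 0 1 φ) ψ = -𝒟.formB φ (𝒟.opR 0 1 ψ) ∧
    𝒟.formB (𝒟.opR 1 0 φ) ψ = -𝒟.formB φ (𝒟.opR 1 0 ψ) := by
  have h1 := hφ
  have h2 := hψ
  rw [← harmonic_transpose] at h1 h2
  obtain ⟨e1, e2, e3, e4⟩ := formB_opL (𝒟 := 𝒟.transpose) h1 h2 hs
  simp only [formB_transpose] at e1 e2 e3 e4
  exact ⟨e1, e2, e4, e3⟩

end ConformalCalculus

/-! ### The adjoint for the bilinear forms -/

/-- The anti-automorphism of `𝔤𝔩(4, ℂ)` (up to sign) adjoint with respect to the bilinear forms. -/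
def sharp (x : gl4) : gl4 :=
  Matrix.fromBlocks (-x.toBlocks₁₁.adjugate) x.toBlocks₂₁.adjugate
    x.toBlocks₁₂.adjugate (-x.toBlocks₂₂.adjugate)

theorem bilinear_span_eq_zero {E F : Type*} [AddCommGroup E] [Module ℂ E] [AddCommGroup F]
    [Module ℂ F] (β : E →ₗ[ℂ] F →ₗ[ℂ] ℂ) {S : Set E} {T : Set F}
    (h : ∀ s ∈ S, ∀ t ∈ T, β s t = 0) {f : E} {g : F} (hf : f ∈ Submodule.span ℂ S)
    (hg : g ∈ Submodule.span ℂ T) : β f g = 0 := by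
  have h1 : ∀ s ∈ S, β s g = 0 := fun s hs =>
    LinearMap.eqOn_span (f := β s) (g := 0) (fun t ht => h s hs t ht) hg
  exact LinearMap.eqOn_span (f := β.flip g) (g := 0) (fun s hs => h1 s hs) hf

namespace ConformalCalculus

variable {A : Type*} [CommRing A] [StarRing A] [Algebra ℂ A] [StarModule ℂ A]
  {𝒟 : ConformalCalculus A}

/-- `sharp` collects the adjoints found above: `P a b` and `opKs a b` are adjoint to each other,
diagonal units of one block are exchanged, and off-diagonal ones change sign. -/
theorem formB_repH_harmonic {n m : ℤ} {φ ψ : A} (hφ : φ ∈ 𝒟.harmonic n) (hψ : ψ ∈ 𝒟.harmonic m)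
    (hs : 0 ≤ n ↔ 0 ≤ m) (x : gl4) :
    𝒟.formB (𝒟.repH x φ) ψ + 𝒟.formB φ (𝒟.repH (sharp x) ψ) = 0 := by
  obtain ⟨l1, l2, l3, l4⟩ := formB_opL hφ hψ hs
  obtain ⟨r1, r2, r3, r4⟩ := formB_opR hφ hψ hs
  have p (a b : Fin 2) := formB_P hφ hψ hs a b
  have k (a b : Fin 2) := formB_opKs hφ hψ hs a b
  have p00 := p 0 0
  have p01 := p 0 1
  have p10 := p 1 0
  have p11 := p 1 1
  have k00 := k 0 0
  have k01 := k 0 1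
  have k10 := k 1 0
  have k11 := k 1 1
  simp [opKs] at p00 p01 p10 p11 k00 k01 k10 k11
  simp only [repH_eq, Fin.sum_univ_two, map_add, map_sub, map_neg, map_smul, LinearMap.add_apply,
    LinearMap.sub_apply, LinearMap.neg_apply, LinearMap.smul_apply, smul_eq_mul]
  simp only [l1, l2, l3, l4, r1, r2, r3, r4, p00, p01, p10, p11, k00, k11]
  simp [sharp, Matrix.adjugate_fin_two, Matrix.toBlocks₁₁, Matrix.toBlocks₁₂, Matrix.toBlocks₂₁,
    Matrix.toBlocks₂₂]
  linear_combination -x (.inr 0) (.inl 1) * k01 - x (.inr 1) (.inl 0) * k10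

/-! ### The bilinear form on regular spinors -/

/-- The bilinear form `∫ (f₀ l₁ - f₁ l₀)` on spinors. -/
def formW (𝒟 : ConformalCalculus A) : (Fin 2 → A) →ₗ[ℂ] (Fin 2 → A) →ₗ[ℂ] ℂ :=
  LinearMap.mk₂ ℂ (fun f l => 𝒟.I (f 0 * l 1) - 𝒟.I (f 1 * l 0))
    (fun f g l => by simp only [Pi.add_apply, add_mul, map_add]; ring)
    (fun c f l => by simp only [Pi.smul_apply, smul_mul_assoc, map_smul, smul_sub])
    (fun f g l => by simp only [Pi.add_apply, mul_add, map_add]; ring)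
    (fun c f l => by simp only [Pi.smul_apply, mul_smul_comm, map_smul, smul_sub])

theorem formW_apply (f l : Fin 2 → A) :
    𝒟.formW f l = 𝒟.I (f 0 * l 1) - 𝒟.I (f 1 * l 0) := rfl

theorem formW_antisymm (f l : Fin 2 → A) : 𝒟.formW f l = -𝒟.formW l f := by
  rw [formW_apply, formW_apply, mul_comm (l 0), mul_comm (l 1)]; ring

/-- The operator adjoint to `P a b` on spinors. -/
def opKVs (𝒟 : ConformalCalculus A) (a b : Fin 2) (f : Fin 2 → A) : Fin 2 → A :=
  if a = b then 𝒟.opKV (1 - a) (1 - b) f else -𝒟.opKV a b f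

theorem regular_opKVs {n : ℤ} {f : Fin 2 → A} (h : f ∈ 𝒟.regular n) (a b : Fin 2) :
    𝒟.opKVs a b f ∈ 𝒟.regular (n + 1) := by
  rw [opKVs]; split_ifs
  · exact regular_opKV h _ _
  · exact neg_mem (regular_opKV h _ _)

theorem opKVs_eq (a b : Fin 2) (f : Fin 2 → A) :
    𝒟.opKVs a b f = fun j => 𝒟.opKs a b (f j) +
      if a = b then (if j = 1 - a then 𝒟.z (1 - b) 0 * f 0 + 𝒟.z (1 - b) 1 * f 1 else 0)
      else if j = a then -(𝒟.z b 0 * f 0 + 𝒟.z b 1 * f 1) else 0 := by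
  ext j
  rw [opKVs, opKs]
  by_cases h : a = b
  · subst h
    simp [opKV]
  · by_cases hj : j = a <;> simp [opKV, h, hj] <;> abel

theorem formW_eq_zero {n m : ℤ} {f l : Fin 2 → A} (hf : f ∈ 𝒟.regular n) (hl : l ∈ 𝒟.regular m)
    (h1 : n ≠ m) (h2 : n + m ≠ -2) : 𝒟.formW f l = 0 := by
  rw [formW_apply, I_mul_eq_zero (regular_harmonic hf 0) (regular_harmonic hl 1) h1 h2,
    I_mul_eq_zero (regular_harmonic hf 1) (regular_harmonic hl 0) h1 h2, sub_zero]

theorem regular_neg_one {n : ℤ} {f : Fin 2 → A} (h : f ∈ 𝒟.regular n) (hn : n = -1) : f = 0 :=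
  funext fun j => eq_zero_of_harmonic (regular_harmonic h j) hn

theorem formW_P {n m : ℤ} {f l : Fin 2 → A} (hf : f ∈ 𝒟.regular n) (hl : l ∈ 𝒟.regular m)
    (hs : 0 ≤ n ↔ 0 ≤ m) (a b : Fin 2) :
    𝒟.formW (fun j => 𝒟.P a b (f j)) l = 𝒟.formW f (𝒟.opKVs a b l) := by
  by_cases hn : n = -1
  · simp [regular_neg_one hf hn, formW_apply]
  by_cases hm : m = -1
  · rw [regular_neg_one hl hm, map_zero, opKVs_eq]
    simp [formW_apply]
  by_cases hnm : m = n - 1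
  · have h (i j : Fin 2) := I_P_mul (regular_harmonic hf i) (regular_harmonic hl j) hs hnm a b
    have k (i j : Fin 2) : 𝒟.I (f i * 𝒟.opKs a b (l j)) = n * 𝒟.I (𝒟.cof a b * (f i * l j)) := by
      rw [opKs_eq (hl.1 j), mul_sub, map_sub, mul_left_comm, mul_left_comm (f i), I_intCast_mul,
        mul_left_comm (f i) 𝒟.det, I_det_mul, (h i j).1, hnm]
      push_cast
      ring
    -- Without the spin part the right side has the factor n and the left side n + 1. The missing
    -- copy is the spin part of `opKVs`, converted by the orthogonality of z f, of degree n + 1, to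
    -- l, of degree n - 1.
    have o (i j : Fin 2) : 𝒟.I ((𝒟.z i 0 * f 0 + 𝒟.z i 1 * f 1) * l j) = 0 :=
      I_mul_eq_zero (harmonic_z_mul_regular hf i) (regular_harmonic hl j) (by omega) (by omega)
    rw [formW_apply, formW_apply, (h 0 1).2, (h 1 0).2, opKVs_eq]
    simp only [mul_add, map_add, k]
    have o' (i j : Fin 2) : 𝒟.I (𝒟.z i 0 * (f 0 * l j)) + 𝒟.I (𝒟.z i 1 * (f 1 * l j)) = 0 := by
      rw [← o i j, add_mul, map_add, mul_assoc, mul_assoc]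
    fin_cases a <;> fin_cases b <;>
      simp [cof, mul_add, mul_left_comm (f _), -mul_eq_mul_left_iff]
    · linear_combination -o' 1 0
    · linear_combination -o' 1 1
    · linear_combination o' 0 0
    · linear_combination o' 0 1
  · rw [formW_eq_zero (regular_P hf a b) hl (by omega) (by omega),
      formW_eq_zero hf (regular_opKVs hl a b) (by omega) (by omega)]

theorem formW_opKVs {n m : ℤ} {f l : Fin 2 → A} (hf : f ∈ 𝒟.regular n) (hl : l ∈ 𝒟.regular m)
    (hs : 0 ≤ n ↔ 0 ≤ m) (a b : Fin 2) :
    𝒟.formW (𝒟.opKVs a b f) l = 𝒟.formW f (fun j => 𝒟.P a b (l j)) := by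
  rw [formW_antisymm, ← formW_P hl hf hs.symm, formW_antisymm, neg_neg]

theorem formW_opL {n m : ℤ} {f l : Fin 2 → A} (hf : f ∈ 𝒟.regular n) (hl : l ∈ 𝒟.regular m)
    (hs : 0 ≤ n ↔ 0 ≤ m) :
    𝒟.formW (fun j => 𝒟.opL 0 0 (f j)) l = 𝒟.formW f (fun j => 𝒟.opL 1 1 (l j)) ∧
    𝒟.formW (fun j => 𝒟.opL 1 1 (f j)) l = 𝒟.formW f (fun j => 𝒟.opL 0 0 (l j)) ∧
    𝒟.formW (fun j => 𝒟.opL 0 1 (f j)) l = -𝒟.formW f (fun j => 𝒟.opL 0 1 (l j)) ∧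
    𝒟.formW (fun j => 𝒟.opL 1 0 (f j)) l = -𝒟.formW f (fun j => 𝒟.opL 1 0 (l j)) := by
  by_cases hn : n = -1
  · simp [regular_neg_one hf hn, formW_apply]
  have hn' : (n : ℂ) + 1 ≠ 0 := by
    have : ((n + 1 : ℤ) : ℂ) ≠ 0 := Int.cast_ne_zero.2 (by omega)
    simpa using this
  have h (i j : Fin 2) := formB_opL (regular_harmonic hf i) (regular_harmonic hl j) hs
  -- On a first argument of degree n, `formB` is n + 1 times the plain integral; the nonzero factor
  -- cancels.
  simp only [formB_apply (harmonic_opL (regular_harmonic hf _) _ _).1,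
    formB_apply (regular_harmonic hf _).1, ← mul_neg, mul_right_inj' hn'] at h
  obtain ⟨a1, a2, a3, a4⟩ := h 0 1
  obtain ⟨b1, b2, b3, b4⟩ := h 1 0
  simp only [formW_apply, a1, a2, a3, a4, b1, b2, b3, b4, true_and]
  exact ⟨by ring, by ring⟩

theorem formW_opRV {n m : ℤ} {f l : Fin 2 → A} (hf : f ∈ 𝒟.regular n) (hl : l ∈ 𝒟.regular m)
    (hs : 0 ≤ n ↔ 0 ≤ m) :
    𝒟.formW (𝒟.opRV 0 0 f) l = 𝒟.formW f (𝒟.opRV 1 1 l) ∧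
    𝒟.formW (𝒟.opRV 1 1 f) l = 𝒟.formW f (𝒟.opRV 0 0 l) ∧
    𝒟.formW (𝒟.opRV 0 1 f) l = -𝒟.formW f (𝒟.opRV 0 1 l) ∧
    𝒟.formW (𝒟.opRV 1 0 f) l = -𝒟.formW f (𝒟.opRV 1 0 l) := by
  by_cases hn : n = -1
  · simp [regular_neg_one hf hn, formW_apply, opRV]
  have hn' : (n : ℂ) + 1 ≠ 0 := by
    have : ((n + 1 : ℤ) : ℂ) ≠ 0 := Int.cast_ne_zero.2 (by omega)
    simpa using this
  have h (i j : Fin 2) := formB_opR (regular_harmonic hf i) (regular_harmonic hl j) hs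
  simp only [formB_apply (harmonic_opR (regular_harmonic hf _) _ _).1,
    formB_apply (regular_harmonic hf _).1, ← mul_neg, mul_right_inj' hn'] at h
  obtain ⟨a1, a2, a3, a4⟩ := h 0 1
  obtain ⟨b1, b2, b3, b4⟩ := h 1 0
  refine ⟨?_, ?_, ?_, ?_⟩ <;>
    simp [formW_apply, opRV, add_mul, mul_add, a1, a2, a3, a4, b1, b2, b3, b4] <;> ring

theorem formW_repV_regular {n m : ℤ} {f l : Fin 2 → A} (hf : f ∈ 𝒟.regular n)
    (hl : l ∈ 𝒟.regular m) (hs : 0 ≤ n ↔ 0 ≤ m) (x : gl4) :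
    𝒟.formW (𝒟.repV x f) l + 𝒟.formW f (𝒟.repV (sharp x) l) = 0 := by
  obtain ⟨l1, l2, l3, l4⟩ := formW_opL hf hl hs
  obtain ⟨r1, r2, r3, r4⟩ := formW_opRV hf hl hs
  have p (a b : Fin 2) := formW_P hf hl hs a b
  have k (a b : Fin 2) := formW_opKVs hf hl hs a b
  have p00 := p 0 0
  have p01 := p 0 1
  have p10 := p 1 0
  have p11 := p 1 1
  have k00 := k 0 0
  have k01 := k 0 1
  have k10 := k 1 0
  have k11 := k 1 1
  simp [opKVs] at p00 p01 p10 p11 k00 k01 k10 k11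
  simp only [repV_eq, Fin.sum_univ_two, map_add, map_sub, map_neg, map_smul, LinearMap.add_apply,
    LinearMap.sub_apply, LinearMap.neg_apply, LinearMap.smul_apply, smul_eq_mul]
  simp only [l1, l2, l3, l4, r1, r2, r3, r4, p00, p01, p10, p11, k00, k11]
  simp [sharp, Matrix.adjugate_fin_two, Matrix.toBlocks₁₁, Matrix.toBlocks₁₂, Matrix.toBlocks₂₁,
    Matrix.toBlocks₂₂]
  linear_combination -x (.inr 0) (.inl 1) * k01 - x (.inr 1) (.inl 0) * k10

end ConformalCalculus
end QuatConf
end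
noncomputable section
namespace QuatConf

/-! ### Sums of graded pieces -/

section Graded

variable {E : Type*} [AddCommGroup E] [Module ℂ E]

/-- The sum of the subspaces `W n`, `n ∈ s`. -/
def gspan (W : ℤ → Submodule ℂ E) (s : Set ℤ) : Submodule ℂ E :=
  Submodule.span ℂ {f | ∃ n, n ∈ s ∧ f ∈ W n}

theorem mem_gspan {W : ℤ → Submodule ℂ E} {s : Set ℤ} {n : ℤ} {f : E} (hn : n ∈ s)
    (hf : f ∈ W n) : f ∈ gspan W s := Submodule.subset_span ⟨n, hn, hf⟩

theorem exists_sum_of_mem_gspan {W : ℤ → Submodule ℂ E} {s : Set ℤ} {f : E}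
    (hf : f ∈ gspan W s) : ∃ F : s →₀ E, (∀ n : s, F n ∈ W n) ∧ f = ∑ n ∈ F.support, F n := by
  have h : f ∈ ⨆ n : s, W n := by
    refine (Submodule.span_le.2 ?_ : gspan W s ≤ _) hf
    rintro g ⟨n, hn, hg⟩
    exact Submodule.mem_iSup_of_mem (⟨n, hn⟩ : s) hg
  obtain ⟨F, hF, e⟩ := (Submodule.mem_iSup_iff_exists_finsupp _ _).1 h
  exact ⟨F, hF, e.symm⟩

/-- Components with respect to distinct eigenvalues stay in an invariant subspace. -/
theorem component_mem {κ : Type*} [DecidableEq κ] (K : Module.End ℂ E) (c : κ → ℂ)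
    (hc : Function.Injective c) (U : Submodule ℂ E) (hU : ∀ f ∈ U, K f ∈ U) (T : Finset κ) :
    ∀ F : κ → E, (∀ k, K (F k) = c k • F k) → ∑ k ∈ T, F k ∈ U → ∀ k ∈ T, F k ∈ U := by
  induction T using Finset.induction_on with
  | empty => simp
  | insert a T ha ih =>
    intro F hF hs
    -- Applying K - c a removes the component at a and rescales the others by nonzero numbers.
    have h1 : ∑ k ∈ T, (c k - c a) • F k ∈ U := by
      have h2 := sub_mem (hU _ hs) (U.smul_mem (c a) hs)
      rw [Finset.sum_insert ha, map_add, map_sum, smul_add, Finset.smul_sum, hF a,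
        add_sub_add_left_eq_sub, ← Finset.sum_sub_distrib] at h2
      simpa only [hF, sub_smul] using h2
    have h3 := ih (fun k => (c k - c a) • F k)
      (fun k => by rw [map_smul, hF, smul_comm]) h1
    have h4 : ∀ k ∈ T, F k ∈ U := fun k hk => by
      have hne : c k - c a ≠ 0 := sub_ne_zero.2 (hc.ne (by rintro rfl; exact ha hk))
      exact (U.smul_mem_iff hne).1 (h3 k hk)
    intro k hk
    rcases Finset.mem_insert.1 hk with rfl | hk
    · rw [Finset.sum_insert ha] at hs
      exact (U.add_mem_iff_left (U.sum_mem h4)).1 hs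
    · exact h4 k hk

/-- An irreducibility criterion for a space graded by `ℕ` with lowering and raising operators. -/
theorem eq_bot_or_le_of_ladder {J : Type*} [Fintype J] (W : ℕ → Submodule ℂ E)
    (D R : J → Module.End ℂ E) (c : ℕ → ℂ) (hc : Function.Injective c) (hc0 : c 0 = 0)
    (hD : ∀ k i, ∀ f ∈ W (k + 1), D i f ∈ W k)
    (hcas : ∀ k, ∀ f ∈ W k, ∑ i, R i (D i f) = c k • f)
    (U : Submodule ℂ E) (hUW : U ≤ ⨆ k, W k) (hUD : ∀ i, ∀ f ∈ U, D i f ∈ U)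
    (hUR : ∀ i, ∀ f ∈ U, R i f ∈ U) (hbase : ∀ f ∈ U, f ∈ W 0 → f ≠ 0 → W 0 ≤ U) :
    U = ⊥ ∨ ⨆ k, W k ≤ U := by
  refine or_iff_not_imp_left.2 fun hne => ?_
  obtain ⟨f, hf, hf0⟩ := U.ne_bot_iff.1 hne
  have hck (k : ℕ) : c (k + 1) ≠ 0 := by
    rw [← hc0]; exact hc.ne (Nat.succ_ne_zero k)
  obtain ⟨F, hF, e⟩ := (Submodule.mem_iSup_iff_exists_finsupp _ _).1 (hUW hf)
  -- The sum of the R i ∘ D i preserves U and acts on the pieces with distinct eigenvalues, so U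
  -- contains every homogeneous component of f.
  have hmem := component_mem (∑ i, R i ∘ₗ D i) c hc U
    (fun g hg => by
      rw [LinearMap.sum_apply]
      exact U.sum_mem fun i _ => hUR i _ (hUD i _ hg)) F.support F
    (fun k => by rw [LinearMap.sum_apply]; exact hcas k _ (hF k)) (by rw [← e] at hf; exact hf)
  -- Lowering: if all D i g were zero, the relation with eigenvalue c (k+1) ≠ 0 would give g = 0.
  have hdown : ∀ k, ∀ g ∈ U, g ∈ W k → g ≠ 0 → W 0 ≤ U := by
    intro k
    induction k with
    | zero => exact hbase
    | succ k ih =>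
      intro g hg hgk hg0
      by_cases h : ∃ i, D i g ≠ 0
      · obtain ⟨i, hi⟩ := h
        exact ih _ (hUD i g hg) (hD k i g hgk) hi
      · push Not at h
        have := hcas _ g hgk
        simp only [h, map_zero, Finset.sum_const_zero] at this
        exact absurd this.symm (smul_ne_zero (hck k) hg0)
  -- Raising: the same relation writes g as a combination of R i applied to elements of the piece
  -- below.
  have hup : ∀ k, W 0 ≤ U → W k ≤ U := by
    intro k h0
    induction k with
    | zero => exact h0
    | succ k ih =>
      intro g hg
      have h1 : c (k + 1) • g ∈ U := by
        rw [← hcas _ g hg]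
        exact U.sum_mem fun i _ => hUR i _ (ih (hD k i g hg))
      exact (U.smul_mem_iff (hck k)).1 h1
  have hW0 : W 0 ≤ U := by
    have : ∃ k ∈ F.support, F k ≠ 0 := by
      by_contra h
      push Not at h
      exact hf0 (by rw [← e]; exact Finset.sum_eq_zero h)
    obtain ⟨k, hk, hk0⟩ := this
    exact hdown k _ (hmem k hk) (hF k) hk0
  exact iSup_le fun k => hup k hW0

/-- The image of `ℂ²` is irreducible under operators that act as the off-diagonal units. -/
theorem range_le_of_offdiag (T : (Fin 2 → ℂ) →ₗ[ℂ] E) (U : Submodule ℂ E)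
    (h1 : ∀ s, T s ∈ U → T ![s 1, 0] ∈ U) (h2 : ∀ s, T s ∈ U → T ![0, s 0] ∈ U)
    (s : Fin 2 → ℂ) (hs : T s ∈ U) (h0 : T s ≠ 0) : LinearMap.range T ≤ U := by
  have e1 (a : ℂ) : (![a, 0] : Fin 2 → ℂ) = a • ![1, 0] := by ext j; fin_cases j <;> simp
  have e2 (a : ℂ) : (![0, a] : Fin 2 → ℂ) = a • ![0, 1] := by ext j; fin_cases j <;> simp
  have key : T ![1, 0] ∈ U ∧ T ![0, 1] ∈ U := by
    by_cases hs0 : s 0 = 0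
    · by_cases hs1 : s 1 = 0
      · refine absurd ?_ h0
        have : s = 0 := by ext j; fin_cases j <;> assumption
        rw [this, map_zero]
      · have k1 : T ![1, 0] ∈ U := by
          have := h1 s hs
          rw [e1, map_smul] at this
          exact (U.smul_mem_iff hs1).1 this
        exact ⟨k1, by simpa using h2 _ k1⟩
    · have k1 : T ![0, 1] ∈ U := by
        have := h2 s hs
        rw [e2, map_smul] at this
        exact (U.smul_mem_iff hs0).1 this
      exact ⟨by simpa using h1 _ k1, k1⟩
  rintro _ ⟨t, rfl⟩
  have : t = t 0 • ![1, 0] + t 1 • ![0, 1] := by ext j; fin_cases j <;> simp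
  rw [this, map_add, map_smul, map_smul]
  exact add_mem (U.smul_mem _ key.1) (U.smul_mem _ key.2)

end Graded

/-- The two sets of degrees that occur. -/
def IsHalf (s : Set ℤ) : Prop := s = {n | 0 ≤ n} ∨ s = {n | n < 0}

theorem IsHalf.iff {s : Set ℤ} (hs : IsHalf s) {n m : ℤ} (hn : n ∈ s) (hm : m ∈ s) :
    0 ≤ n ↔ 0 ≤ m := by
  rcases hs with rfl | rfl <;> simp at hn hm <;> omega

/-- A step of length at most one between the halves has to start or end in degree -1, where the
spaces are zero. -/
theorem IsHalf.mem_of {s : Set ℤ} (hs : IsHalf s) {n m : ℤ} (hn : n ∈ s) (h1 : m ≤ n + 1)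
    (h2 : n ≤ m + 1) (h3 : n ≠ -1) (h4 : m ≠ -1) : m ∈ s := by
  rcases hs with rfl | rfl <;> simp at hn ⊢ <;> omega

namespace ConformalCalculus

variable {A : Type*} [CommRing A] [StarRing A] [Algebra ℂ A] [StarModule ℂ A]
  {𝒟 : ConformalCalculus A}

/-! ### Invariance of the graded sums -/

theorem repH_mem {s : Set ℤ} (hs : IsHalf s) (x : gl4) {f : A}
    (hf : f ∈ gspan 𝒟.harmonic s) : 𝒟.repH x f ∈ gspan 𝒟.harmonic s := by
  refine (Submodule.span_le.2 ?_ :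
    gspan 𝒟.harmonic s ≤ (gspan 𝒟.harmonic s).comap (𝒟.repH x)) hf
  rintro φ ⟨n, hn, hφ⟩
  rw [SetLike.mem_coe, Submodule.mem_comap]
  by_cases h1 : n = -1
  · rw [eq_zero_of_harmonic hφ h1, map_zero]; exact zero_mem _
  have key {m : ℤ} {ψ : A} (hψ : ψ ∈ 𝒟.harmonic m) (h2 : m ≤ n + 1) (h3 : n ≤ m + 1) :
      ψ ∈ gspan 𝒟.harmonic s := by
    by_cases h4 : m = -1
    · rw [eq_zero_of_harmonic hψ h4]; exact zero_mem _
    · exact mem_gspan (hs.mem_of hn h2 h3 h1 h4) hψ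
  rw [repH_eq]
  refine add_mem (sum_mem fun a _ => sum_mem fun b _ => add_mem (add_mem (sub_mem (neg_mem ?_) ?_) ?_) ?_) ?_ <;>
    refine Submodule.smul_mem _ _ ?_
  · exact key (harmonic_P hφ a b) (by omega) (by omega)
  · exact key (harmonic_opL hφ a b) (by omega) (by omega)
  · exact key (harmonic_opR hφ a b) (by omega) (by omega)
  · exact key (harmonic_opK hφ a b) (by omega) (by omega)
  · exact key hφ (by omega) (by omega)

theorem repV_mem {s : Set ℤ} (hs : IsHalf s) (x : gl4) {f : Fin 2 → A}
    (hf : f ∈ gspan 𝒟.regular s) : 𝒟.repV x f ∈ gspan 𝒟.regular s := by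
  refine (Submodule.span_le.2 ?_ :
    gspan 𝒟.regular s ≤ (gspan 𝒟.regular s).comap (𝒟.repV x)) hf
  rintro φ ⟨n, hn, hφ⟩
  rw [SetLike.mem_coe, Submodule.mem_comap]
  by_cases h1 : n = -1
  · rw [regular_neg_one hφ h1, map_zero]; exact zero_mem _
  have key {m : ℤ} {ψ : Fin 2 → A} (hψ : ψ ∈ 𝒟.regular m) (h2 : m ≤ n + 1) (h3 : n ≤ m + 1) :
      ψ ∈ gspan 𝒟.regular s := by
    by_cases h4 : m = -1
    · rw [regular_neg_one hψ h4]; exact zero_mem _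
    · exact mem_gspan (hs.mem_of hn h2 h3 h1 h4) hψ
  rw [repV_eq]
  refine add_mem (sum_mem fun a _ => sum_mem fun b _ => add_mem (add_mem (sub_mem (neg_mem ?_) ?_) ?_) ?_) ?_ <;>
    refine Submodule.smul_mem _ _ ?_
  · exact key (regular_P hφ a b) (by omega) (by omega)
  · exact key (regular_opL hφ a b) (by omega) (by omega)
  · exact key (regular_opRV hφ a b) (by omega) (by omega)
  · exact key (regular_opKV hφ a b) (by omega) (by omega)
  · exact key hφ (by omega) (by omega)

/-! ### The lowest and highest pieces -/

theorem P_det (a b : Fin 2) : 𝒟.P a b 𝒟.det = 𝒟.cof a b := by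
  fin_cases a <;> fin_cases b <;> simp [det, cof, P_z]

theorem det_mul_Ninv' : 𝒟.det * 𝒟.Ninv = 1 := 𝒟.det_mul_Ninv

theorem P_Ninv (a b : Fin 2) : 𝒟.P a b 𝒟.Ninv = -(𝒟.cof a b * 𝒟.Ninv ^ 2) := by
  have h := congrArg (𝒟.P a b) 𝒟.det_mul_Ninv'
  rw [Derivation.leibniz, smul_eq_mul, smul_eq_mul, Derivation.map_one_eq_zero, P_det] at h
  linear_combination 𝒟.Ninv * h - 𝒟.P a b 𝒟.Ninv * 𝒟.det_mul_Ninv'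

/-- The derivatives have degree -1 and therefore vanish. -/
theorem harmonic_zero {φ : A} (h : φ ∈ 𝒟.harmonic 0) : ∃ c, φ = algebraMap ℂ A c :=
  𝒟.exists_const φ fun a b => eq_zero_of_harmonic (harmonic_P h a b) (by norm_num)

/-- Dual to degree 0: the raising operators lead to degree -1 and vanish, and by `opKs_eq` at n = -2
this says that all derivatives of det · φ are zero. -/
theorem harmonic_neg_two {φ : A} (h : φ ∈ 𝒟.harmonic (-2)) :
    ∃ c, φ = algebraMap ℂ A c * 𝒟.Ninv := by
  obtain ⟨c, hc⟩ := 𝒟.exists_const (𝒟.det * φ) fun a b => by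
    have h1 := eq_zero_of_harmonic (harmonic_opKs h a b) (by norm_num)
    rw [opKs_eq h.1] at h1
    rw [Derivation.leibniz, smul_eq_mul, smul_eq_mul, P_det]
    push_cast at h1
    linear_combination -h1
  exact ⟨c, by rw [← hc]; linear_combination -φ * 𝒟.det_mul_Ninv'⟩

theorem one_harmonic : (1 : A) ∈ 𝒟.harmonic 0 := ⟨𝒟.one_mem, by simp⟩

theorem Ninv_harmonic : 𝒟.Ninv ∈ 𝒟.harmonic (-2) := by
  refine ⟨by simpa using 𝒟.Ninv_mul_mem 𝒟.one_mem, ?_⟩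
  have h := 𝒟.det_mul_Ninv
  simp [P_Ninv, cof, P_z]
  linear_combination (2 * 𝒟.Ninv ^ 2) * h

theorem z_mul_eq_zero {f : Fin 2 → A} (h : ∀ j, 𝒟.z j 0 * f 0 + 𝒟.z j 1 * f 1 = 0) : f = 0 := by
  have e := 𝒟.det_mul_Ninv
  have h0 := h 0
  have h1 := h 1
  ext j
  fin_cases j <;> simp
  · linear_combination -f 0 * e + 𝒟.Ninv * 𝒟.z 1 1 * h0 - 𝒟.Ninv * 𝒟.z 0 1 * h1
  · linear_combination -f 1 * e - 𝒟.Ninv * 𝒟.z 1 0 * h0 + 𝒟.Ninv * 𝒟.z 0 0 * h1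

theorem regular_neg_two {n : ℤ} {f : Fin 2 → A} (h : f ∈ 𝒟.regular n) (hn : n = -2) : f = 0 :=
  z_mul_eq_zero fun j => eq_zero_of_harmonic (harmonic_z_mul_regular h j) (by omega)

/-- The constant spinors. -/
def constV (_ : ConformalCalculus A) : (Fin 2 → ℂ) →ₗ[ℂ] (Fin 2 → A) :=
  (Algebra.linearMap ℂ A).compLeft (Fin 2)

theorem constV_apply (s : Fin 2 → ℂ) (j : Fin 2) : 𝒟.constV s j = algebraMap ℂ A (s j) := rfl

theorem regular_zero {f : Fin 2 → A} (h : f ∈ 𝒟.regular 0) : f ∈ LinearMap.range 𝒟.constV := by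
  choose c hc using fun j => harmonic_zero (regular_harmonic h j)
  exact ⟨c, funext fun j => (hc j).symm⟩

theorem constV_regular (s : Fin 2 → ℂ) : 𝒟.constV s ∈ 𝒟.regular 0 := by
  refine ⟨fun j => ?_, fun c => by simp [constV_apply]⟩
  rw [constV_apply, Algebra.algebraMap_eq_smul_one]
  exact Submodule.smul_mem _ _ 𝒟.one_mem

/-- The regular spinors `z⁻¹ s / N`. -/
def topV (𝒟 : ConformalCalculus A) : (Fin 2 → ℂ) →ₗ[ℂ] (Fin 2 → A) where
  toFun s := ![𝒟.Ninv * (𝒟.Ninv * (s 0 • 𝒟.z 1 1 - s 1 • 𝒟.z 0 1)),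
    𝒟.Ninv * (𝒟.Ninv * (s 1 • 𝒟.z 0 0 - s 0 • 𝒟.z 1 0))]
  map_add' s t := by
    ext j; fin_cases j <;> simp [add_smul] <;> ring
  map_smul' c s := by
    ext j; fin_cases j <;> simp [mul_smul, mul_sub, smul_sub]

theorem topV_zero (s : Fin 2 → ℂ) : 𝒟.topV s 0 =
    𝒟.Ninv ^ 2 * (algebraMap ℂ A (s 0) * 𝒟.z 1 1 - algebraMap ℂ A (s 1) * 𝒟.z 0 1) := by
  simp only [topV, LinearMap.coe_mk, AddHom.coe_mk, Matrix.cons_val_zero, Algebra.smul_def]; ring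

theorem topV_one (s : Fin 2 → ℂ) : 𝒟.topV s 1 =
    𝒟.Ninv ^ 2 * (algebraMap ℂ A (s 1) * 𝒟.z 0 0 - algebraMap ℂ A (s 0) * 𝒟.z 1 0) := by
  simp only [topV, LinearMap.coe_mk, AddHom.coe_mk, Matrix.cons_val_one, Matrix.cons_val_fin_one,
    Algebra.smul_def]; ring

theorem topV_regular (s : Fin 2 → ℂ) : 𝒟.topV s ∈ 𝒟.regular (-3) := by
  have hz (a b : Fin 2) (c : ℂ) : c • 𝒟.z a b ∈ 𝒟.L 1 :=
    Submodule.smul_mem _ _ (by simpa using 𝒟.z_mul_mem 𝒟.one_mem a b)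
  have hN {φ : A} (h : φ ∈ 𝒟.L 1) : 𝒟.Ninv * (𝒟.Ninv * φ) ∈ 𝒟.L (-3) :=
    𝒟.Ninv_mul_mem (𝒟.Ninv_mul_mem h)
  refine ⟨fun j => ?_, fun c => ?_⟩
  · fin_cases j
    · exact hN (sub_mem (hz _ _ _) (hz _ _ _))
    · exact hN (sub_mem (hz _ _ _) (hz _ _ _))
  · have h := 𝒟.det_mul_Ninv
    rw [topV_zero, topV_one]
    fin_cases c <;> simp [P_Ninv, cof, P_z, Derivation.leibniz_pow]
    · linear_combination (2 * 𝒟.Ninv ^ 2 * algebraMap ℂ A (s 1)) * h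
    · linear_combination (-2 * 𝒟.Ninv ^ 2 * algebraMap ℂ A (s 0)) * h

/-- z f has harmonic entries of degree -2, that is, constants times N⁻¹; inverting z gives f. -/
theorem regular_neg_three {f : Fin 2 → A} (h : f ∈ 𝒟.regular (-3)) :
    f ∈ LinearMap.range 𝒟.topV := by
  choose c hc using fun j => harmonic_neg_two (harmonic_z_mul_regular h j)
  refine ⟨c, ?_⟩
  have e := 𝒟.det_mul_Ninv
  have h0 := hc 0
  have h1 := hc 1
  ext j
  fin_cases j
  · show 𝒟.topV c 0 = f 0
    rw [topV_zero]
    linear_combination f 0 * e - 𝒟.Ninv * 𝒟.z 1 1 * h0 + 𝒟.Ninv * 𝒟.z 0 1 * h1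
  · show 𝒟.topV c 1 = f 1
    rw [topV_one]
    linear_combination f 1 * e + 𝒟.Ninv * 𝒟.z 1 0 * h0 - 𝒟.Ninv * 𝒟.z 0 0 * h1

theorem opL01_topV (s : Fin 2 → ℂ) :
    -(fun j => 𝒟.opL 0 1 (𝒟.topV s j)) = 𝒟.topV ![s 1, 0] := by
  ext j
  fin_cases j <;> simp [topV_zero, topV_one, opL_apply, P_Ninv, cof, P_z, Derivation.leibniz_pow] <;> ring

theorem opL10_topV (s : Fin 2 → ℂ) :
    -(fun j => 𝒟.opL 1 0 (𝒟.topV s j)) = 𝒟.topV ![0, s 0] := by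
  ext j
  fin_cases j <;> simp [topV_zero, topV_one, opL_apply, P_Ninv, cof, P_z, Derivation.leibniz_pow] <;> ring

theorem opRV01_constV (s : Fin 2 → ℂ) : 𝒟.opRV 0 1 (𝒟.constV s) = 𝒟.constV ![s 1, 0] := by
  ext j
  fin_cases j <;> simp [opRV, opR_apply, constV_apply]

theorem opRV10_constV (s : Fin 2 → ℂ) : 𝒟.opRV 1 0 (𝒟.constV s) = 𝒟.constV ![0, s 0] := by
  ext j
  fin_cases j <;> simp [opRV, opR_apply, constV_apply]

end ConformalCalculus
end QuatConf
end
noncomputable section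
namespace QuatConf
namespace ConformalCalculus

variable {A : Type*} [CommRing A] [StarRing A] [Algebra ℂ A] [StarModule ℂ A]
  {𝒟 : ConformalCalculus A}

/-! ### Irreducibility -/

theorem single_mem_sl4 {i j : Fin 2 ⊕ Fin 2} (h : i ≠ j) : Matrix.single i j (1 : ℂ) ∈ sl4 :=
  Matrix.trace_single_eq_of_ne i j 1 h

theorem repH_single_P (a b : Fin 2) (φ : A) :
    𝒟.repH (Matrix.single (.inl a) (.inr b) 1) φ = -𝒟.P a b φ := by
  rw [repH_eq]
  fin_cases a <;> fin_cases b <;> simp [Fin.sum_univ_two, Matrix.single_apply]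

theorem repH_single_opK (a b : Fin 2) (φ : A) :
    𝒟.repH (Matrix.single (.inr a) (.inl b) 1) φ = 𝒟.opK a b φ := by
  rw [repH_eq]
  fin_cases a <;> fin_cases b <;> simp [Fin.sum_univ_two, Matrix.single_apply]

theorem repV_single_P (a b : Fin 2) (f : Fin 2 → A) :
    𝒟.repV (Matrix.single (.inl a) (.inr b) 1) f = -fun j => 𝒟.P a b (f j) := by
  rw [repV_eq]
  fin_cases a <;> fin_cases b <;> simp [Fin.sum_univ_two, Matrix.single_apply]

theorem repV_single_opKV (a b : Fin 2) (f : Fin 2 → A) :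
    𝒟.repV (Matrix.single (.inr a) (.inl b) 1) f = 𝒟.opKV a b f := by
  rw [repV_eq]
  fin_cases a <;> fin_cases b <;> simp [Fin.sum_univ_two, Matrix.single_apply]

theorem repV_single_opL (a b : Fin 2) (f : Fin 2 → A) :
    𝒟.repV (Matrix.single (.inl a) (.inl b) 1) f = -fun j => 𝒟.opL a b (f j) := by
  rw [repV_eq]
  fin_cases a <;> fin_cases b <;> simp [Fin.sum_univ_two, Matrix.single_apply]

theorem repV_single_opRV {a b : Fin 2} (h : a ≠ b) (f : Fin 2 → A) :
    𝒟.repV (Matrix.single (.inr a) (.inr b) 1) f = 𝒟.opRV a b f := by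
  rw [repV_eq]
  fin_cases a <;> fin_cases b <;> simp [Fin.sum_univ_two, Matrix.single_apply] at h ⊢

theorem injective_sq : Function.Injective fun k : ℕ => ((k ^ 2 : ℕ) : ℂ) :=
  Nat.cast_injective.comp (Nat.pow_left_injective two_ne_zero)

theorem injective_mul_succ : Function.Injective fun k : ℕ => ((k * (k + 1) : ℕ) : ℂ) :=
  Nat.cast_injective.comp (StrictMono.injective fun a b h => by
    show a * (a + 1) < b * (b + 1)
    gcongr)

/-- For n ≥ 0 the `P a b` lower towards degree 0 and the `opK` raise. For n < 0 the roles are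
exchanged and k = -2 - n counts the distance from degree -2. -/
theorem eq_bot_or_le_repH {s : Set ℤ} (hs : IsHalf s) (U : Submodule ℂ A)
    (hUW : U ≤ gspan 𝒟.harmonic s) (hU : ∀ x ∈ sl4, ∀ f ∈ U, 𝒟.repH x f ∈ U) :
    U = ⊥ ∨ gspan 𝒟.harmonic s ≤ U := by
  have hUP (i : Fin 2 × Fin 2) : ∀ f ∈ U, (𝒟.P i.1 i.2 : A →ₗ[ℂ] A) f ∈ U := fun f hf => by
    have := hU _ (single_mem_sl4 (i := .inl i.1) (j := .inr i.2) (by simp)) f hf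
    rw [repH_single_P] at this
    exact neg_mem_iff.1 this
  have hUK (i : Fin 2 × Fin 2) : ∀ f ∈ U, 𝒟.opK i.2 i.1 f ∈ U := fun f hf => by
    have := hU _ (single_mem_sl4 (i := .inr i.2) (j := .inl i.1) (by simp)) f hf
    rwa [repH_single_opK] at this
  rcases hs with rfl | rfl
  · have hle : gspan 𝒟.harmonic {n | 0 ≤ n} ≤ ⨆ k : ℕ, 𝒟.harmonic k := by
      refine Submodule.span_le.2 ?_
      rintro f ⟨n, hn, hf⟩
      refine Submodule.mem_iSup_of_mem n.toNat ?_
      rwa [Int.toNat_of_nonneg hn]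
    refine (eq_bot_or_le_of_ladder (fun k : ℕ => 𝒟.harmonic k)
      (fun i : Fin 2 × Fin 2 => (𝒟.P i.1 i.2 : A →ₗ[ℂ] A)) (fun i => 𝒟.opK i.2 i.1) _ injective_sq
      (by simp) ?_ ?_ U (hUW.trans hle) hUP hUK ?_).imp_right hle.trans
    · intro k i f hf
      simpa using harmonic_P hf i.1 i.2
    · intro k f hf
      rw [Fintype.sum_prod_type]
      simpa [Algebra.smul_def] using sum_opK_P hf
    · intro f hfU hf h0 g hg
      obtain ⟨c, rfl⟩ := harmonic_zero hf
      obtain ⟨d, rfl⟩ := harmonic_zero hg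
      have hc : c ≠ 0 := by rintro rfl; simp at h0
      have : algebraMap ℂ A d = (d / c) • algebraMap ℂ A c := by
        rw [Algebra.smul_def, ← map_mul, div_mul_cancel₀ _ hc]
      rw [this]
      exact U.smul_mem _ hfU
  · have hle : gspan 𝒟.harmonic {n | n < 0} ≤ ⨆ k : ℕ, 𝒟.harmonic (-2 - k) := by
      refine Submodule.span_le.2 ?_
      rintro f ⟨n, hn, hf⟩
      by_cases h1 : n = -1
      · rw [eq_zero_of_harmonic hf h1]; exact zero_mem _
      refine Submodule.mem_iSup_of_mem (-2 - n).toNat ?_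
      simp only [Set.mem_ofPred_eq] at hn
      rwa [Int.toNat_of_nonneg (by omega), sub_sub_cancel]
    refine (eq_bot_or_le_of_ladder (fun k : ℕ => 𝒟.harmonic (-2 - k))
      (fun i : Fin 2 × Fin 2 => 𝒟.opK i.2 i.1) (fun i => (𝒟.P i.1 i.2 : A →ₗ[ℂ] A)) _ injective_sq
      (by simp) ?_ ?_ U (hUW.trans hle) hUK hUP ?_).imp_right hle.trans
    · intro k i f hf
      have := harmonic_opK hf i.2 i.1
      push_cast at this
      convert this using 1
      congr 1
      ring
    · intro k f hf
      rw [Fintype.sum_prod_type]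
      refine (sum_P_opK hf).trans ?_
      show _ = ((k ^ 2 : ℕ) : ℂ) • f
      rw [Algebra.smul_def]
      push_cast
      ring
    · intro f hfU hf h0 g hg
      obtain ⟨c, rfl⟩ := harmonic_neg_two hf
      obtain ⟨d, rfl⟩ := harmonic_neg_two hg
      have hc : c ≠ 0 := by rintro rfl; simp at h0
      have : algebraMap ℂ A d * 𝒟.Ninv = (d / c) • (algebraMap ℂ A c * 𝒟.Ninv) := by
        rw [Algebra.smul_def, ← mul_assoc, ← map_mul, div_mul_cancel₀ _ hc]
      rw [this]
      exact U.smul_mem _ hfU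

theorem eq_bot_or_le_repV {s : Set ℤ} (hs : IsHalf s) (U : Submodule ℂ (Fin 2 → A))
    (hUW : U ≤ gspan 𝒟.regular s) (hU : ∀ x ∈ sl4, ∀ f ∈ U, 𝒟.repV x f ∈ U) :
    U = ⊥ ∨ gspan 𝒟.regular s ≤ U := by
  have hUP (i : Fin 2 × Fin 2) : ∀ f ∈ U,
      (-𝒟.repV (Matrix.single (.inl i.1) (.inr i.2) 1)) f ∈ U :=
    fun f hf => neg_mem (hU _ (single_mem_sl4 (i := .inl i.1) (j := .inr i.2) (by simp)) f hf)
  have hUK (i : Fin 2 × Fin 2) : ∀ f ∈ U,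
      𝒟.repV (Matrix.single (.inr i.2) (.inl i.1) 1) f ∈ U := fun f hf =>
    hU _ (single_mem_sl4 (i := .inr i.2) (j := .inl i.1) (by simp)) f hf
  have eP (i : Fin 2 × Fin 2) (f : Fin 2 → A) :
      (-𝒟.repV (Matrix.single (.inl i.1) (.inr i.2) 1)) f = fun j => 𝒟.P i.1 i.2 (f j) := by
    rw [LinearMap.neg_apply, repV_single_P, neg_neg]
  rcases hs with rfl | rfl
  · have hle : gspan 𝒟.regular {n | 0 ≤ n} ≤ ⨆ k : ℕ, 𝒟.regular k := by
      refine Submodule.span_le.2 ?_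
      rintro f ⟨n, hn, hf⟩
      refine Submodule.mem_iSup_of_mem n.toNat ?_
      rwa [Int.toNat_of_nonneg hn]
    refine (eq_bot_or_le_of_ladder (fun k : ℕ => 𝒟.regular k)
      (fun i : Fin 2 × Fin 2 => -𝒟.repV (Matrix.single (.inl i.1) (.inr i.2) 1))
      (fun i => 𝒟.repV (Matrix.single (.inr i.2) (.inl i.1) 1)) _ injective_mul_succ
      (by simp) ?_ ?_ U (hUW.trans hle) hUP hUK ?_).imp_right hle.trans
    · intro k i f hf
      rw [eP]
      simpa using regular_P hf i.1 i.2
    · intro k f hf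
      ext j
      simp only [Fintype.sum_prod_type, Finset.sum_apply, eP, repV_single_opKV]
      refine (sum_opKV_P hf j).trans ?_
      simp [Algebra.smul_def]
    · intro f hfU hf h0 g hg
      -- The extreme piece is two-dimensional; the off-diagonal units of the lower right block act
      -- on it as those of ℂ².
      obtain ⟨t, rfl⟩ := regular_zero hf
      refine range_le_of_offdiag 𝒟.constV U (fun s h => ?_) (fun s h => ?_) t hfU h0
        (regular_zero hg)
      · rw [← opRV01_constV, ← repV_single_opRV (by decide)]
        exact hU _ (single_mem_sl4 (by simp)) _ h
      · rw [← opRV10_constV, ← repV_single_opRV (by decide)]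
        exact hU _ (single_mem_sl4 (by simp)) _ h
  -- Degrees -1 and -2 are empty, so the grading starts at -3; at n = -3 - k the eigenvalue
  -- (n+2)(n+3) is k(k+1).
  · have hle : gspan 𝒟.regular {n | n < 0} ≤ ⨆ k : ℕ, 𝒟.regular (-3 - k) := by
      refine Submodule.span_le.2 ?_
      rintro f ⟨n, hn, hf⟩
      by_cases h1 : n = -1
      · rw [regular_neg_one hf h1]; exact zero_mem _
      by_cases h2 : n = -2
      · rw [regular_neg_two hf h2]; exact zero_mem _
      refine Submodule.mem_iSup_of_mem (-3 - n).toNat ?_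
      simp only [Set.mem_ofPred_eq] at hn
      rwa [Int.toNat_of_nonneg (by omega), sub_sub_cancel]
    refine (eq_bot_or_le_of_ladder (fun k : ℕ => 𝒟.regular (-3 - k))
      (fun i : Fin 2 × Fin 2 => 𝒟.repV (Matrix.single (.inr i.2) (.inl i.1) 1))
      (fun i => -𝒟.repV (Matrix.single (.inl i.1) (.inr i.2) 1)) _ injective_mul_succ
      (by simp) ?_ ?_ U (hUW.trans hle) hUK hUP ?_).imp_right hle.trans
    · intro k i f hf
      rw [repV_single_opKV]
      have := regular_opKV hf i.2 i.1
      push_cast at this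
      convert this using 1
      congr 1
      ring
    · intro k f hf
      ext j
      simp only [Fintype.sum_prod_type, Finset.sum_apply, eP, repV_single_opKV]
      refine (sum_P_opKV hf j).trans ?_
      show _ = ((k * (k + 1) : ℕ) : ℂ) • f j
      rw [Algebra.smul_def]
      push_cast
      ring
    · intro f hfU hf h0 g hg
      obtain ⟨t, rfl⟩ := regular_neg_three (by simpa using hf)
      refine range_le_of_offdiag 𝒟.topV U (fun s h => ?_) (fun s h => ?_) t hfU h0
        (regular_neg_three (by simpa using hg))
      · rw [← opL01_topV, ← repV_single_opL]
        exact hU _ (single_mem_sl4 (by simp)) _ h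
      · rw [← opL10_topV, ← repV_single_opL]
        exact hU _ (single_mem_sl4 (by simp)) _ h

theorem gspan_harmonic_ne_bot [Nontrivial A] {s : Set ℤ} (hs : IsHalf s) :
    gspan 𝒟.harmonic s ≠ ⊥ := by
  rcases hs with rfl | rfl
  · exact (Submodule.ne_bot_iff _).2 ⟨1, mem_gspan (n := 0) (by simp) one_harmonic, one_ne_zero⟩
  · refine (Submodule.ne_bot_iff _).2 ⟨𝒟.Ninv, mem_gspan (n := -2) (by simp) Ninv_harmonic, ?_⟩
    intro h
    have := 𝒟.det_mul_Ninv
    simp [h] at this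

theorem gspan_regular_ne_bot [Nontrivial A] {s : Set ℤ} (hs : IsHalf s) :
    gspan 𝒟.regular s ≠ ⊥ := by
  rcases hs with rfl | rfl
  · refine (Submodule.ne_bot_iff _).2
      ⟨𝒟.constV ![1, 0], mem_gspan (n := 0) (by simp) (constV_regular _), fun h => ?_⟩
    have := congrFun h 0
    simp [constV_apply] at this
  · refine (Submodule.ne_bot_iff _).2
      ⟨𝒟.topV ![1, 0], mem_gspan (n := -3) (by simp) (topV_regular _), fun h => ?_⟩
    have h0 := congrFun h 0
    have h1 := congrFun h 1
    have e := 𝒟.det_mul_Ninv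
    rw [topV_zero] at h0
    rw [topV_one] at h1
    simp at h0 h1
    -- The spinor is N⁻² times (z 1 1, -z 1 0), from which det² N⁻² = 1 is recovered.
    have : (1 : A) = 0 := by
      linear_combination -(1 + (𝒟.z 0 0 * 𝒟.z 1 1 - 𝒟.z 0 1 * 𝒟.z 1 0) * 𝒟.Ninv) * e +
        (𝒟.z 0 0 * 𝒟.z 1 1 - 𝒟.z 0 1 * 𝒟.z 1 0) * 𝒟.z 0 0 * h0 -
        (𝒟.z 0 0 * 𝒟.z 1 1 - 𝒟.z 0 1 * 𝒟.z 1 0) * 𝒟.z 0 1 * h1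
    exact one_ne_zero this

end ConformalCalculus
end QuatConf
end
noncomputable section
namespace QuatConf

/-! ### The real form 𝔲(2, 2) and the quaternionic structure on spinors -/

theorem star_apply_of_mem_u22 {x : gl4} (hx : x ∈ u22) (a b : Fin 2) :
    star (x (.inl a) (.inl b)) = -x (.inl b) (.inl a) ∧
      star (x (.inl a) (.inr b)) = x (.inr b) (.inl a) ∧
      star (x (.inr a) (.inl b)) = x (.inl b) (.inr a) ∧
      star (x (.inr a) (.inr b)) = -x (.inr b) (.inr a) := by
  have e (i j : Fin 2 ⊕ Fin 2) := congrFun (congrFun (show _ = _ from hx) i) j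
  have h1 := e (.inl b) (.inl a)
  have h2 := e (.inr b) (.inl a)
  have h3 := e (.inl b) (.inr a)
  have h4 := e (.inr b) (.inr a)
  simp [Matrix.mul_apply, Fintype.sum_sum_type, Matrix.one_apply] at h1 h2 h3 h4
  simp only [Complex.star_def]
  exact ⟨by linear_combination h1, by linear_combination h2, by linear_combination -h3,
    by linear_combination -h4⟩

namespace ConformalCalculus

section

variable {A : Type*} [CommRing A] [StarRing A]

/-- The quaternionic structure on spinors. -/
def sstar (f : Fin 2 → A) : Fin 2 → A := ![-star (f 1), star (f 0)]

theorem sstar_zero (f : Fin 2 → A) : sstar f 0 = -star (f 1) := rfl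

theorem sstar_one (f : Fin 2 → A) : sstar f 1 = star (f 0) := rfl

end

variable {A : Type*} [CommRing A] [StarRing A] [Algebra ℂ A] [StarModule ℂ A]
  {𝒟 : ConformalCalculus A}

/-! ### Real structures -/

/-- For x ∈ 𝔲(2, 2) conjugating the entries of x amounts to transposing within the blocks, up to
sign, and conjugating `z` takes the transposed adjugate; together this is `sharp`. With `formB_repH`
it makes the Hermitian form skew-invariant. -/
theorem star_repH {x : gl4} (hx : x ∈ u22) (φ : A) :
    star (𝒟.repH x φ) = 𝒟.repH (sharp x) (star φ) := by
  have h (a b : Fin 2) := star_apply_of_mem_u22 hx a b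
  simp only [repH_eq, Fin.sum_univ_two, star_add, star_sub, star_neg, star_smul, h, star_P00,
    star_P01, star_P10, star_P11, opL_apply, opR_apply, opK_apply, star_mul, star_z00, star_z01,
    star_z10, star_z11]
  simp only [sharp, Matrix.adjugate_fin_two, Matrix.fromBlocks_apply₁₁, Matrix.fromBlocks_apply₁₂,
    Matrix.fromBlocks_apply₂₁, Matrix.fromBlocks_apply₂₂, Matrix.neg_apply, Matrix.of_apply,
    Matrix.toBlocks₁₁, Matrix.toBlocks₁₂, Matrix.toBlocks₂₁, Matrix.toBlocks₂₂,
    Matrix.cons_val', Matrix.cons_val_zero, Matrix.cons_val_one, Matrix.cons_val_fin_one,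
    Algebra.smul_def, map_neg, map_add]
  ring

theorem sstar_repV {x : gl4} (hx : x ∈ u22) (f : Fin 2 → A) :
    sstar (𝒟.repV x f) = 𝒟.repV (sharp x) (sstar f) := by
  have h (a b : Fin 2) := star_apply_of_mem_u22 hx a b
  ext j
  fin_cases j <;>
  simp only [Fin.zero_eta, Fin.mk_one, sstar_zero, sstar_one, repV_eq, Fin.sum_univ_two, Pi.add_apply,
    Pi.sub_apply, Pi.neg_apply, Pi.smul_apply, opKV, opRV, star_add, star_sub, star_neg, star_smul,
    h, star_P00, star_P01, star_P10, star_P11, opL_apply, opR_apply, opK_apply, star_mul, star_z00,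
    star_z01, star_z10, star_z11, zero_ne_one, one_ne_zero, if_true, if_false, star_zero] <;>
  simp only [sharp, Matrix.adjugate_fin_two, Matrix.fromBlocks_apply₁₁, Matrix.fromBlocks_apply₁₂,
    Matrix.fromBlocks_apply₂₁, Matrix.fromBlocks_apply₂₂, Matrix.neg_apply, Matrix.of_apply,
    Matrix.toBlocks₁₁, Matrix.toBlocks₁₂, Matrix.toBlocks₂₁, Matrix.toBlocks₂₂,
    Matrix.cons_val', Matrix.cons_val_zero, Matrix.cons_val_one, Matrix.cons_val_fin_one,
    Algebra.smul_def, map_neg, map_add] <;>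
  ring

theorem sstar_regular {n : ℤ} {f : Fin 2 → A} (h : f ∈ 𝒟.regular n) :
    sstar f ∈ 𝒟.regular n := by
  refine ⟨fun j => ?_, fun c => ?_⟩
  · fin_cases j
    · exact neg_mem (𝒟.star_mem (h.1 1))
    · exact 𝒟.star_mem (h.1 0)
  · have h0 := congrArg star (h.2 0)
    have h1 := congrArg star (h.2 1)
    rw [star_P01, star_P00] at h0
    rw [star_P11, star_P10] at h1
    rw [sstar_zero, sstar_one, map_neg]
    fin_cases c
    · show -𝒟.P 0 1 (star (f 1)) = 𝒟.P 0 0 (star (f 0))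
      rw [h1]
    · show -𝒟.P 1 1 (star (f 1)) = 𝒟.P 1 0 (star (f 0))
      rw [← h0, neg_neg]

theorem star_mem_gspan {s : Set ℤ} {f : A} (hf : f ∈ gspan 𝒟.harmonic s) :
    star f ∈ gspan 𝒟.harmonic s := by
  induction hf using Submodule.span_induction with
  | mem x hx => obtain ⟨n, hn, h⟩ := hx; exact mem_gspan hn (harmonic_star h)
  | zero => rw [star_zero]; exact zero_mem _
  | add x y _ _ hx hy => rw [star_add]; exact add_mem hx hy
  | smul c x _ hx => rw [star_smul]; exact Submodule.smul_mem _ _ hx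

theorem sstar_mem_gspan {s : Set ℤ} {f : Fin 2 → A} (hf : f ∈ gspan 𝒟.regular s) :
    sstar f ∈ gspan 𝒟.regular s := by
  induction hf using Submodule.span_induction with
  | mem x hx => obtain ⟨n, hn, h⟩ := hx; exact mem_gspan hn (sstar_regular h)
  | zero =>
    have : sstar (0 : Fin 2 → A) = 0 := by ext j; fin_cases j <;> simp [sstar]
    rw [this]; exact zero_mem _
  | add x y _ _ hx hy =>
    have : sstar (x + y) = sstar x + sstar y := by
      ext j; fin_cases j <;> simp [sstar]; ring
    rw [this]; exact add_mem hx hy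
  | smul c x _ hx =>
    have : sstar (c • x) = star c • sstar x := by ext j; fin_cases j <;> simp [sstar]
    rw [this]; exact Submodule.smul_mem _ _ hx

/-! ### Hermitian forms -/

theorem formB_repH {s : Set ℤ} (hs : IsHalf s) (x : gl4) {f k : A}
    (hf : f ∈ gspan 𝒟.harmonic s) (hk : k ∈ gspan 𝒟.harmonic s) :
    𝒟.formB (𝒟.repH x f) k + 𝒟.formB f (𝒟.repH (sharp x) k) = 0 := by
  refine bilinear_span_eq_zero (𝒟.formB.comp (𝒟.repH x) + 𝒟.formB.compl₂ (𝒟.repH (sharp x)))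
    ?_ hf hk
  rintro φ ⟨n, hn, hφ⟩ ψ ⟨m, hm, hψ⟩
  exact formB_repH_harmonic hφ hψ (hs.iff hn hm) x

theorem formW_repV {s : Set ℤ} (hs : IsHalf s) (x : gl4) {f k : Fin 2 → A}
    (hf : f ∈ gspan 𝒟.regular s) (hk : k ∈ gspan 𝒟.regular s) :
    𝒟.formW (𝒟.repV x f) k + 𝒟.formW f (𝒟.repV (sharp x) k) = 0 := by
  refine bilinear_span_eq_zero (𝒟.formW.comp (𝒟.repV x) + 𝒟.formW.compl₂ (𝒟.repV (sharp x)))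
    ?_ hf hk
  rintro φ ⟨n, hn, hφ⟩ ψ ⟨m, hm, hψ⟩
  exact formW_repV_regular hφ hψ (hs.iff hn hm) x

theorem star_degOp (φ : A) : star (𝒟.degOp φ) = 𝒟.degOp (star φ) := by
  show star (φ + (𝒟.opL 0 0 φ + 𝒟.opL 1 1 φ)) =
    star φ + (𝒟.opL 0 0 (star φ) + 𝒟.opL 1 1 (star φ))
  rw [star_add, star_add, star_opL00, star_opL11]; ring

theorem formB_conj_symm {s : Set ℤ} (hs : IsHalf s) {f h : A} (hf : f ∈ gspan 𝒟.harmonic s)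
    (hh : h ∈ gspan 𝒟.harmonic s) : 𝒟.formB h (star f) = star (𝒟.formB f (star h)) := by
  have e : star (𝒟.formB f (star h)) = 𝒟.formB (star f) h := by
    rw [formB_def, formB_def, ← 𝒟.I_star, star_mul, star_star, star_degOp, mul_comm]
  rw [e, ← sub_eq_zero]
  refine bilinear_span_eq_zero (𝒟.formB - 𝒟.formB.flip) ?_ hh (star_mem_gspan hf)
  rintro φ ⟨n, hn, hφ⟩ ψ ⟨m, hm, hψ⟩
  exact sub_eq_zero.2 (formB_comm hφ hψ (hs.iff hn hm))

theorem formW_sstar (f h : Fin 2 → A) :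
    𝒟.formW f (sstar h) = 𝒟.I (f 0 * star (h 0)) + 𝒟.I (f 1 * star (h 1)) := by
  rw [formW_apply, sstar_zero, sstar_one, mul_neg, map_neg, sub_neg_eq_add]

theorem formW_conj_symm (f h : Fin 2 → A) :
    𝒟.formW h (sstar f) = star (𝒟.formW f (sstar h)) := by
  simp only [formW_sstar, star_add, ← 𝒟.I_star, star_mul, star_star]

/-- Orthogonality removes the cross terms and leaves squared norms with weights n + 1. Their sign on
each half is the ± in the inner product. -/
theorem formB_star_self {s : Set ℤ} (hs : IsHalf s) (F : s →₀ A)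
    (hF : ∀ n : s, F n ∈ 𝒟.harmonic n) :
    𝒟.formB (∑ n ∈ F.support, F n) (star (∑ n ∈ F.support, F n)) =
      ∑ n ∈ F.support, (((n : ℤ) : ℂ) + 1) * 𝒟.I (F n * star (F n)) := by
  rw [star_sum, map_sum 𝒟.formB, LinearMap.sum_apply]
  refine Finset.sum_congr rfl fun n hn => ?_
  rw [map_sum, Finset.sum_eq_single n]
  · exact formB_apply (hF n).1 _
  · intro m _ hmn
    rw [formB_apply (hF n).1, I_mul_eq_zero_of_ne (hF n) (harmonic_star (hF m)) (hs.iff n.2 m.2)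
      (fun h => hmn (Subtype.ext h.symm)), mul_zero]
  · exact fun h => absurd hn h

theorem formB_pos {s : Set ℤ} (hs : IsHalf s) {ε : ℝ}
    (hε : ∀ n ∈ s, n ≠ -1 → 0 < ε * ((n : ℝ) + 1)) {f : A} (hf : f ∈ gspan 𝒟.harmonic s)
    (h0 : f ≠ 0) : 0 < ε * (𝒟.formB f (star f)).re := by
  obtain ⟨F, hF, rfl⟩ := exists_sum_of_mem_gspan hf
  rw [formB_star_self hs F hF, Complex.re_sum, Finset.mul_sum]
  have hne : F.support.Nonempty := by
    by_contra h
    rw [Finset.not_nonempty_iff_eq_empty] at h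
    simp [h] at h0
  refine Finset.sum_pos (fun n hn => ?_) hne
  have hn0 : F n ≠ 0 := Finsupp.mem_support_iff.1 hn
  have h1 := hε n n.2 fun h => hn0 (eq_zero_of_harmonic (hF n) h)
  have e : ((n : ℤ) : ℂ) + 1 = (((n : ℤ) + 1 : ℝ) : ℂ) := by push_cast; rfl
  rw [e, Complex.re_ofReal_mul, ← mul_assoc]
  exact mul_pos h1 (𝒟.I_pos (hF n).1 hn0)

theorem formW_sstar_self {s : Set ℤ} (hs : IsHalf s) (F : s →₀ (Fin 2 → A))
    (hF : ∀ n : s, F n ∈ 𝒟.regular n) :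
    𝒟.formW (∑ n ∈ F.support, F n) (sstar (∑ n ∈ F.support, F n)) =
      ∑ n ∈ F.support, (𝒟.I (F n 0 * star (F n 0)) + 𝒟.I (F n 1 * star (F n 1))) := by
  have e (j : Fin 2) : 𝒟.I ((∑ n ∈ F.support, F n) j * star ((∑ n ∈ F.support, F n) j)) =
      ∑ n ∈ F.support, 𝒟.I (F n j * star (F n j)) := by
    rw [Finset.sum_apply, star_sum, Finset.sum_mul, map_sum]
    refine Finset.sum_congr rfl fun n hn => ?_
    rw [Finset.mul_sum, map_sum, Finset.sum_eq_single n]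
    · intro m _ hmn
      exact I_mul_eq_zero_of_ne (regular_harmonic (hF n) j)
        (harmonic_star (regular_harmonic (hF m) j)) (hs.iff n.2 m.2)
        (fun h => hmn (Subtype.ext h.symm))
    · exact fun h => absurd hn h
  rw [formW_sstar, e, e, Finset.sum_add_distrib]

theorem formW_pos {s : Set ℤ} (hs : IsHalf s) {f : Fin 2 → A} (hf : f ∈ gspan 𝒟.regular s)
    (h0 : f ≠ 0) : 0 < (𝒟.formW f (sstar f)).re := by
  obtain ⟨F, hF, rfl⟩ := exists_sum_of_mem_gspan hf
  rw [formW_sstar_self hs F hF, Complex.re_sum]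
  have hne : F.support.Nonempty := by
    by_contra h
    rw [Finset.not_nonempty_iff_eq_empty] at h
    simp [h] at h0
  refine Finset.sum_pos (fun n hn => ?_) hne
  have hn0 : F n ≠ 0 := Finsupp.mem_support_iff.1 hn
  rw [Complex.add_re]
  have p0 := I_pos' ((hF n).1 0)
  have p1 := I_pos' ((hF n).1 1)
  by_cases h : F n 0 = 0
  · have h1 : F n 1 ≠ 0 := fun h1 => hn0 (by ext j; fin_cases j <;> assumption)
    exact add_pos_of_nonneg_of_pos p0 (𝒟.I_pos ((hF n).1 1) h1)
  · exact add_pos_of_pos_of_nonneg (𝒟.I_pos ((hF n).1 0) h) p1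

/-! ### The pairing of `𝓗⁺` and `𝓗⁻` -/

/-- Only n + m = -1 contributes. There `opKs a b φ` and ψ have degrees of sum 0 and are orthogonal,
so (n+1) ∫ cof φψ = ∫ (Pφ) ψ, while n + m + 3 = 2 in `I_P`. -/
theorem pairing_P {n m : ℤ} {φ ψ : A} (hφ : φ ∈ 𝒟.harmonic n) (hψ : ψ ∈ 𝒟.harmonic m)
    (hn : 0 ≤ n) (hm : m < 0) (a b : Fin 2) :
    𝒟.formB (𝒟.P a b φ) ψ = -𝒟.formB φ (𝒟.P a b ψ) := by
  rw [formB_apply hφ.1, formB_apply (𝒟.P_mem hφ.1 a b)]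
  by_cases h : n + m = -1
  · have hm' : m = -1 - n := by omega
    have h1 := I_P hφ.1 hψ.1 a b
    have h2 := I_mul_eq_zero (harmonic_opKs hφ a b) hψ (by omega) (by omega)
    rw [opKs_eq hφ.1, sub_mul, map_sub, mul_assoc, I_intCast_mul, mul_assoc, mul_assoc,
      I_det_mul] at h2
    rw [hm'] at h1
    push_cast at h1 h2 ⊢
    linear_combination (n + 1) / 2 * h1 + h2
  · rw [I_mul_eq_zero (harmonic_P hφ a b) hψ (by omega) (by omega),
      I_mul_eq_zero hφ (harmonic_P hψ a b) (by omega) (by omega)]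
    simp

theorem pairing_opKs {n m : ℤ} {φ ψ : A} (hφ : φ ∈ 𝒟.harmonic n) (hψ : ψ ∈ 𝒟.harmonic m)
    (hn : 0 ≤ n) (hm : m < 0) (a b : Fin 2) :
    𝒟.formB (𝒟.opKs a b φ) ψ = -𝒟.formB φ (𝒟.opKs a b ψ) := by
  by_cases hm1 : m = -1
  · simp [eq_zero_of_harmonic hψ hm1]
  rw [formB_apply hφ.1, formB_apply (harmonic_opKs hφ a b).1]
  by_cases h : n + m = -3
  · have hm' : m = -3 - n := by omega
    have h1 := I_P hφ.1 hψ.1 a b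
    have h2 := I_mul_eq_zero (harmonic_P hφ a b) hψ (by omega) (by omega)
    rw [opKs_eq hφ.1, sub_mul, map_sub, mul_assoc, I_intCast_mul, mul_assoc, mul_assoc, I_det_mul, h2]
    have h3 : 𝒟.I (φ * 𝒟.opKs a b ψ) =
        ((m : ℂ) + 1) * 𝒟.I (𝒟.cof a b * (φ * ψ)) - 𝒟.I (φ * 𝒟.P a b ψ) := by
      rw [opKs_eq hψ.1, mul_sub, map_sub, mul_left_comm φ, mul_left_comm φ (𝒟.cof a b),
        I_intCast_mul, mul_left_comm φ 𝒟.det, I_det_mul]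
      push_cast; rfl
    rw [h3, hm']
    rw [hm', h2] at h1
    push_cast at h1 ⊢
    linear_combination -(n + 1) / 2 * h1
  · rw [I_mul_eq_zero (harmonic_opKs hφ a b) hψ (by omega) (by omega),
      I_mul_eq_zero hφ (harmonic_opKs hψ a b) (by omega) (by omega)]
    simp

/-- Between the halves only degrees of sum -2 pair nontrivially. -/
theorem I_mul_of_pairing {n m : ℤ} {φ ψ : A} (hφ : φ ∈ 𝒟.harmonic n) (hψ : ψ ∈ 𝒟.harmonic m)
    (hn : 0 ≤ n) (hm : m < 0) : ((n : ℂ) + m + 2) * 𝒟.I (φ * ψ) = 0 := by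
  by_cases h : n + m = -2
  · rw [show (n : ℂ) + m + 2 = ((n + m + 2 : ℤ) : ℂ) by push_cast; ring, h]; simp
  · rw [I_mul_eq_zero hφ hψ (by omega) h, mul_zero]

theorem pairing_opL {n m : ℤ} {φ ψ : A} (hφ : φ ∈ 𝒟.harmonic n) (hψ : ψ ∈ 𝒟.harmonic m)
    (hn : 0 ≤ n) (hm : m < 0) (a b : Fin 2) :
    𝒟.formB (𝒟.opL a b φ) ψ = -𝒟.formB φ (𝒟.opL a b ψ) - if a = b then 𝒟.formB φ ψ else 0 := by
  have h1 := I_opL hφ.1 hψ.1 a b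
  have h2 := I_mul_of_pairing hφ hψ hn hm
  rw [formB_apply hφ.1, formB_apply hφ.1, formB_apply (harmonic_opL hφ a b).1]
  split_ifs at h1 ⊢
  · linear_combination (n + 1) / 2 * h1 + (n + 1) / 2 * h2
  · linear_combination (n + 1) / 2 * h1

theorem pairing_opR {n m : ℤ} {φ ψ : A} (hφ : φ ∈ 𝒟.harmonic n) (hψ : ψ ∈ 𝒟.harmonic m)
    (hn : 0 ≤ n) (hm : m < 0) (a b : Fin 2) :
    𝒟.formB (𝒟.opR a b φ) ψ = -𝒟.formB φ (𝒟.opR a b ψ) - if a = b then 𝒟.formB φ ψ else 0 := by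
  have h1 := I_opR hφ.1 hψ.1 a b
  have h2 := I_mul_of_pairing hφ hψ hn hm
  rw [formB_apply hφ.1, formB_apply hφ.1, formB_apply (harmonic_opR hφ a b).1]
  split_ifs at h1 ⊢
  · linear_combination (n + 1) / 2 * h1 + (n + 1) / 2 * h2
  · linear_combination (n + 1) / 2 * h1

/-- Each diagonal matrix unit leaves a multiple of `formB φ ψ`. With the scalar multipliers the
total is tr x, which is exactly what the twist subtracts. -/
theorem pairing_repH_harmonic {n m : ℤ} {φ ψ : A} (hφ : φ ∈ 𝒟.harmonic n)
    (hψ : ψ ∈ 𝒟.harmonic m) (hn : 0 ≤ n) (hm : m < 0) (x : gl4) :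
    𝒟.formB (𝒟.repH x φ) ψ + 𝒟.formB φ (twist 𝒟.repH x ψ) = 0 := by
  have p (a b : Fin 2) := pairing_P hφ hψ hn hm a b
  have l (a b : Fin 2) := pairing_opL hφ hψ hn hm a b
  have r (a b : Fin 2) := pairing_opR hφ hψ hn hm a b
  have k (a b : Fin 2) := pairing_opKs hφ hψ hn hm a b
  have k00 := k 0 0
  have k01 := k 0 1
  have k10 := k 1 0
  have k11 := k 1 1
  simp [opKs] at k00 k01 k10 k11
  have t : x.trace = x (.inl 0) (.inl 0) + x (.inl 1) (.inl 1) + x (.inr 0) (.inr 0)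
      + x (.inr 1) (.inr 1) := by
    simp [Matrix.trace, Fin.sum_univ_two]; ring
  simp only [twist_apply, repH_eq, Fin.sum_univ_two, map_add, map_sub, map_neg, map_smul,
    LinearMap.add_apply, LinearMap.sub_apply, LinearMap.neg_apply, LinearMap.smul_apply, smul_eq_mul,
    p, l, r, k00, k11, t]
  simp
  linear_combination -x (.inr 0) (.inl 1) * k01 - x (.inr 1) (.inl 0) * k10

theorem pairing_repH (x : gl4) {f k : A} (hf : f ∈ gspan 𝒟.harmonic {n | 0 ≤ n})
    (hk : k ∈ gspan 𝒟.harmonic {n | n < 0}) :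
    𝒟.formB (𝒟.repH x f) k + 𝒟.formB f (twist 𝒟.repH x k) = 0 := by
  refine bilinear_span_eq_zero (𝒟.formB.comp (𝒟.repH x) + 𝒟.formB.compl₂ (twist 𝒟.repH x))
    ?_ hf hk
  rintro φ ⟨n, hn, hφ⟩ ψ ⟨m, hm, hψ⟩
  exact pairing_repH_harmonic hφ hψ hn hm x

theorem twist_repH_mem {s : Set ℤ} (hs : IsHalf s) (x : gl4) {f : A}
    (hf : f ∈ gspan 𝒟.harmonic s) : twist 𝒟.repH x f ∈ gspan 𝒟.harmonic s :=
  sub_mem (repH_mem hs x hf) (Submodule.smul_mem _ _ hf)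

theorem formB_one_Ninv [Nontrivial A] : 𝒟.formB 1 𝒟.Ninv ≠ 0 := by
  rw [formB_apply 𝒟.one_mem, one_mul, ← 𝒟.I_det_mul, det_mul_Ninv']
  intro h
  have := 𝒟.I_pos 𝒟.one_mem one_ne_zero
  simp at h
  simp [h] at this

/-- The radical is a subspace stable under 𝔰𝔩(4, ℂ), hence zero or everything by irreducibility. The
latter is impossible since 1 and N⁻¹ pair to the integral of 1 over the sphere, which is nonzero. -/
theorem pairing_nondeg_left [Nontrivial A] {f : A} (hf : f ∈ gspan 𝒟.harmonic {n | 0 ≤ n})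
    (h : ∀ k ∈ gspan 𝒟.harmonic {n | n < 0}, 𝒟.formB f k = 0) : f = 0 := by
  let U : Submodule ℂ A :=
    { carrier := {f | f ∈ gspan 𝒟.harmonic {n | 0 ≤ n} ∧
        ∀ k ∈ gspan 𝒟.harmonic {n | n < 0}, 𝒟.formB f k = 0}
      add_mem' := fun h1 h2 => ⟨add_mem h1.1 h2.1, fun k hk => by
        rw [map_add, LinearMap.add_apply, h1.2 k hk, h2.2 k hk, add_zero]⟩
      zero_mem' := ⟨zero_mem _, by simp⟩
      smul_mem' := fun c f h1 => ⟨Submodule.smul_mem _ c h1.1, fun k hk => by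
        rw [map_smul, LinearMap.smul_apply, h1.2 k hk, smul_zero]⟩ }
  have hU : ∀ x ∈ sl4, ∀ g ∈ U, 𝒟.repH x g ∈ U := fun x _ g hg =>
    ⟨repH_mem (.inl rfl) x hg.1, fun k hk => by
      have := pairing_repH x hg.1 hk
      rwa [hg.2 _ (twist_repH_mem (.inr rfl) x hk), add_zero] at this⟩
  rcases eq_bot_or_le_repH (.inl rfl) U (fun g hg => hg.1) hU with h0 | h0
  · exact (Submodule.eq_bot_iff _).1 h0 f ⟨hf, h⟩
  · exact absurd ((h0 (mem_gspan (n := 0) (by simp) one_harmonic)).2 𝒟.Ninv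
      (mem_gspan (n := -2) (by simp) Ninv_harmonic)) formB_one_Ninv

theorem pairing_nondeg_right [Nontrivial A] {k : A} (hk : k ∈ gspan 𝒟.harmonic {n | n < 0})
    (h : ∀ f ∈ gspan 𝒟.harmonic {n | 0 ≤ n}, 𝒟.formB f k = 0) : k = 0 := by
  let U : Submodule ℂ A :=
    { carrier := {k | k ∈ gspan 𝒟.harmonic {n | n < 0} ∧
        ∀ f ∈ gspan 𝒟.harmonic {n | 0 ≤ n}, 𝒟.formB f k = 0}
      add_mem' := fun h1 h2 => ⟨add_mem h1.1 h2.1, fun f hf => by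
        rw [map_add, h1.2 f hf, h2.2 f hf, add_zero]⟩
      zero_mem' := ⟨zero_mem _, by simp⟩
      smul_mem' := fun c k h1 => ⟨Submodule.smul_mem _ c h1.1, fun f hf => by
        rw [map_smul, h1.2 f hf, smul_zero]⟩ }
  have hU : ∀ x ∈ sl4, ∀ g ∈ U, 𝒟.repH x g ∈ U := fun x hx g hg =>
    ⟨repH_mem (.inr rfl) x hg.1, fun f hf => by
      have := pairing_repH x hf hg.1
      rw [hg.2 _ (repH_mem (.inl rfl) x hf), zero_add, twist_apply,
        show x.trace = 0 from hx, zero_smul, sub_zero] at this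
      exact this⟩
  rcases eq_bot_or_le_repH (.inr rfl) U (fun g hg => hg.1) hU with h0 | h0
  · exact (Submodule.eq_bot_iff _).1 h0 k ⟨hk, h⟩
  · exact absurd ((h0 (mem_gspan (n := -2) (by simp) Ninv_harmonic)).2 1
      (mem_gspan (n := 0) (by simp) one_harmonic)) formB_one_Ninv

end ConformalCalculus
end QuatConf
end
noncomputable section
namespace QuatConf

/-! ### The algebra of smooth functions on `ℍˣ` -/

section Ext

variable {F : Type*} [Zero F]

theorem ext_coe (f : ℍ[ℝ]ˣ → F) (X : ℍ[ℝ]ˣ) : ext f (X : ℍ[ℝ]) = f X := by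
  rw [ext, dif_pos X.ne_zero]
  congr 1
  ext1; rfl

theorem ext_zero (f : ℍ[ℝ]ˣ → F) : ext f 0 = 0 := by
  rw [ext, dif_neg (by simp)]

theorem ext_of_ne (f : ℍ[ℝ]ˣ → F) {X : ℍ[ℝ]} (h : X ≠ 0) : ext f X = f (Units.mk0 X h) :=
  ext_coe f (Units.mk0 X h)

theorem ext_eqOn {f : ℍ[ℝ]ˣ → F} {G : ℍ[ℝ] → F} (h : ∀ X : ℍ[ℝ]ˣ, f X = G X) :
    Set.EqOn (ext f) G {0}ᶜ := fun X hX => by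
  have hX' : X ≠ 0 := hX
  rw [ext_of_ne f hX', h, Units.val_mk0]

theorem ext_eventuallyEq {f : ℍ[ℝ]ˣ → F} {G : ℍ[ℝ] → F} (h : ∀ X : ℍ[ℝ]ˣ, f X = G X)
    (X : ℍ[ℝ]ˣ) : ext f =ᶠ[nhds (X : ℍ[ℝ])] G :=
  (ext_eqOn h).eventuallyEq_of_mem (isOpen_compl_singleton.mem_nhds X.ne_zero)

theorem ext_comp {G : Type*} [Zero G] (T : F → G) (hT : T 0 = 0) (f : ℍ[ℝ]ˣ → F) (X : ℍ[ℝ]) :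
    ext (fun Y => T (f Y)) X = T (ext f X) := by
  by_cases h : X = 0
  · rw [h, ext_zero, ext_zero, hT]
  · rw [ext_of_ne _ h, ext_of_ne _ h]

theorem ext_comp₂ {G H : Type*} [Zero G] [Zero H] (T : F → G → H) (hT : T 0 0 = 0)
    (f : ℍ[ℝ]ˣ → F) (g : ℍ[ℝ]ˣ → G) (X : ℍ[ℝ]) :
    ext (fun Y => T (f Y) (g Y)) X = T (ext f X) (ext g X) := by
  by_cases h : X = 0
  · rw [h, ext_zero, ext_zero, ext_zero, hT]
  · rw [ext_of_ne _ h, ext_of_ne _ h, ext_of_ne _ h]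

end Ext

theorem ext_add (f g : ℍ[ℝ]ˣ → ℂ) : ext (f + g) = ext f + ext g :=
  funext fun X => ext_comp₂ (· + ·) (by simp) f g X

theorem ext_mul (f g : ℍ[ℝ]ˣ → ℂ) : ext (f * g) = ext f * ext g :=
  funext fun X => ext_comp₂ (· * ·) (by simp) f g X

theorem ext_smul (c : ℂ) (f : ℍ[ℝ]ˣ → ℂ) : ext (c • f) = c • ext f :=
  funext fun X => ext_comp (c • ·) (by simp) f X

theorem ext_star (f : ℍ[ℝ]ˣ → ℂ) : ext (star f) = fun X => star (ext f X) :=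
  funext fun X => ext_comp star (by simp) f X

/-- The functions on `ℍˣ` that are smooth in the real sense. -/
def smooth : StarSubalgebra ℂ (ℍ[ℝ]ˣ → ℂ) where
  carrier := {f | ContDiffOn ℝ ((⊤ : ℕ∞) : WithTop ℕ∞) (ext f) {0}ᶜ}
  mul_mem' hf hg := by
    simp only [Set.mem_ofPred_eq, ext_mul] at *; exact hf.mul hg
  add_mem' hf hg := by
    simp only [Set.mem_ofPred_eq, ext_add] at *; exact hf.add hg
  algebraMap_mem' c := (contDiffOn_const (c := c)).congr (ext_eqOn fun _ => rfl)
  star_mem' {f} hf := by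
    simp only [Set.mem_ofPred_eq] at *
    rw [ext_star]
    exact Complex.conjCLE.contDiff.comp_contDiffOn hf

theorem smooth.contDiffOn (f : smooth) :
    ContDiffOn ℝ ((⊤ : ℕ∞) : WithTop ℕ∞) (ext f.1) {0}ᶜ := f.2

theorem smooth.contDiffAt (f : smooth) {X : ℍ[ℝ]} (hX : X ≠ 0) :
    ContDiffAt ℝ ((⊤ : ℕ∞) : WithTop ℕ∞) (ext f.1) X :=
  (smooth.contDiffOn f).contDiffAt (isOpen_compl_singleton.mem_nhds hX)

theorem smooth.differentiableAt (f : smooth) {X : ℍ[ℝ]} (hX : X ≠ 0) :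
    DifferentiableAt ℝ (ext f.1) X :=
  (smooth.contDiffAt f hX).differentiableAt (by simp)

theorem smooth.differentiableAt_coe (f : smooth) (X : ℍ[ℝ]ˣ) :
    DifferentiableAt ℝ (ext f.1) (X : ℍ[ℝ]) := smooth.differentiableAt f X.ne_zero

theorem smooth.pd_mem (i : Fin 4) (f : smooth) : pd i f.1 ∈ smooth := by
  have h := (smooth.contDiffOn f).fderiv_of_isOpen (m := ((⊤ : ℕ∞) : WithTop ℕ∞))
    isOpen_compl_singleton (by simp)
  exact (h.clm_apply (contDiffOn_const (c := e i))).congr (ext_eqOn fun X => rfl)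

/-- The partial derivatives as derivations of the algebra of smooth functions. -/
def D (i : Fin 4) : Derivation ℂ smooth smooth :=
  Derivation.mk'
    { toFun := fun f => ⟨pd i f.1, smooth.pd_mem i f⟩
      map_add' := fun f g => Subtype.ext <| funext fun X => by
        show fderiv ℝ (ext (f.1 + g.1)) X (e i) = _
        rw [ext_add, fderiv_add (smooth.differentiableAt_coe f X) (smooth.differentiableAt_coe g X)]
        rfl
      map_smul' := fun c f => Subtype.ext <| funext fun X => by
        show fderiv ℝ (ext (c • f.1)) X (e i) = _
        rw [ext_smul, fderiv_const_smul (smooth.differentiableAt_coe f X)]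
        rfl }
    fun f g => Subtype.ext <| funext fun X => by
      show fderiv ℝ (ext (f.1 * g.1)) X (e i) = f.1 X * pd i g.1 X + g.1 X * pd i f.1 X
      rw [ext_mul, fderiv_mul (smooth.differentiableAt_coe f X) (smooth.differentiableAt_coe g X),
        ext_coe, ext_coe]
      rfl

theorem D_apply (i : Fin 4) (f : smooth) (X : ℍ[ℝ]ˣ) :
    (D i f).1 X = fderiv ℝ (ext f.1) (X : ℍ[ℝ]) (e i) := rfl

theorem two_le_smooth : (2 : WithTop ℕ∞) ≤ ((⊤ : ℕ∞) : WithTop ℕ∞) :=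
  WithTop.coe_le_coe.2 (le_top : (2 : ℕ∞) ≤ ⊤)

theorem D_comm (i j : Fin 4) (f : smooth) : D i (D j f) = D j (D i f) := by
  refine Subtype.ext <| funext fun X => ?_
  have hX : (X : ℍ[ℝ]) ≠ 0 := X.ne_zero
  have key (i j : Fin 4) : (D i (D j f)).1 X =
      fderiv ℝ (fderiv ℝ (ext f.1)) (X : ℍ[ℝ]) (e i) (e j) := by
    rw [D_apply]
    have h1 : ext (D j f).1 =ᶠ[nhds (X : ℍ[ℝ])] fun Y => fderiv ℝ (ext f.1) Y (e j) :=
      ext_eventuallyEq (G := fun Y => fderiv ℝ (ext f.1) Y (e j)) (fun Y => rfl) X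
    have h2 : DifferentiableAt ℝ (fderiv ℝ (ext f.1)) (X : ℍ[ℝ]) :=
      ((smooth.contDiffAt f hX).fderiv_right (m := 1)
        (one_add_one_eq_two.le.trans two_le_smooth)).differentiableAt (by simp)
    rw [h1.fderiv_eq, fderiv_clm_apply h2 (differentiableAt_const _)]
    simp
  rw [key, key]
  exact ((smooth.contDiffAt f hX).isSymmSndFDerivAt (by
    rw [minSmoothness_of_isRCLikeNormedField]
    exact two_le_smooth)).eq _ _

theorem D_star (i : Fin 4) (f : smooth) : D i (star f) = star (D i f) := by
  refine Subtype.ext <| funext fun X => ?_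
  have h : HasFDerivAt (ext (star f).1)
      ((Complex.conjCLE : ℂ →L[ℝ] ℂ).comp (fderiv ℝ (ext f.1) (X : ℍ[ℝ]))) (X : ℍ[ℝ]) := by
    have := (Complex.conjCLE : ℂ →L[ℝ] ℂ).hasFDerivAt.comp (X : ℍ[ℝ])
      (smooth.differentiableAt_coe f X).hasFDerivAt
    rw [show ext (star f).1 = _ from ext_star f.1]
    exact this
  rw [D_apply, h.fderiv]
  rfl

/-- The coordinates as continuous linear forms. -/
def coordL (i : Fin 4) : ℍ[ℝ] →L[ℝ] ℝ :=
  LinearMap.toContinuousLinearMap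
    { toFun := coord i
      map_add' := fun X Y => by fin_cases i <;> rfl
      map_smul' := fun c X => by fin_cases i <;> rfl }

theorem coordL_apply (i : Fin 4) (X : ℍ[ℝ]) : coordL i X = coord i X := rfl

theorem coord_e (i j : Fin 4) : coord j (e i) = if i = j then 1 else 0 := by
  fin_cases i <;> fin_cases j <;> simp [coord, e]

theorem sum_coord_smul_e (X : ℍ[ℝ]) : ∑ i, coord i X • e i = X := by
  rw [Fin.sum_univ_four]
  refine QuaternionAlgebra.ext ?_ ?_ ?_ ?_
  · show X.re * 1 + X.imI * 0 + X.imJ * 0 + X.imK * 0 = X.re; ring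
  · show X.re * 0 + X.imI * 1 + X.imJ * 0 + X.imK * 0 = X.imI; ring
  · show X.re * 0 + X.imI * 0 + X.imJ * 1 + X.imK * 0 = X.imJ; ring
  · show X.re * 0 + X.imI * 0 + X.imJ * 0 + X.imK * 1 = X.imK; ring

/-- The coordinate functions. -/
def x (i : Fin 4) : smooth :=
  ⟨fun X => (coord i (X : ℍ[ℝ]) : ℂ),
    ((Complex.ofRealCLM.comp (coordL i)).contDiff.contDiffOn).congr (ext_eqOn fun _ => rfl)⟩

theorem D_x (i j : Fin 4) : D i (x j) = if i = j then 1 else 0 := by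
  refine Subtype.ext <| funext fun X => ?_
  have h1 : ext (x j).1 =ᶠ[nhds (X : ℍ[ℝ])] Complex.ofRealCLM.comp (coordL j) :=
    ext_eventuallyEq (G := Complex.ofRealCLM.comp (coordL j)) (fun Y => rfl) X
  rw [D_apply, h1.fderiv_eq, ContinuousLinearMap.fderiv]
  show ((coord j (e i) : ℝ) : ℂ) = _
  rw [coord_e]
  split_ifs <;> simp

theorem star_x (i : Fin 4) : star (x i) = x i :=
  Subtype.ext <| funext fun _ => Complex.conj_ofReal _

theorem normSq_eq_sum (X : ℍ[ℝ]) : Quaternion.normSq X = ∑ i, coord i X ^ 2 := by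
  rw [Quaternion.normSq_def', Fin.sum_univ_four]; rfl

/-- The inverse of the norm. -/
def xinv : smooth :=
  ⟨fun X => ((Quaternion.normSq (X : ℍ[ℝ]) : ℝ) : ℂ)⁻¹, by
    have h : ContDiff ℝ ((⊤ : ℕ∞) : WithTop ℕ∞) fun X : ℍ[ℝ] => Quaternion.normSq X := by
      simp only [normSq_eq_sum]
      exact ContDiff.sum fun i _ => (coordL i).contDiff.pow 2
    have h' : ContDiff ℝ ((⊤ : ℕ∞) : WithTop ℕ∞)
        fun X : ℍ[ℝ] => ((Quaternion.normSq X : ℝ) : ℂ) := Complex.ofRealCLM.contDiff.comp h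
    refine ContDiffOn.congr (f := fun X : ℍ[ℝ] => ((Quaternion.normSq X : ℝ) : ℂ)⁻¹)
      (h'.contDiffOn.inv fun X hX => ?_) (ext_eqOn fun _ => rfl)
    rw [Complex.ofReal_ne_zero]
    exact Quaternion.normSq_ne_zero.2 hX⟩

theorem normSq_mul_xinv : (x 0 ^ 2 + x 1 ^ 2 + x 2 ^ 2 + x 3 ^ 2) * xinv = 1 := by
  refine Subtype.ext <| funext fun X => ?_
  have h : ((Quaternion.normSq (X : ℍ[ℝ]) : ℝ) : ℂ) ≠ 0 :=
    Complex.ofReal_ne_zero.2 (Quaternion.normSq_ne_zero.2 X.ne_zero)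
  have h2 : (x 0 ^ 2 + x 1 ^ 2 + x 2 ^ 2 + x 3 ^ 2 : smooth).1 X
      = ((Quaternion.normSq (X : ℍ[ℝ]) : ℝ) : ℂ) := by
    rw [normSq_eq_sum, Fin.sum_univ_four]
    push_cast; rfl
  show (x 0 ^ 2 + x 1 ^ 2 + x 2 ^ 2 + x 3 ^ 2 : smooth).1 X * _ = 1
  rw [h2]
  exact mul_inv_cancel₀ h

theorem star_xinv : star xinv = xinv :=
  Subtype.ext <| funext fun _ => by
    show star (_ : ℂ)⁻¹ = _
    rw [star_inv₀]
    congr 1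
    exact Complex.conj_ofReal _

theorem D_xinv (i : Fin 4) : D i xinv = -(2 * x i * xinv ^ 2) := by
  have h := normSq_mul_xinv
  have h1 := congrArg (D i) h
  rw [Derivation.leibniz, Derivation.map_one_eq_zero, smul_eq_mul, smul_eq_mul] at h1
  have h2 : D i (x 0 ^ 2 + x 1 ^ 2 + x 2 ^ 2 + x 3 ^ 2) = 2 * x i := by
    fin_cases i <;> simp [Derivation.leibniz_pow, D_x]
  rw [h2] at h1
  linear_combination xinv * h1 - D i xinv * h

/-- Uses that ℍ \ {0} is connected, the real dimension being greater than one. -/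
theorem exists_const_of_D {f : smooth} (h : ∀ i, D i f = 0) : ∃ c, f = algebraMap ℂ smooth c := by
  have h0 (X : ℍ[ℝ]ˣ) : fderiv ℝ (ext f.1) (X : ℍ[ℝ]) = 0 := by
    refine ContinuousLinearMap.ext fun Y => ?_
    rw [← sum_coord_smul_e Y, map_sum]
    refine Finset.sum_eq_zero fun i _ => ?_
    rw [map_smul, ← D_apply, h i]
    exact smul_zero _
  refine ⟨f.1 1, Subtype.ext <| funext fun X => ?_⟩
  have hc : IsPreconnected ({0}ᶜ : Set ℍ[ℝ]) :=
    (isConnected_compl_singleton_of_one_lt_rank (by rw [Quaternion.rank_eq_four]; norm_num)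
      0).isPreconnected
  have := isOpen_compl_singleton.is_const_of_fderiv_eq_zero (𝕜 := ℝ) hc
    (fun Y hY => (smooth.differentiableAt f hY).differentiableWithinAt)
    (fun Y hY => h0 (Units.mk0 Y hY)) (X.ne_zero : (X : ℍ[ℝ]) ∈ ({0}ᶜ : Set ℍ[ℝ]))
    (one_ne_zero : (1 : ℍ[ℝ]) ∈ ({0}ᶜ : Set ℍ[ℝ]))
  rw [ext_coe] at this
  rw [this, ← Units.val_one, ext_coe]
  rfl

/-! ### Laurent polynomials as smooth functions -/

/-- The monomials of degree `n`. -/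
def monomials (n : ℤ) : Set smooth :=
  {φ | ∃ (m : Fin 4 → ℕ) (k : ℕ), (∑ i, (m i : ℤ)) - 2 * (k : ℤ) = n ∧
    φ = (∏ i, x i ^ m i) * xinv ^ k}

/-- The Laurent polynomials of degree `n`. -/
def laurent (n : ℤ) : Submodule ℂ smooth := Submodule.span ℂ (monomials n)

/-- The inclusion of the smooth functions into all functions. -/
def incl : smooth →ₗ[ℂ] (ℍ[ℝ]ˣ → ℂ) where
  toFun f := f.1
  map_add' _ _ := rfl
  map_smul' _ _ := rfl

theorem incl_injective : Function.Injective incl := Subtype.coe_injective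

theorem map_laurent (n : ℤ) : (laurent n).map incl = laurentDeg n := by
  rw [laurent, Submodule.map_span, laurentDeg]
  congr 1
  have e (m : Fin 4 → ℕ) (k : ℕ) : incl ((∏ i, x i ^ m i) * xinv ^ k) =
      fun X : ℍ[ℝ]ˣ => (∏ i, (coord i (X : ℍ[ℝ]) : ℂ) ^ m i) *
        (((Quaternion.normSq (X : ℍ[ℝ]) : ℝ) : ℂ)⁻¹) ^ k := by
    funext X
    simp only [Fin.prod_univ_four]
    rfl
  ext φ
  constructor
  · rintro ⟨_, ⟨m, k, h, rfl⟩, rfl⟩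
    exact ⟨m, k, h, e m k⟩
  · rintro ⟨m, k, h, rfl⟩
    exact ⟨_, ⟨m, k, h, rfl⟩, e m k⟩

theorem mem_laurent_iff {n : ℤ} {f : smooth} : f ∈ laurent n ↔ f.1 ∈ laurentDeg n := by
  rw [← map_laurent]
  refine ⟨fun h => Submodule.mem_map_of_mem (f := incl) h, ?_⟩
  rintro ⟨g, hg, h⟩
  exact incl_injective h ▸ hg

theorem mul_mem_laurent {n m : ℤ} {φ ψ : smooth} (hφ : φ ∈ laurent n) (hψ : ψ ∈ laurent m) :
    φ * ψ ∈ laurent (n + m) := by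
  have h := Submodule.mul_mem_mul hφ hψ
  rw [laurent, laurent, Submodule.span_mul_span] at h
  refine Submodule.span_mono ?_ h
  rintro _ ⟨_, ⟨a, k, ha, rfl⟩, _, ⟨b, l, hb, rfl⟩, rfl⟩
  refine ⟨a + b, k + l, ?_, ?_⟩
  · simp only [Pi.add_apply, Nat.cast_add, Finset.sum_add_distrib]
    linear_combination ha + hb
  · simp only [Pi.add_apply, pow_add, Finset.prod_mul_distrib]
    ring

theorem laurent_cast {n m : ℤ} {φ : smooth} (h : φ ∈ laurent n) (e : n = m) : φ ∈ laurent m := e ▸ h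

theorem one_mem_laurent : (1 : smooth) ∈ laurent 0 :=
  Submodule.subset_span ⟨0, 0, by simp, by simp⟩

theorem x_mem_laurent (i : Fin 4) : x i ∈ laurent 1 :=
  Submodule.subset_span ⟨Pi.single i 1, 0, by simp [Pi.single_apply], by
    simp [Pi.single_apply, pow_ite]⟩

theorem xinv_mem_laurent : xinv ∈ laurent (-2) :=
  Submodule.subset_span ⟨0, 1, by simp, by simp⟩

theorem star_mem_laurent {n : ℤ} {φ : smooth} (h : φ ∈ laurent n) : star φ ∈ laurent n := by
  induction h using Submodule.span_induction with
  | mem φ h =>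
    obtain ⟨m, k, h, rfl⟩ := h
    refine Submodule.subset_span ⟨m, k, h, ?_⟩
    simp only [star_mul, star_pow, star_xinv, Fin.prod_univ_four, star_x]
    ring
  | zero => rw [star_zero]; exact zero_mem _
  | add x y _ _ hx hy => rw [star_add]; exact add_mem hx hy
  | smul c x _ hx => rw [star_smul]; exact Submodule.smul_mem _ _ hx

/-- The Laurent polynomials of degree `n` for which the derivatives have the expected degree and
Euler's identity holds. -/
def eulerian (n : ℤ) : Submodule ℂ smooth where
  carrier := {φ | φ ∈ laurent n ∧ (∀ i, D i φ ∈ laurent (n - 1)) ∧ ∑ i, x i * D i φ = (n : smooth) * φ}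
  add_mem' h h' := ⟨add_mem h.1 h'.1, fun i => by rw [map_add]; exact add_mem (h.2.1 i) (h'.2.1 i), by
    simp only [map_add, mul_add, Finset.sum_add_distrib, h.2.2, h'.2.2]⟩
  zero_mem' := ⟨zero_mem _, fun i => by rw [map_zero]; exact zero_mem _, by simp⟩
  smul_mem' c φ h := ⟨Submodule.smul_mem _ _ h.1,
    fun i => by rw [Derivation.map_smul]; exact Submodule.smul_mem _ _ (h.2.1 i), by
    simp only [Derivation.map_smul, mul_smul_comm, ← Finset.smul_sum, h.2.2]⟩

theorem mul_mem_eulerian {n m : ℤ} {φ ψ : smooth} (hφ : φ ∈ eulerian n) (hψ : ψ ∈ eulerian m) :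
    φ * ψ ∈ eulerian (n + m) := by
  refine ⟨mul_mem_laurent hφ.1 hψ.1, fun i => ?_, ?_⟩
  · rw [Derivation.leibniz, smul_eq_mul, smul_eq_mul]
    exact add_mem (laurent_cast (mul_mem_laurent hφ.1 (hψ.2.1 i)) (by ring))
      (laurent_cast (mul_mem_laurent hψ.1 (hφ.2.1 i)) (by ring))
  · have h1 := hφ.2.2
    have h2 := hψ.2.2
    simp only [Fin.sum_univ_four, Derivation.leibniz, smul_eq_mul] at *
    push_cast
    linear_combination ψ * h1 + φ * h2

theorem one_mem_eulerian : (1 : smooth) ∈ eulerian 0 :=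
  ⟨one_mem_laurent, fun i => by rw [Derivation.map_one_eq_zero]; exact zero_mem _, by simp⟩

theorem pow_mem_eulerian {n : ℤ} {φ : smooth} (h : φ ∈ eulerian n) (k : ℕ) :
    φ ^ k ∈ eulerian (k * n) := by
  induction k with
  | zero => simpa using one_mem_eulerian
  | succ k ih =>
    have := mul_mem_eulerian ih h
    rw [pow_succ]
    convert this using 2
    push_cast; ring

theorem x_mem_eulerian (i : Fin 4) : x i ∈ eulerian 1 :=
  ⟨x_mem_laurent i, fun j => by
    rw [D_x]; split_ifs
    exacts [by simpa using one_mem_laurent, zero_mem _], by simp [D_x]⟩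

theorem xinv_mem_eulerian : xinv ∈ eulerian (-2) := by
  refine ⟨xinv_mem_laurent, fun i => ?_, ?_⟩
  · rw [D_xinv, mul_assoc, two_mul]
    have := laurent_cast (mul_mem_laurent (x_mem_laurent i)
      (mul_mem_laurent xinv_mem_laurent xinv_mem_laurent)) (show _ = (-2 - 1 : ℤ) by norm_num)
    rw [← pow_two] at this
    exact neg_mem (add_mem this this)
  · have h := normSq_mul_xinv
    simp only [Fin.sum_univ_four, D_xinv]
    push_cast
    linear_combination (-2 * xinv) * h

/-- The `eulerian` subspaces are multiplicative, so it suffices to look at the coordinates and N⁻¹.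
-/
theorem laurent_le_eulerian (n : ℤ) : laurent n ≤ eulerian n := by
  refine Submodule.span_le.2 ?_
  rintro _ ⟨m, k, rfl, rfl⟩
  have h (i : Fin 4) := pow_mem_eulerian (x_mem_eulerian i) (m i)
  have := mul_mem_eulerian (mul_mem_eulerian (mul_mem_eulerian (mul_mem_eulerian (h 0) (h 1)) (h 2))
    (h 3)) (pow_mem_eulerian xinv_mem_eulerian k)
  simp only [Fin.prod_univ_four, Fin.sum_univ_four]
  rw [SetLike.mem_coe]
  convert this using 2
  ring

end QuatConf
end
noncomputable section
namespace QuatConf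

/-! ### Rotation invariance of the surface measure of the sphere -/

section Rotation

open MeasureTheory Metric
open scoped Pointwise

variable {E : Type*} [NormedAddCommGroup E] [InnerProductSpace ℝ E]

/-- The action of a linear isometry on the unit sphere. -/
def sphereMap (g : E ≃ₗᵢ[ℝ] E) (ω : sphere (0 : E) 1) : sphere (0 : E) 1 :=
  ⟨g ω, by rw [mem_sphere_zero_iff_norm, g.norm_map]; exact norm_eq_of_mem_sphere ω⟩

theorem continuous_sphereMap (g : E ≃ₗᵢ[ℝ] E) : Continuous (sphereMap g) :=
  (g.continuous.comp continuous_subtype_val).subtype_mk _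

/-- The surface measure of a set is a constant times the volume of the cone over it; isometries
preserve volume and map cones to cones. -/
theorem measurePreserving_sphereMap [FiniteDimensional ℝ E] [MeasurableSpace E] [BorelSpace E]
    (g : E ≃ₗᵢ[ℝ] E) :
    MeasurePreserving (sphereMap g) (volume : Measure E).toSphere (volume : Measure E).toSphere := by
  refine ⟨(continuous_sphereMap g).measurable, Measure.ext fun s hs => ?_⟩
  rw [Measure.map_apply (continuous_sphereMap g).measurable hs, Measure.toSphere_apply' _ hs,
    Measure.toSphere_apply' _ ((continuous_sphereMap g).measurable hs)]
  congr 1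
  rw [← g.measurePreserving.measure_preimage_emb g.toHomeomorph.measurableEmbedding
    (Set.Ioo (0 : ℝ) 1 • (Subtype.val '' s))]
  congr 1
  ext X
  constructor
  · rintro ⟨r, hr, _, ⟨ω, hω, rfl⟩, rfl⟩
    exact ⟨r, hr, _, ⟨_, hω, rfl⟩, (g.map_smul r (ω : E)).symm⟩
  · rintro ⟨r, hr, _, ⟨ω, hω, rfl⟩, h⟩
    have h : r • (ω : E) = g X := h
    refine ⟨r, hr, _, ⟨sphereMap g.symm ω, ?_, rfl⟩, ?_⟩
    · show sphereMap g (sphereMap g.symm ω) ∈ s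
      have : sphereMap g (sphereMap g.symm ω) = ω := Subtype.ext (g.apply_symm_apply _)
      rwa [this]
    · show r • g.symm (ω : E) = X
      rw [← g.symm_apply_apply X, ← h]
      exact (g.symm.map_smul r (ω : E)).symm

theorem measurableEmbedding_sphereMap [MeasurableSpace E] [BorelSpace E] (g : E ≃ₗᵢ[ℝ] E) :
    MeasurableEmbedding (sphereMap g) :=
  (Homeomorph.mk
    ⟨sphereMap g, sphereMap g.symm, fun _ => Subtype.ext (g.symm_apply_apply _),
      fun _ => Subtype.ext (g.apply_symm_apply _)⟩
    (continuous_sphereMap g) (continuous_sphereMap g.symm)).measurableEmbedding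

end Rotation

/-! ### The mean value functional on smooth functions -/

section Sphere

open MeasureTheory

/-- The unit sphere in `ℝ⁴`. -/
abbrev S3 : Type := Metric.sphere (0 : EuclideanSpace ℝ (Fin 4)) 1

/-- The surface measure of the unit sphere. -/
def surf : Measure S3 := (volume : Measure (EuclideanSpace ℝ (Fin 4))).toSphere

instance : IsFiniteMeasure surf := inferInstanceAs (IsFiniteMeasure (Measure.toSphere _))

instance : surf.IsOpenPosMeasure := inferInstanceAs (Measure.IsOpenPosMeasure (Measure.toSphere _))

/-- The points of the unit sphere as quaternions. -/
def pt (ω : S3) : ℍ[ℝ] := Quaternion.linearIsometryEquivTuple.symm (ω : EuclideanSpace ℝ (Fin 4))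

theorem continuous_pt : Continuous pt :=
  Quaternion.linearIsometryEquivTuple.symm.continuous.comp continuous_subtype_val

theorem norm_pt (ω : S3) : ‖pt ω‖ = 1 := by
  rw [pt, LinearIsometryEquiv.norm_map]; exact norm_eq_of_mem_sphere ω

theorem ne_zero_of_norm_eq_one {X : ℍ[ℝ]} (h : ‖X‖ = 1) : X ≠ 0 := by
  rintro rfl; simp at h

theorem pt_ne_zero (ω : S3) : pt ω ≠ 0 := ne_zero_of_norm_eq_one (norm_pt ω)

theorem exists_pt_eq {X : ℍ[ℝ]} (h : ‖X‖ = 1) : ∃ ω, pt ω = X :=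
  ⟨⟨Quaternion.linearIsometryEquivTuple X, by
    rw [mem_sphere_zero_iff_norm, LinearIsometryEquiv.norm_map, h]⟩,
    LinearIsometryEquiv.symm_apply_apply _ _⟩

theorem sphereIntegral_one (F : ℍ[ℝ] → ℂ) : sphereIntegral 1 F = ∫ ω, F (pt ω) ∂surf := by
  simp only [sphereIntegral, Complex.ofReal_one, one_pow, one_mul, one_smul]
  rfl

theorem integral_pt_map (g : ℍ[ℝ] →ₗᵢ[ℝ] ℍ[ℝ]) (F : ℍ[ℝ] → ℂ) :
    ∫ ω, F (g (pt ω)) ∂surf = ∫ ω, F (pt ω) ∂surf := by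
  let g' := (Quaternion.linearIsometryEquivTuple.symm.trans (g.toLinearIsometryEquiv rfl)).trans
    Quaternion.linearIsometryEquivTuple
  have h : MeasurePreserving (sphereMap g') surf surf := measurePreserving_sphereMap g'
  rw [← h.integral_comp (measurableEmbedding_sphereMap g') fun ω => F (pt ω)]
  refine integral_congr_ae (Filter.Eventually.of_forall fun ω => ?_)
  show F _ = F (Quaternion.linearIsometryEquivTuple.symm (g' ω))
  exact congrArg F (LinearIsometryEquiv.symm_apply_apply _ _).symm

theorem continuous_comp_pt {G : Type*} [TopologicalSpace G] {F : ℍ[ℝ] → G}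
    (hF : ContinuousOn F {0}ᶜ) : Continuous fun ω => F (pt ω) :=
  hF.comp_continuous continuous_pt pt_ne_zero

theorem integrable_comp_pt {F : ℍ[ℝ] → ℂ} (hF : ContinuousOn F {0}ᶜ) :
    Integrable (fun ω => F (pt ω)) surf :=
  (continuous_comp_pt hF).integrable_of_hasCompactSupport (HasCompactSupport.of_compactSpace _)

theorem smooth.continuousOn (f : smooth) : ContinuousOn (ext f.1) {0}ᶜ :=
  (smooth.contDiffOn f).continuousOn

/-- The integral over the unit sphere as a linear functional. -/
def sphI : smooth →ₗ[ℂ] ℂ where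
  toFun f := ∫ ω, ext f.1 (pt ω) ∂surf
  map_add' f g := by
    rw [← integral_add (integrable_comp_pt (smooth.continuousOn f))
      (integrable_comp_pt (smooth.continuousOn g))]
    exact integral_congr_ae (Filter.Eventually.of_forall fun ω => congrFun (ext_add f.1 g.1) _)
  map_smul' c f := by
    rw [RingHom.id_apply, smul_eq_mul, ← integral_const_mul]
    exact integral_congr_ae (Filter.Eventually.of_forall fun ω => congrFun (ext_smul c f.1) _)

theorem sphI_apply (f : smooth) : sphI f = ∫ ω, ext f.1 (pt ω) ∂surf := rfl

theorem sphI_congr {f g : smooth} (h : ∀ X : ℍ[ℝ]ˣ, ‖(X : ℍ[ℝ])‖ = 1 → f.1 X = g.1 X) :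
    sphI f = sphI g := by
  refine integral_congr_ae (Filter.Eventually.of_forall fun ω => ?_)
  show ext f.1 (pt ω) = ext g.1 (pt ω)
  rw [ext_of_ne _ (pt_ne_zero ω), ext_of_ne _ (pt_ne_zero ω)]
  exact h _ (norm_pt ω)

theorem sphI_star (f : smooth) : sphI (star f) = star (sphI f) := by
  show _ = (starRingEnd ℂ) _
  rw [sphI_apply, sphI_apply, ← integral_conj]
  exact integral_congr_ae (Filter.Eventually.of_forall fun ω => congrFun (ext_star f.1) _)

/-- The integral over the sphere of the derivative along a one-parameter family of rotations
vanishes. -/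
theorem integral_fderiv_eq_zero (f : smooth) (g : ℝ → ℍ[ℝ] →ₗᵢ[ℝ] ℍ[ℝ]) (g' : ℝ → ℍ[ℝ] → ℍ[ℝ])
    (h0 : g 0 = LinearIsometry.id) (hg : ∀ t X, HasDerivAt (fun s => g s X) (g' t X) t)
    (hg' : ∀ t X, ‖g' t X‖ = ‖X‖) (hc : Continuous (g' 0)) :
    ∫ ω, fderiv ℝ (ext f.1) (pt ω) (g' 0 (pt ω)) ∂surf = 0 := by
  have hcont : ContinuousOn (fderiv ℝ (ext f.1)) {0}ᶜ :=
    (smooth.contDiffOn f).continuousOn_fderiv_of_isOpen isOpen_compl_singleton (by simp)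
  obtain ⟨C, hC⟩ := (isCompact_sphere (0 : ℍ[ℝ]) 1)
    |>.exists_bound_of_continuousOn (E := ℍ[ℝ] →L[ℝ] ℂ)
    (hcont.mono fun X hX => ne_zero_of_norm_eq_one (mem_sphere_zero_iff_norm.1 hX))
  have hn (t : ℝ) (ω : S3) : ‖g t (pt ω)‖ = 1 := by rw [LinearIsometry.norm_map, norm_pt]
  have hm (t : ℝ) : Integrable (fun ω => ext f.1 (g t (pt ω))) surf :=
    ((smooth.continuousOn f).comp_continuous ((g t).continuous.comp continuous_pt)
      fun ω => ne_zero_of_norm_eq_one (hn t ω)).integrable_of_hasCompactSupport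
        (HasCompactSupport.of_compactSpace _)
  -- Differentiation under the integral sign. Each g t preserves the sphere and g' t preserves
  -- norms, so a bound of the derivative of f on the compact sphere dominates.
  have h := hasDerivAt_integral_of_dominated_loc_of_deriv_le (μ := surf) (𝕜 := ℝ) (x₀ := 0)
    (F := fun t ω => ext f.1 (g t (pt ω)))
    (F' := fun t ω => fderiv ℝ (ext f.1) (g t (pt ω)) (g' t (pt ω)))
    (bound := fun _ => C) (s := Set.univ) Filter.univ_mem
    (Filter.Eventually.of_forall fun t => (hm t).aestronglyMeasurable) (hm 0) ?_ ?_
    (integrable_const C) ?_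
  -- By rotation invariance the integral does not depend on t.
  · have h2 : HasDerivAt (fun t => ∫ ω, ext f.1 (g t (pt ω)) ∂surf) 0 0 := by
      simp only [integral_pt_map]
      exact hasDerivAt_const _ _
    have := h.2.unique h2
    rw [h0] at this
    exact this
  · have : Continuous fun ω => fderiv ℝ (ext f.1) (pt ω) (g' 0 (pt ω)) :=
      (continuous_comp_pt hcont).clm_apply (hc.comp continuous_pt)
    rw [h0]
    exact this.aestronglyMeasurable
  · refine Filter.Eventually.of_forall fun ω t _ => ?_
    refine (ContinuousLinearMap.le_opNorm _ _).trans ?_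
    rw [hg', norm_pt, mul_one]
    exact hC _ (mem_sphere_zero_iff_norm.2 (hn t ω))
  · refine Filter.Eventually.of_forall fun ω t _ => ?_
    have h1 := (smooth.differentiableAt f (ne_zero_of_norm_eq_one (hn t ω))).hasFDerivAt
    exact h1.comp_hasDerivAt t (hg t (pt ω))

/-- The derivative of `f` at `X` in the direction of `q`. -/
theorem fderiv_eq_sum (f : smooth) (X : ℍ[ℝ]ˣ) (q : ℍ[ℝ]) :
    fderiv ℝ (ext f.1) (X : ℍ[ℝ]) q = ∑ i, (coord i q : ℂ) * (D i f).1 X := by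
  conv_lhs => rw [← sum_coord_smul_e q, map_sum]
  refine Finset.sum_congr rfl fun i _ => ?_
  rw [map_smul, Complex.real_smul, D_apply]

/-- The points `cos t + u sin t` of the circle through the imaginary unit `u`. -/
def circ (u : ℍ[ℝ]) (t : ℝ) : ℍ[ℝ] := Real.cos t • (1 : ℍ[ℝ]) + Real.sin t • u

theorem circ_zero (u : ℍ[ℝ]) : circ u 0 = 1 := by simp [circ]

theorem norm_circ {u : ℍ[ℝ]} (hu : u * u = -1) (hr : u.re = 0) (t : ℝ) : ‖circ u t‖ = 1 := by
  have h1 : Quaternion.normSq u = 1 := by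
    have := congrArg QuaternionAlgebra.re hu
    simp [hr] at this
    rw [Quaternion.normSq_def']
    rw [hr]; linear_combination -this
  have h2 : ‖circ u t‖ * ‖circ u t‖ = 1 := by
    rw [← Quaternion.normSq_eq_norm_mul_self, ← Real.cos_sq_add_sin_sq t]
    rw [Quaternion.normSq_def'] at h1 ⊢
    simp [circ, hr] at h1 ⊢
    linear_combination (Real.sin t) ^ 2 * h1 + Real.sin_sq_add_cos_sq t
  nlinarith [norm_nonneg (circ u t)]

theorem hasDerivAt_circ {u : ℍ[ℝ]} (hu : u * u = -1) (t : ℝ) :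
    HasDerivAt (circ u) (u * circ u t) t := by
  have h := ((Real.hasDerivAt_cos t).smul_const (1 : ℍ[ℝ])).add
    ((Real.hasDerivAt_sin t).smul_const u)
  have e : u * circ u t = -Real.sin t • (1 : ℍ[ℝ]) + Real.cos t • u := by
    rw [circ, mul_add, mul_smul_comm, mul_smul_comm, hu, mul_one, smul_neg, neg_smul, add_comm]
  rw [e]
  exact h

/-- Left multiplication by a unit quaternion. -/
def mulLeftIsom {q : ℍ[ℝ]} (h : ‖q‖ = 1) : ℍ[ℝ] →ₗᵢ[ℝ] ℍ[ℝ] :=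
  ⟨LinearMap.mulLeft ℝ q, fun X => by simp [h]⟩

/-- Right multiplication by a unit quaternion. -/
def mulRightIsom {q : ℍ[ℝ]} (h : ‖q‖ = 1) : ℍ[ℝ] →ₗᵢ[ℝ] ℍ[ℝ] :=
  ⟨LinearMap.mulRight ℝ q, fun X => by simp [h]⟩

theorem norm_eq_one_of_mul_self {u : ℍ[ℝ]} (hu : u * u = -1) : ‖u‖ = 1 := by
  have h := congrArg norm hu
  rw [norm_mul, norm_neg, norm_one] at h
  nlinarith [norm_nonneg u]

theorem integral_fderiv_mul_left (f : smooth) {u : ℍ[ℝ]} (hu : u * u = -1) (hr : u.re = 0) :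
    ∫ ω, fderiv ℝ (ext f.1) (pt ω) (u * pt ω) ∂surf = 0 := by
  have := integral_fderiv_eq_zero f (fun t => mulLeftIsom (norm_circ hu hr t))
    (fun t X => u * circ u t * X) (LinearIsometry.ext fun X => by
      show circ u 0 * X = X
      rw [circ_zero, one_mul])
    (fun t X => (hasDerivAt_circ hu t).mul_const X) (fun t X => by
      rw [norm_mul, norm_mul, norm_eq_one_of_mul_self hu, norm_circ hu hr, one_mul, one_mul])
    (by fun_prop)
  simpa only [circ_zero, mul_one] using this

theorem integral_fderiv_mul_right (f : smooth) {u : ℍ[ℝ]} (hu : u * u = -1) (hr : u.re = 0) :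
    ∫ ω, fderiv ℝ (ext f.1) (pt ω) (pt ω * u) ∂surf = 0 := by
  have := integral_fderiv_eq_zero f (fun t => mulRightIsom (norm_circ hu hr t))
    (fun t X => X * (u * circ u t)) (LinearIsometry.ext fun X => by
      show X * circ u 0 = X
      rw [circ_zero, mul_one])
    (fun t X => (hasDerivAt_circ hu t).const_mul X) (fun t X => by
      rw [norm_mul, norm_mul, norm_eq_one_of_mul_self hu, norm_circ hu hr, one_mul, mul_one])
    (by fun_prop)
  simpa only [circ_zero, mul_one] using this

theorem sphI_eq_zero_of_integral (f : smooth) (q : ℍ[ℝ] → ℍ[ℝ]) (w : Fin 4 → smooth)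
    (hw : ∀ i (X : ℍ[ℝ]ˣ), (w i).1 X = coord i (q X))
    (h : ∫ ω, fderiv ℝ (ext f.1) (pt ω) (q (pt ω)) ∂surf = 0) :
    sphI (w 0 * D 0 f + w 1 * D 1 f + w 2 * D 2 f + w 3 * D 3 f) = 0 := by
  rw [← h, sphI_apply]
  refine integral_congr_ae (Filter.Eventually.of_forall fun ω => ?_)
  show ext _ (pt ω) = fderiv ℝ (ext f.1) (pt ω) (q (pt ω))
  rw [ext_of_ne _ (pt_ne_zero ω)]
  have := fderiv_eq_sum f (Units.mk0 (pt ω) (pt_ne_zero ω)) (q (pt ω))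
  rw [Units.val_mk0] at this
  rw [this, Fin.sum_univ_four]
  show (w 0).1 _ * _ + (w 1).1 _ * _ + (w 2).1 _ * _ + (w 3).1 _ * _ = _
  simp only [hw, Units.val_mk0]

theorem re_e (i : Fin 4) : (e i).re = if i = 0 then 1 else 0 := by fin_cases i <;> rfl
theorem imI_e (i : Fin 4) : (e i).imI = if i = 1 then 1 else 0 := by fin_cases i <;> rfl
theorem imJ_e (i : Fin 4) : (e i).imJ = if i = 2 then 1 else 0 := by fin_cases i <;> rfl
theorem imK_e (i : Fin 4) : (e i).imK = if i = 3 then 1 else 0 := by fin_cases i <;> rfl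

theorem e_mul_self {i : Fin 4} (hi : i ≠ 0) : e i * e i = -1 := by
  fin_cases i
  · exact absurd rfl hi
  all_goals ext <;> simp [re_e, imI_e, imJ_e, imK_e]

/-- Here and in the five companions, the coefficients are the coordinates of the product of an
imaginary unit with X, the velocity of a one-parameter group of rotations. -/
theorem sphI_left1 (f : smooth) :
    sphI (-x 1 * D 0 f + x 0 * D 1 f + -x 3 * D 2 f + x 2 * D 3 f) = 0 :=
  sphI_eq_zero_of_integral f (e 1 * ·) ![-x 1, x 0, -x 3, x 2] (fun i X => by
    fin_cases i <;> simp [coord, re_e, imI_e, imJ_e, imK_e, x])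
    (integral_fderiv_mul_left f (e_mul_self (by decide)) (by simp [re_e]))

theorem sphI_left2 (f : smooth) :
    sphI (-x 2 * D 0 f + x 3 * D 1 f + x 0 * D 2 f + -x 1 * D 3 f) = 0 :=
  sphI_eq_zero_of_integral f (e 2 * ·) ![-x 2, x 3, x 0, -x 1] (fun i X => by
    fin_cases i <;> simp [coord, re_e, imI_e, imJ_e, imK_e, x])
    (integral_fderiv_mul_left f (e_mul_self (by decide)) (by simp [re_e]))

theorem sphI_left3 (f : smooth) :
    sphI (-x 3 * D 0 f + -x 2 * D 1 f + x 1 * D 2 f + x 0 * D 3 f) = 0 :=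
  sphI_eq_zero_of_integral f (e 3 * ·) ![-x 3, -x 2, x 1, x 0] (fun i X => by
    fin_cases i <;> simp [coord, re_e, imI_e, imJ_e, imK_e, x])
    (integral_fderiv_mul_left f (e_mul_self (by decide)) (by simp [re_e]))

theorem sphI_right1 (f : smooth) :
    sphI (-x 1 * D 0 f + x 0 * D 1 f + x 3 * D 2 f + -x 2 * D 3 f) = 0 :=
  sphI_eq_zero_of_integral f (· * e 1) ![-x 1, x 0, x 3, -x 2] (fun i X => by
    fin_cases i <;> simp [coord, re_e, imI_e, imJ_e, imK_e, x])
    (integral_fderiv_mul_right f (e_mul_self (by decide)) (by simp [re_e]))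

theorem sphI_right2 (f : smooth) :
    sphI (-x 2 * D 0 f + -x 3 * D 1 f + x 0 * D 2 f + x 1 * D 3 f) = 0 :=
  sphI_eq_zero_of_integral f (· * e 2) ![-x 2, -x 3, x 0, x 1] (fun i X => by
    fin_cases i <;> simp [coord, re_e, imI_e, imJ_e, imK_e, x])
    (integral_fderiv_mul_right f (e_mul_self (by decide)) (by simp [re_e]))

theorem sphI_right3 (f : smooth) :
    sphI (-x 3 * D 0 f + x 2 * D 1 f + -x 1 * D 2 f + x 0 * D 3 f) = 0 :=
  sphI_eq_zero_of_integral f (· * e 3) ![-x 3, x 2, -x 1, x 0] (fun i X => by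
    fin_cases i <;> simp [coord, re_e, imI_e, imJ_e, imK_e, x])
    (integral_fderiv_mul_right f (e_mul_self (by decide)) (by simp [re_e]))

theorem ext_smul_of_mem_laurent {n : ℤ} {f : smooth} (hf : f ∈ laurent n) {r : ℝ} (hr : r ≠ 0)
    {X : ℍ[ℝ]} (hX : X ≠ 0) : ext f.1 (r • X) = (r : ℂ) ^ n * ext f.1 X := by
  have hX' : r • X ≠ 0 := smul_ne_zero hr hX
  have hr' : (r : ℂ) ≠ 0 := Complex.ofReal_ne_zero.2 hr
  rw [ext_of_ne _ hX, ext_of_ne _ hX']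
  induction hf using Submodule.span_induction with
  | mem φ h =>
    obtain ⟨m, k, rfl, rfl⟩ := h
    have hc (i : Fin 4) : (x i).1 (Units.mk0 (r • X) hX') = r * (x i).1 (Units.mk0 X hX) := by
      fin_cases i <;> simp [x, coord]
    have hN : xinv.1 (Units.mk0 (r • X) hX') = ((r : ℂ) ^ 2)⁻¹ * xinv.1 (Units.mk0 X hX) := by
      simp only [xinv, Units.val_mk0, Quaternion.normSq_smul]
      push_cast
      rw [mul_inv]
    have hv (Y : ℍ[ℝ]ˣ) : ((∏ i, x i ^ m i) * xinv ^ k).1 Y =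
        (∏ i, (x i).1 Y ^ m i) * xinv.1 Y ^ k := by
      simp only [Fin.prod_univ_four]
      rfl
    simp only [hv, hc, hN, mul_pow, Finset.prod_mul_distrib, Finset.prod_pow_eq_pow_sum]
    rw [zpow_sub₀ hr', mul_comm (2 : ℤ), ← Nat.cast_sum, zpow_natCast, mul_comm (k : ℤ), zpow_mul,
      zpow_natCast, inv_pow]
    rw [div_eq_mul_inv]
    norm_cast
    push_cast
    ring
  | zero => exact (mul_zero _).symm
  | add f g _ _ hf hg =>
    show f.1 _ + g.1 _ = _ * (f.1 _ + g.1 _)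
    rw [hf, hg, mul_add]
  | smul c f _ hf =>
    show c * f.1 _ = _ * (c * f.1 _)
    rw [hf]; ring

/-- By homogeneity, a Laurent polynomial of one degree that vanishes on the unit sphere vanishes
everywhere. -/
theorem exists_pt_ne_zero {n : ℤ} {f : smooth} (hf : f ∈ laurent n) (h0 : f ≠ 0) :
    ∃ ω, ext f.1 (pt ω) ≠ 0 := by
  by_contra! h
  refine h0 (Subtype.ext <| funext fun X => ?_)
  have hX : ‖(X : ℍ[ℝ])‖ ≠ 0 := norm_ne_zero_iff.2 X.ne_zero
  obtain ⟨ω, hω⟩ := exists_pt_eq (X := ‖(X : ℍ[ℝ])‖⁻¹ • (X : ℍ[ℝ])) (by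
    rw [norm_smul, norm_inv, norm_norm, inv_mul_cancel₀ hX])
  have := ext_smul_of_mem_laurent hf hX (pt_ne_zero ω)
  rw [h, mul_zero, hω, smul_inv_smul₀ hX, ext_coe] at this
  exact this

theorem sphI_pos {n : ℤ} {f : smooth} (hf : f ∈ laurent n) (h0 : f ≠ 0) :
    0 < (sphI (f * star f)).re := by
  have h : sphI (f * star f) = ((∫ ω, ‖ext f.1 (pt ω)‖ ^ 2 ∂surf : ℝ) : ℂ) := by
    rw [← integral_complex_ofReal, sphI_apply]
    refine integral_congr_ae (Filter.Eventually.of_forall fun ω => ?_)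
    show ext (f.1 * star f.1) (pt ω) = _
    rw [ext_mul, ext_star]
    show _ * (starRingEnd ℂ) _ = _
    rw [Complex.mul_conj, Complex.normSq_eq_norm_sq]
  obtain ⟨ω, hω⟩ := exists_pt_ne_zero hf h0
  rw [h, Complex.ofReal_re]
  have hc : Continuous fun ω => ‖ext f.1 (pt ω)‖ ^ 2 :=
    (continuous_comp_pt (smooth.continuousOn f)).norm.pow 2
  exact hc.integral_pos_of_hasCompactSupport_nonneg_nonzero (HasCompactSupport.of_compactSpace _)
    (fun ω => by positivity) (x := ω) (pow_ne_zero 2 (norm_ne_zero_iff.2 hω))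

end Sphere

/-! ### The conformal calculus on `ℍˣ` -/

/-- The entries of the matrix realization of a quaternion. -/
def zc : Matrix (Fin 2) (Fin 2) smooth :=
  !![x 0 - Complex.I • x 3, -(Complex.I • x 1) - x 2;
     -(Complex.I • x 1) + x 2, x 0 + Complex.I • x 3]

/-- The derivations dual to the matrix entries. -/
def Pc (a b : Fin 2) : Derivation ℂ smooth smooth :=
  ![![(1 / 2 : ℂ) • (D 0 + Complex.I • D 3), (1 / 2 : ℂ) • (Complex.I • D 1 - D 2)],
    ![(1 / 2 : ℂ) • (Complex.I • D 1 + D 2), (1 / 2 : ℂ) • (D 0 - Complex.I • D 3)]] a b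

/-- The imaginary unit as a constant function. -/
def cI : smooth := algebraMap ℂ smooth Complex.I

/-- The constant function `1 / 2`. -/
def cHalf : smooth := algebraMap ℂ smooth (1 / 2)

theorem cI_sq : cI ^ 2 = -1 := by
  rw [cI, ← map_pow, Complex.I_sq, map_neg, map_one]

theorem two_mul_cHalf : 2 * cHalf = 1 := by
  have : (2 : smooth) = algebraMap ℂ smooth 2 := (map_ofNat _ 2).symm
  rw [cHalf, this, ← map_mul]
  norm_num

theorem zc00 : zc 0 0 = x 0 - cI * x 3 := by rw [cI, ← Algebra.smul_def]; rfl
theorem zc01 : zc 0 1 = -(cI * x 1) - x 2 := by rw [cI, ← Algebra.smul_def]; rfl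
theorem zc10 : zc 1 0 = -(cI * x 1) + x 2 := by rw [cI, ← Algebra.smul_def]; rfl
theorem zc11 : zc 1 1 = x 0 + cI * x 3 := by rw [cI, ← Algebra.smul_def]; rfl

theorem Pc00 (f : smooth) : Pc 0 0 f = cHalf * (D 0 f + cI * D 3 f) := by
  rw [cI, cHalf, ← Algebra.smul_def, ← Algebra.smul_def]; rfl
theorem Pc01 (f : smooth) : Pc 0 1 f = cHalf * (cI * D 1 f - D 2 f) := by
  rw [cI, cHalf, ← Algebra.smul_def, ← Algebra.smul_def]; rfl
theorem Pc10 (f : smooth) : Pc 1 0 f = cHalf * (cI * D 1 f + D 2 f) := by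
  rw [cI, cHalf, ← Algebra.smul_def, ← Algebra.smul_def]; rfl
theorem Pc11 (f : smooth) : Pc 1 1 f = cHalf * (D 0 f - cI * D 3 f) := by
  rw [cI, cHalf, ← Algebra.smul_def, ← Algebra.smul_def]; rfl

theorem D_cI (i : Fin 4) : D i cI = 0 := Derivation.map_algebraMap _ _
theorem D_cHalf (i : Fin 4) : D i cHalf = 0 := Derivation.map_algebraMap _ _

theorem star_cI : star cI = -cI := by
  rw [cI, ← algebraMap_star_comm, ← map_neg]
  exact congrArg _ Complex.conj_I

theorem star_cHalf : star cHalf = cHalf := by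
  rw [cHalf, ← algebraMap_star_comm]
  congr 1
  simp

theorem sphI_cI_mul (f : smooth) : sphI (cI * f) = Complex.I * sphI f := by
  rw [cI, ← Algebra.smul_def, map_smul, smul_eq_mul]

theorem sphI_cHalf_mul (f : smooth) : sphI (cHalf * f) = 1 / 2 * sphI f := by
  rw [cHalf, ← Algebra.smul_def, map_smul, smul_eq_mul]

theorem det_zc : zc 0 0 * zc 1 1 - zc 0 1 * zc 1 0 = x 0 ^ 2 + x 1 ^ 2 + x 2 ^ 2 + x 3 ^ 2 := by
  rw [zc00, zc01, zc10, zc11]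
  linear_combination (-x 3 ^ 2 - x 1 ^ 2) * cI_sq

theorem Pc_zc (a b c d : Fin 2) : Pc a b (zc c d) = if a = c ∧ b = d then 1 else 0 := by
  have h := cI_sq
  have h2 := two_mul_cHalf
  fin_cases a <;> fin_cases b <;> fin_cases c <;> fin_cases d <;>
    simp [Pc00, Pc01, Pc10, Pc11, zc00, zc01, zc10, zc11, D_x, D_cI] <;> grind

theorem Pc_comm (a b c d : Fin 2) (f : smooth) : Pc a b (Pc c d f) = Pc c d (Pc a b f) := by
  have h (i j : Fin 4) := D_comm i j f
  fin_cases a <;> fin_cases b <;> fin_cases c <;> fin_cases d <;>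
    simp [Pc00, Pc01, Pc10, Pc11, D_cI, D_cHalf] <;>
    simp only [h 3 0, h 3 1, h 3 2, h 2 0, h 2 1, h 1 0] <;> ring

theorem zc_mem (a b : Fin 2) : zc a b ∈ laurent 1 := by
  have h (i : Fin 4) := x_mem_laurent i
  have hI (i : Fin 4) := Submodule.smul_mem _ Complex.I (h i)
  fin_cases a <;> fin_cases b
  exacts [sub_mem (h 0) (hI 3), sub_mem (neg_mem (hI 1)) (h 2), add_mem (neg_mem (hI 1)) (h 2),
    add_mem (h 0) (hI 3)]

theorem Pc_mem {n : ℤ} {f : smooth} (hf : f ∈ laurent n) (a b : Fin 2) :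
    Pc a b f ∈ laurent (n - 1) := by
  have h (i : Fin 4) := (laurent_le_eulerian n hf).2.1 i
  have hI (i : Fin 4) := Submodule.smul_mem _ Complex.I (h i)
  fin_cases a <;> fin_cases b <;> refine Submodule.smul_mem _ (1 / 2 : ℂ) ?_
  exacts [add_mem (h 0) (hI 3), sub_mem (hI 1) (h 2), add_mem (hI 1) (h 2),
    sub_mem (h 0) (hI 3)]

theorem D0_eq (f : smooth) : D 0 f = Pc 0 0 f + Pc 1 1 f := by
  rw [Pc00, Pc11]; linear_combination (-D 0 f) * two_mul_cHalf
theorem D1_eq (f : smooth) : D 1 f = -cI * (Pc 0 1 f + Pc 1 0 f) := by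
  rw [Pc01, Pc10]
  linear_combination (-D 1 f) * two_mul_cHalf + (2 * cHalf * D 1 f) * cI_sq
theorem D2_eq (f : smooth) : D 2 f = Pc 1 0 f - Pc 0 1 f := by
  rw [Pc01, Pc10]; linear_combination (-D 2 f) * two_mul_cHalf
theorem D3_eq (f : smooth) : D 3 f = -cI * (Pc 0 0 f - Pc 1 1 f) := by
  rw [Pc00, Pc11]
  linear_combination (-D 3 f) * two_mul_cHalf + (2 * cHalf * D 3 f) * cI_sq

theorem zc_mul_Pc (f : smooth) :
    zc 0 0 * Pc 0 0 f + zc 0 1 * Pc 0 1 f + zc 1 0 * Pc 1 0 f + zc 1 1 * Pc 1 1 f =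
      ∑ i, x i * D i f := by
  rw [Fin.sum_univ_four, D0_eq, D1_eq, D2_eq, D3_eq, zc00, zc01, zc10, zc11]
  ring

/-- The diagonal rotation fields differ by i times the rotation field of `e 3`; the off-diagonal
ones below are complex combinations of those of `e 1` and `e 2`. -/
theorem zc_left_diag (f : smooth) : zc 0 0 * Pc 0 0 f + zc 0 1 * Pc 0 1 f =
    (zc 1 0 * Pc 1 0 f + zc 1 1 * Pc 1 1 f) +
      cI * (-x 3 * D 0 f + -x 2 * D 1 f + x 1 * D 2 f + x 0 * D 3 f) := by
  rw [D0_eq, D1_eq, D2_eq, D3_eq, zc00, zc01, zc10, zc11]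
  linear_combination
    (-(x 2 * (Pc 0 1 f + Pc 1 0 f) - x 0 * (Pc 0 0 f - Pc 1 1 f))) * cI_sq

theorem zc_right_diag (f : smooth) : zc 0 0 * Pc 0 0 f + zc 1 0 * Pc 1 0 f =
    (zc 0 1 * Pc 0 1 f + zc 1 1 * Pc 1 1 f) +
      cI * (-x 3 * D 0 f + x 2 * D 1 f + -x 1 * D 2 f + x 0 * D 3 f) := by
  rw [D0_eq, D1_eq, D2_eq, D3_eq, zc00, zc01, zc10, zc11]
  linear_combination (x 2 * (Pc 0 1 f + Pc 1 0 f) + x 0 * (Pc 0 0 f - Pc 1 1 f)) * cI_sq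

theorem sphI_left01 (f : smooth) : sphI (zc 1 0 * Pc 0 0 f + zc 1 1 * Pc 0 1 f) = 0 := by
  have e : zc 1 0 * Pc 0 0 f + zc 1 1 * Pc 0 1 f =
      cHalf * (cI * (-x 1 * D 0 f + x 0 * D 1 f + -x 3 * D 2 f + x 2 * D 3 f)
        - (-x 2 * D 0 f + x 3 * D 1 f + x 0 * D 2 f + -x 1 * D 3 f)) := by
    rw [Pc00, Pc01, zc10, zc11]
    linear_combination (cHalf * (x 3 * D 1 f - x 1 * D 3 f)) * cI_sq
  rw [e, sphI_cHalf_mul, map_sub, sphI_cI_mul, sphI_left1, sphI_left2]; simp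

theorem sphI_left10 (f : smooth) : sphI (zc 0 0 * Pc 1 0 f + zc 0 1 * Pc 1 1 f) = 0 := by
  have e : zc 0 0 * Pc 1 0 f + zc 0 1 * Pc 1 1 f =
      cHalf * (cI * (-x 1 * D 0 f + x 0 * D 1 f + -x 3 * D 2 f + x 2 * D 3 f)
        + (-x 2 * D 0 f + x 3 * D 1 f + x 0 * D 2 f + -x 1 * D 3 f)) := by
    rw [Pc10, Pc11, zc00, zc01]
    linear_combination (cHalf * (-x 3 * D 1 f + x 1 * D 3 f)) * cI_sq
  rw [e, sphI_cHalf_mul, map_add, sphI_cI_mul, sphI_left1, sphI_left2]; simp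

theorem sphI_right10 (f : smooth) : sphI (zc 0 1 * Pc 0 0 f + zc 1 1 * Pc 1 0 f) = 0 := by
  have e : zc 0 1 * Pc 0 0 f + zc 1 1 * Pc 1 0 f =
      cHalf * (cI * (-x 1 * D 0 f + x 0 * D 1 f + x 3 * D 2 f + -x 2 * D 3 f)
        + (-x 2 * D 0 f + -x 3 * D 1 f + x 0 * D 2 f + x 1 * D 3 f)) := by
    rw [Pc00, Pc10, zc01, zc11]
    linear_combination (cHalf * (x 3 * D 1 f - x 1 * D 3 f)) * cI_sq
  rw [e, sphI_cHalf_mul, map_add, sphI_cI_mul, sphI_right1, sphI_right2]; simp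

theorem sphI_right01 (f : smooth) : sphI (zc 0 0 * Pc 0 1 f + zc 1 0 * Pc 1 1 f) = 0 := by
  have e : zc 0 0 * Pc 0 1 f + zc 1 0 * Pc 1 1 f =
      cHalf * (cI * (-x 1 * D 0 f + x 0 * D 1 f + x 3 * D 2 f + -x 2 * D 3 f)
        - (-x 2 * D 0 f + -x 3 * D 1 f + x 0 * D 2 f + x 1 * D 3 f)) := by
    rw [Pc01, Pc11, zc00, zc10]
    linear_combination (cHalf * (-x 3 * D 1 f + x 1 * D 3 f)) * cI_sq
  rw [e, sphI_cHalf_mul, map_sub, sphI_cI_mul, sphI_right1, sphI_right2]; simp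

theorem sphI_det (f : smooth) :
    sphI ((zc 0 0 * zc 1 1 - zc 0 1 * zc 1 0) * f) = sphI f := by
  refine sphI_congr fun X hX => ?_
  have h : (x 0 ^ 2 + x 1 ^ 2 + x 2 ^ 2 + x 3 ^ 2 : smooth).1 X = 1 := by
    have h1 : (x 0 ^ 2 + x 1 ^ 2 + x 2 ^ 2 + x 3 ^ 2 : smooth).1 X
        = ((Quaternion.normSq (X : ℍ[ℝ]) : ℝ) : ℂ) := by
      rw [normSq_eq_sum, Fin.sum_univ_four]
      push_cast; rfl
    rw [h1, Quaternion.normSq_eq_norm_mul_self, hX]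
    simp
  rw [det_zc]
  show (x 0 ^ 2 + x 1 ^ 2 + x 2 ^ 2 + x 3 ^ 2 : smooth).1 X * f.1 X = _
  rw [h, one_mul]

/-- The conformal calculus of smooth functions on `ℍˣ`, with the Laurent polynomials and the
integral over the unit sphere. -/
def calculus : ConformalCalculus smooth where
  z := zc
  P := Pc
  Ninv := xinv
  L := laurent
  I := sphI
  P_z := Pc_zc
  P_comm := Pc_comm
  det_mul_Ninv := by rw [det_zc, normSq_mul_xinv]
  star_z00 := by rw [zc00, zc11]; simp [star_x, star_cI]; ring
  star_z01 := by rw [zc01, zc10]; simp [star_x, star_cI]; ring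
  star_P00 f := by
    rw [Pc00, Pc11]; simp [star_cI, star_cHalf, D_star]; ring
  star_P01 f := by
    rw [Pc01, Pc10]; simp [star_cI, star_cHalf, D_star]; ring
  one_mem := one_mem_laurent
  z_mul_mem h a b := laurent_cast (mul_mem_laurent (zc_mem a b) h) (add_comm _ _)
  Ninv_mul_mem h := laurent_cast (mul_mem_laurent xinv_mem_laurent h) (by ring)
  P_mem := Pc_mem
  star_mem := star_mem_laurent
  euler h := (zc_mul_Pc _).trans (laurent_le_eulerian _ h).2.2
  exists_const f h := exists_const_of_D fun i => by
    fin_cases i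
    · exact (D0_eq f).trans (by simp [h])
    · exact (D1_eq f).trans (by simp [h])
    · exact (D2_eq f).trans (by simp [h])
    · exact (D3_eq f).trans (by simp [h])
  I_star := sphI_star
  I_left01 := sphI_left01
  I_left10 := sphI_left10
  I_left_diag f := by rw [zc_left_diag, map_add, sphI_cI_mul, sphI_left3]; simp
  I_right10 := sphI_right10
  I_right01 := sphI_right01
  I_right_diag f := by rw [zc_right_diag, map_add, sphI_cI_mul, sphI_right3]; simp
  I_det := sphI_det
  I_pos := sphI_pos

end QuatConf
end
noncomputable section
namespace QuatConf

/-! ### The matrix realization as an algebra homomorphism -/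

theorem toMat_eq_sum (X : ℍ[ℝ]) (a b : Fin 2) :
    toMat X a b = !![(coord 0 X : ℂ) - Complex.I * coord 3 X, -(Complex.I * coord 1 X) - coord 2 X;
      -(Complex.I * coord 1 X) + coord 2 X, (coord 0 X : ℂ) + Complex.I * coord 3 X] a b := by
  fin_cases a <;> fin_cases b <;> simp [toMat, coord]

/-- The matrix realization as an algebra homomorphism. -/
def toMatHom : ℍ[ℝ] →ₐ[ℝ] Matrix (Fin 2) (Fin 2) ℂ where
  toFun := toMat
  map_one' := by ext a b; fin_cases a <;> fin_cases b <;> simp [toMat]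
  map_zero' := by ext a b; fin_cases a <;> fin_cases b <;> simp [toMat]
  map_add' X Y := by
    ext a b; fin_cases a <;> fin_cases b <;> simp [toMat] <;> ring
  map_mul' X Y := by
    have h := Complex.I_sq
    ext a b
    fin_cases a <;> fin_cases b <;> simp [toMat, Matrix.mul_apply] <;> grind
  commutes' r := by
    ext a b
    fin_cases a <;> fin_cases b <;> simp [toMat, Algebra.algebraMap_eq_smul_one]

theorem toMatHom_apply (X : ℍ[ℝ]) : toMatHom X = toMat X := rfl

theorem trace_toMat (X : ℍ[ℝ]) : (toMat X).trace = ((2 * X.re : ℝ) : ℂ) := by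
  simp [toMat, Matrix.trace_fin_two]; ring

/-- The matrix entries as continuous linear forms. -/
def toMatL (a b : Fin 2) : ℍ[ℝ] →L[ℝ] ℂ :=
  LinearMap.toContinuousLinearMap
    { toFun := fun X => toMat X a b
      map_add' := fun X Y => congrFun (congrFun (map_add toMatHom X Y) a) b
      map_smul' := fun c X => congrFun (congrFun (map_smul toMatHom c X) a) b }

theorem toMatL_apply (a b : Fin 2) (X : ℍ[ℝ]) : toMatL a b X = toMat X a b := rfl

/-! ### Evaluation of the operators at a point -/

/-- The value at a point. -/
def ev (X : ℍ[ℝ]ˣ) : smooth →+* ℂ := (Pi.evalRingHom (fun _ : ℍ[ℝ]ˣ => ℂ) X).comp smooth.subtype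

theorem ev_apply (X : ℍ[ℝ]ˣ) (f : smooth) : ev X f = f.1 X := rfl

theorem map_ev_K (X : ℍ[ℝ]ˣ) (M : Matrix (Fin 2) (Fin 2) ℂ) :
    (ev X).mapMatrix (ConformalCalculus.K M) = M := rfl

theorem map_ev_z (X : ℍ[ℝ]ˣ) : (ev X).mapMatrix calculus.z = toMat X := by
  ext a b
  rw [toMat_eq_sum]
  fin_cases a <;> fin_cases b <;> rfl

/-- The link between the abstract derivations and directional derivatives: only the value of the
coefficient matrix at X matters. -/
theorem fderiv_eq_der (f : smooth) (X : ℍ[ℝ]ˣ) {q : ℍ[ℝ]} {v : Matrix (Fin 2) (Fin 2) smooth}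
    (hv : (ev X).mapMatrix v = toMat q) :
    (calculus.der v f).1 X = fderiv ℝ (ext f.1) (X : ℍ[ℝ]) q := by
  have h (a b : Fin 2) : ev X (v a b) = toMat q a b := congrFun (congrFun hv a) b
  have hI : ev X cI = Complex.I := rfl
  have hI2 := Complex.I_sq
  rw [fderiv_eq_sum, Fin.sum_univ_four, ← ev_apply, ← ev_apply, ← ev_apply, ← ev_apply, ← ev_apply,
    ConformalCalculus.der_apply, D0_eq, D1_eq, D2_eq, D3_eq]
  simp only [map_add, map_mul, map_sub, map_neg, hI, h, toMat_eq_sum]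
  show _ * ev X (Pc 0 0 f) + _ * ev X (Pc 0 1 f) + _ * ev X (Pc 1 0 f) + _ * ev X (Pc 1 1 f) = _
  simp
  ring

variable (x : glH) (X : ℍ[ℝ]ˣ)

theorem map_ev_vec : (ev X).mapMatrix (calculus.vec (ι x)) =
    toMat ((X : ℍ[ℝ]) * x 1 0 * X + X * x 1 1 - x 0 0 * X - x 0 1) := by
  simp only [← toMatHom_apply, map_sub, map_add, map_mul, ConformalCalculus.vec, map_ev_K, map_ev_z]
  rfl

theorem map_ev_mult : (ev X).mapMatrix (calculus.mult (ι x)) = toMat (x 1 0 * X + x 1 1) := by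
  simp only [← toMatHom_apply, map_add, map_mul, ConformalCalculus.mult, map_ev_K, map_ev_z]
  rfl

theorem ev_mult (a b : Fin 2) :
    (calculus.mult (ι x) a b).1 X = toMat (x 1 0 * X + x 1 1) a b :=
  congrFun (congrFun (map_ev_mult x X) a) b

/-- `theta` is chosen so that the vector field it gives in the transposed coordinates is the
transpose of the original one. -/
theorem map_ev_vec_transpose : (ev X).mapMatrix (calculus.transpose.vec (theta (ι x)))ᵀ =
    toMat ((X : ℍ[ℝ]) * x 1 0 * X + X * x 1 1 - x 0 0 * X - x 0 1) := by
  rw [← map_ev_vec]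
  congr 1
  have e1 : (theta (ι x)).toBlocks₁₁ = -(ι x).toBlocks₂₂ᵀ := rfl
  have e2 : (theta (ι x)).toBlocks₁₂ = (ι x).toBlocks₁₂ᵀ := rfl
  have e3 : (theta (ι x)).toBlocks₂₁ = (ι x).toBlocks₂₁ᵀ := rfl
  have e4 : (theta (ι x)).toBlocks₂₂ = -(ι x).toBlocks₁₁ᵀ := rfl
  have hK (M : Matrix (Fin 2) (Fin 2) ℂ) :
      (ConformalCalculus.K Mᵀ : Matrix (Fin 2) (Fin 2) smooth) = (ConformalCalculus.K M)ᵀ := rfl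
  have hz : calculus.transpose.z = calculus.zᵀ := rfl
  rw [ConformalCalculus.vec, ConformalCalculus.vec, e1, e2, e3, e4, hz]
  have key (Z A B C D : Matrix (Fin 2) (Fin 2) smooth) :
      (Zᵀ * Cᵀ * Zᵀ + Zᵀ * (-Aᵀ) - (-Dᵀ) * Zᵀ - Bᵀ)ᵀ = Z * C * Z + Z * D - A * Z - B := by
    ext a b
    simp [Matrix.mul_apply, Fin.sum_univ_two]
    ring
  rw [map_neg, map_neg, hK, hK, hK, hK]
  exact key _ _ _ _ _

theorem ev_mult_transpose (a b : Fin 2) :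
    (calculus.transpose.mult (theta (ι x)) a b).1 X = toMat ((X : ℍ[ℝ]) * x 1 0 - x 0 0) b a := by
  have e3 : (theta (ι x)).toBlocks₂₁ = (ι x).toBlocks₂₁ᵀ := rfl
  have e4 : (theta (ι x)).toBlocks₂₂ = -(ι x).toBlocks₁₁ᵀ := rfl
  have hK (M : Matrix (Fin 2) (Fin 2) ℂ) :
      (ConformalCalculus.K Mᵀ : Matrix (Fin 2) (Fin 2) smooth) = (ConformalCalculus.K M)ᵀ := rfl
  have hz : calculus.transpose.z = calculus.zᵀ := rfl
  have h : calculus.transpose.mult (theta (ι x)) = (calculus.z * ConformalCalculus.K (ι x).toBlocks₂₁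
      - ConformalCalculus.K (ι x).toBlocks₁₁)ᵀ := by
    rw [ConformalCalculus.mult, e3, e4, hz]
    simp only [map_neg, hK, Matrix.transpose_sub, Matrix.transpose_mul]
    noncomm_ring
  have h2 : (ev X).mapMatrix (calculus.z * ConformalCalculus.K (ι x).toBlocks₂₁
      - ConformalCalculus.K (ι x).toBlocks₁₁) = toMat ((X : ℍ[ℝ]) * x 1 0 - x 0 0) := by
    simp only [← toMatHom_apply, map_sub, map_mul, map_ev_K, map_ev_z]
    rfl
  rw [h]
  exact congrFun (congrFun h2 b) a

theorem der_transpose (v : Matrix (Fin 2) (Fin 2) smooth) (f : smooth) :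
    calculus.transpose.der v f = calculus.der vᵀ f := by
  simp only [ConformalCalculus.der_apply, Matrix.transpose_apply]
  show _ * calculus.P 0 0 f + _ * calculus.P 1 0 f + _ * calculus.P 0 1 f + _ * calculus.P 1 1 f = _
  ring

/-! ### Derivatives of curves -/

variable {w Y : ℝ → ℍ[ℝ]} {w' Y' : ℍ[ℝ]}

theorem HasDerivAt.quaternion_normSq_inv (hw : HasDerivAt w w' 0) (h0 : w 0 = 1) :
    HasDerivAt (fun t => (Quaternion.normSq (w t))⁻¹) (-(2 * w'.re)) 0 := by
  have h1 : HasDerivAt (fun t => ∑ i, coordL i (w t) ^ 2)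
      (∑ i, 2 * coordL i (w 0) * coordL i w') 0 := by
    refine HasDerivAt.fun_sum fun i _ => ?_
    have := ((coordL i).hasFDerivAt.comp_hasDerivAt (0 : ℝ) hw).fun_pow 2
    rw [show 2 * coordL i (w 0) * coordL i w' =
      ((2 : ℕ) : ℝ) * coordL i (w 0) ^ (2 - 1) * coordL i w' by simp]
    exact this
  have h2 : HasDerivAt (fun t => Quaternion.normSq (w t)) (2 * w'.re) 0 := by
    simp only [normSq_eq_sum]
    convert! h1 using 1
    rw [h0, Fin.sum_univ_four]
    simp [coordL_apply, coord]
  convert! h2.inv (by rw [h0]; simp) using 1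
  rw [h0]; simp

theorem HasDerivAt.quaternion_inv (hw : HasDerivAt w w' 0) (h0 : w 0 = 1) :
    HasDerivAt (fun t => (w t)⁻¹) (-w') 0 := by
  have h := (hasFDerivAt_inv' (𝕜 := ℝ) (show w 0 ≠ 0 by rw [h0]; exact one_ne_zero)).comp_hasDerivAt
    (0 : ℝ) hw
  rw [h0] at h
  simp only [inv_one, neg_apply, ContinuousLinearMap.mulLeftRight_apply,
    one_mul, mul_one] at h
  exact h

theorem hasDerivAt_ext_comp (f : smooth) (hY : HasDerivAt Y Y' 0) (h0 : Y 0 = X) :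
    HasDerivAt (fun t => ext f.1 (Y t)) (fderiv ℝ (ext f.1) (X : ℍ[ℝ]) Y') 0 := by
  have h := (smooth.differentiableAt_coe f X).hasFDerivAt
  rw [← h0] at h ⊢
  exact h.comp_hasDerivAt (0 : ℝ) hY

theorem hasDerivAt_normSq_inv_smul (f : smooth) (hw : HasDerivAt w w' 0) (hw0 : w 0 = 1)
    (hY : HasDerivAt Y Y' 0) (hY0 : Y 0 = X) :
    HasDerivAt (fun t => ((Quaternion.normSq (w t))⁻¹ : ℝ) • ext f.1 (Y t))
      (fderiv ℝ (ext f.1) (X : ℍ[ℝ]) Y' - (toMat w').trace * f.1 X) 0 := by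
  have h := (HasDerivAt.quaternion_normSq_inv hw hw0).smul (hasDerivAt_ext_comp X f hY hY0)
  convert! h using 1
  rw [hw0, hY0, ext_coe, trace_toMat]
  simp
  ring

theorem hasDerivAt_entry (f : smooth) (a b : Fin 2) (hw : HasDerivAt w w' 0) (hw0 : w 0 = 1)
    (hY : HasDerivAt Y Y' 0) (hY0 : Y 0 = X) :
    HasDerivAt (fun t => ((Quaternion.normSq (w t))⁻¹ : ℝ) • (toMat (w t)⁻¹ a b * ext f.1 (Y t)))
      (toMat 1 a b * (fderiv ℝ (ext f.1) (X : ℍ[ℝ]) Y' - (toMat w').trace * f.1 X)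
        - toMat w' a b * f.1 X) 0 := by
  have h1 := (toMatL a b).hasFDerivAt.comp_hasDerivAt (0 : ℝ) (HasDerivAt.quaternion_inv hw hw0)
  have h := h1.mul (hasDerivAt_normSq_inv_smul X f hw hw0 hY hY0)
  simp only [mul_smul_comm] at h
  convert! h using 1
  · funext t
    exact (mul_smul_comm _ _ _).symm
  · simp only [Function.comp_apply, toMatL_apply, hw0, hY0, ext_coe, map_neg]
    simp
    ring

/-- Pairs of smooth functions as spinor-valued functions. -/
def inclV : (Fin 2 → smooth) →ₗ[ℂ] (ℍ[ℝ]ˣ → Spinor) where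
  toFun f X j := (f j).1 X
  map_add' _ _ := rfl
  map_smul' _ _ := rfl

theorem inclV_injective : Function.Injective inclV := fun _ _ h => funext fun j =>
  Subtype.ext <| funext fun X => congrFun (congrFun h X) j

theorem ext_inclV (f : Fin 2 → smooth) (Y : ℍ[ℝ]) (j : Fin 2) : ext (inclV f) Y j = ext (f j).1 Y :=
  (ext_comp (fun s : Spinor => s j) rfl (inclV f) Y).symm

theorem hasDerivAt_lact (f : Fin 2 → smooth) (hw : HasDerivAt w w' 0) (hw0 : w 0 = 1)
    (hY : HasDerivAt Y Y' 0) (hY0 : Y 0 = X) :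
    HasDerivAt (fun t => ((Quaternion.normSq (w t))⁻¹ : ℝ) • lact (w t)⁻¹ (ext (inclV f) (Y t)))
      (fun j => (fderiv ℝ (ext (f j).1) (X : ℍ[ℝ]) Y' - (toMat w').trace * (f j).1 X)
        - (toMat w' j 0 * (f 0).1 X + toMat w' j 1 * (f 1).1 X)) 0 := by
  refine hasDerivAt_pi.2 fun j => ?_
  have h := (hasDerivAt_entry X (f 0) j 0 hw hw0 hY hY0).add
    (hasDerivAt_entry X (f 1) j 1 hw hw0 hY hY0)
  convert! h using 1
  · funext t
    simp only [Pi.smul_apply, lact, Matrix.mulVec, dotProduct, Fin.sum_univ_two, ext_inclV,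
      smul_add, Pi.add_apply]
  · rw [← toMatHom_apply 1, map_one]
    have hj : j = 0 ∨ j = 1 := by fin_cases j <;> simp
    rcases hj with rfl | rfl <;> simp <;> ring

theorem hasDerivAt_ract (f : Fin 2 → smooth) (hw : HasDerivAt w w' 0) (hw0 : w 0 = 1)
    (hY : HasDerivAt Y Y' 0) (hY0 : Y 0 = X) :
    HasDerivAt (fun t => ((Quaternion.normSq (w t))⁻¹ : ℝ) • ract (ext (inclV f) (Y t)) (w t)⁻¹)
      (fun j => (fderiv ℝ (ext (f j).1) (X : ℍ[ℝ]) Y' - (toMat w').trace * (f j).1 X)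
        - (toMat w' 0 j * (f 0).1 X + toMat w' 1 j * (f 1).1 X)) 0 := by
  refine hasDerivAt_pi.2 fun j => ?_
  have h := (hasDerivAt_entry X (f 0) 0 j hw hw0 hY hY0).add
    (hasDerivAt_entry X (f 1) 1 j hw hw0 hY hY0)
  convert! h using 1
  · funext t
    simp only [Pi.smul_apply, ract, Matrix.vecMul, dotProduct, Fin.sum_univ_two, ext_inclV,
      smul_add, Pi.add_apply, mul_comm]
  · rw [← toMatHom_apply 1, map_one]
    have hj : j = 0 ∨ j = 1 := by fin_cases j <;> simp
    rcases hj with rfl | rfl <;> simp <;> ring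

/-! ### Derivatives of the group actions -/

-- The norm on matrices is auxiliary: the conclusion concerns single entries only.
attribute [local instance] Matrix.linftyOpNormedAddCommGroup Matrix.linftyOpNormedSpace
  Matrix.linftyOpNormedRing Matrix.linftyOpNormedAlgebra in
theorem hasDerivAt_exp_apply (x : glH) (i j : Fin 2) :
    HasDerivAt (fun t : ℝ => (NormedSpace.exp (t • x)) i j) (x i j) 0 := by
  have h := hasDerivAt_exp_smul_const (𝕂 := ℝ) x (0 : ℝ)
  rw [zero_smul, NormedSpace.exp_zero, one_mul] at h
  exact (LinearMap.toContinuousLinearMap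
    (Matrix.entryLinearMap ℝ ℍ[ℝ] i j)).hasFDerivAt.comp_hasDerivAt (0 : ℝ) h

theorem hasDerivAt_expGL (i j : Fin 2) :
    HasDerivAt (fun t : ℝ => ((expGL (t • x) : GLH) : glH) i j) (x i j) 0 :=
  hasDerivAt_exp_apply x i j

theorem hasDerivAt_expGL_inv (i j : Fin 2) :
    HasDerivAt (fun t : ℝ => (((expGL (t • x))⁻¹ : GLH) : glH) i j) (-x i j) 0 := by
  have h := hasDerivAt_exp_apply (-x) i j
  simp only [smul_neg] at h
  exact h

theorem expGL_zero : expGL (0 : glH) = 1 := Units.ext NormedSpace.exp_zero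

theorem hasDerivAt_denom_l : HasDerivAt
    (fun t : ℝ => (((expGL (t • x))⁻¹ : GLH) : glH) 1 0 * (X : ℍ[ℝ]) +
      (((expGL (t • x))⁻¹ : GLH) : glH) 1 1) (-(x 1 0 * X + x 1 1)) 0 := by
  have h := ((hasDerivAt_expGL_inv x 1 0).mul_const (X : ℍ[ℝ])).add (hasDerivAt_expGL_inv x 1 1)
  rw [show -(x 1 0 * (X : ℍ[ℝ]) + x 1 1) = -x 1 0 * X + -x 1 1 by noncomm_ring]
  exact h

theorem hasDerivAt_point_l : HasDerivAt
    (fun t : ℝ => ((((expGL (t • x))⁻¹ : GLH) : glH) 0 0 * (X : ℍ[ℝ]) +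
      (((expGL (t • x))⁻¹ : GLH) : glH) 0 1) * ((((expGL (t • x))⁻¹ : GLH) : glH) 1 0 * (X : ℍ[ℝ]) +
      (((expGL (t • x))⁻¹ : GLH) : glH) 1 1)⁻¹)
      ((X : ℍ[ℝ]) * x 1 0 * X + X * x 1 1 - x 0 0 * X - x 0 1) 0 := by
  have h := (((hasDerivAt_expGL_inv x 0 0).mul_const (X : ℍ[ℝ])).add
    (hasDerivAt_expGL_inv x 0 1)).mul (HasDerivAt.quaternion_inv (hasDerivAt_denom_l x X)
      (by simp [expGL_zero]))
  convert! h using 1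
  simp [expGL_zero]
  noncomm_ring

theorem hasDerivAt_denom_r : HasDerivAt
    (fun t : ℝ => ((expGL (t • x) : GLH) : glH) 0 0 - (X : ℍ[ℝ]) * ((expGL (t • x) : GLH) : glH) 1 0)
      (x 0 0 - X * x 1 0) 0 :=
  (hasDerivAt_expGL x 0 0).sub ((hasDerivAt_expGL x 1 0).const_mul (X : ℍ[ℝ]))

theorem hasDerivAt_point_r : HasDerivAt
    (fun t : ℝ => (((expGL (t • x) : GLH) : glH) 0 0 -
      (X : ℍ[ℝ]) * ((expGL (t • x) : GLH) : glH) 1 0)⁻¹ *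
      (-((expGL (t • x) : GLH) : glH) 0 1 + (X : ℍ[ℝ]) * ((expGL (t • x) : GLH) : glH) 1 1))
      ((X : ℍ[ℝ]) * x 1 0 * X + X * x 1 1 - x 0 0 * X - x 0 1) 0 := by
  have h := (HasDerivAt.quaternion_inv (hasDerivAt_denom_r x X) (by simp [expGL_zero])).mul
    ((hasDerivAt_expGL x 0 1).neg.add ((hasDerivAt_expGL x 1 1).const_mul (X : ℍ[ℝ])))
  convert! h using 1
  simp [expGL_zero]
  noncomm_ring

theorem trace_ι : (ι x).trace = (toMat (x 0 0)).trace + (toMat (x 1 1)).trace :=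
  by simp [ι, Matrix.trace]

theorem trace_toMat_mul_comm (p q : ℍ[ℝ]) : (toMat (p * q)).trace = (toMat (q * p)).trace := by
  rw [← toMatHom_apply, ← toMatHom_apply, map_mul, map_mul, Matrix.trace_mul_comm]

theorem trace_toMat_add (p q : ℍ[ℝ]) : (toMat (p + q)).trace = (toMat p).trace + (toMat q).trace := by
  rw [← toMatHom_apply, map_add, Matrix.trace_add]; rfl

theorem toMat_neg (p : ℍ[ℝ]) : toMat (-p) = -toMat p := map_neg toMatHom p

theorem repH_coe (f : smooth) : (calculus.repH (ι x) f).1 X =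
    fderiv ℝ (ext f.1) (X : ℍ[ℝ]) ((X : ℍ[ℝ]) * x 1 0 * X + X * x 1 1 - x 0 0 * X - x 0 1)
      + (toMat (x 1 0 * X + x 1 1)).trace * f.1 X := by
  rw [← fderiv_eq_der f X (map_ev_vec x X), Matrix.trace_fin_two, ← ev_mult, ← ev_mult]
  rfl

theorem hasDerivAt_actH_l (f : smooth) :
    HasDerivAt (fun t : ℝ => actH_l (expGL (t • x)) (ext f.1) (X : ℍ[ℝ]))
      ((calculus.repH (ι x) f).1 X) 0 := by
  have h := hasDerivAt_normSq_inv_smul X f (hasDerivAt_denom_l x X) (by simp [expGL_zero])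
    (hasDerivAt_point_l x X) (by simp [expGL_zero])
  rw [toMat_neg, Matrix.trace_neg, neg_mul, sub_neg_eq_add, ← repH_coe] at h
  exact h

/-- Both actions induce the same vector field. The multipliers differ by the trace: tr(X C - A) =
tr(C X + D) - tr x. -/
theorem hasDerivAt_actH_r (f : smooth) :
    HasDerivAt (fun t : ℝ => actH_r (expGL (t • x)) (ext f.1) (X : ℍ[ℝ]))
      ((twist calculus.repH (ι x) f).1 X) 0 := by
  have h := hasDerivAt_normSq_inv_smul X f (hasDerivAt_denom_r x X) (by simp [expGL_zero])
    (hasDerivAt_point_r x X) (by simp [expGL_zero])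
  convert! h using 1
  show (calculus.repH (ι x) f).1 X - (ι x).trace * f.1 X = _
  rw [repH_coe, trace_ι, trace_toMat_add, sub_eq_add_neg (x 0 0), trace_toMat_add, toMat_neg,
    Matrix.trace_neg, trace_toMat_mul_comm (x 1 0)]
  ring

theorem inclV_repV (f : Fin 2 → smooth) : inclV (calculus.repV (ι x) f) X = fun j =>
    (fderiv ℝ (ext (f j).1) (X : ℍ[ℝ]) ((X : ℍ[ℝ]) * x 1 0 * X + X * x 1 1 - x 0 0 * X - x 0 1)
      - (toMat (-(x 1 0 * X + x 1 1))).trace * (f j).1 X)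
      - (toMat (-(x 1 0 * X + x 1 1)) j 0 * (f 0).1 X
        + toMat (-(x 1 0 * X + x 1 1)) j 1 * (f 1).1 X) := by
  funext j
  have e : inclV (calculus.repV (ι x) f) X j = (calculus.repH (ι x) (f j)).1 X
      + ((calculus.mult (ι x) j 0).1 X * (f 0).1 X
        + (calculus.mult (ι x) j 1).1 X * (f 1).1 X) := rfl
  rw [e, repH_coe, ev_mult, ev_mult, toMat_neg, Matrix.trace_neg, Matrix.neg_apply,
    Matrix.neg_apply]
  ring

theorem inclV_transpose_repV (f : Fin 2 → smooth) :
    inclV (calculus.transpose.repV (theta (ι x)) f) X = fun j =>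
    (fderiv ℝ (ext (f j).1) (X : ℍ[ℝ]) ((X : ℍ[ℝ]) * x 1 0 * X + X * x 1 1 - x 0 0 * X - x 0 1)
      - (toMat (x 0 0 - X * x 1 0)).trace * (f j).1 X)
      - (toMat (x 0 0 - X * x 1 0) 0 j * (f 0).1 X
        + toMat (x 0 0 - X * x 1 0) 1 j * (f 1).1 X) := by
  funext j
  have e : inclV (calculus.transpose.repV (theta (ι x)) f) X j =
      (calculus.transpose.der (calculus.transpose.vec (theta (ι x))) (f j)).1 X
      + ((calculus.transpose.mult (theta (ι x)) 0 0).1 X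
        + (calculus.transpose.mult (theta (ι x)) 1 1).1 X) * (f j).1 X
      + ((calculus.transpose.mult (theta (ι x)) j 0).1 X * (f 0).1 X
        + (calculus.transpose.mult (theta (ι x)) j 1).1 X * (f 1).1 X) := rfl
  have e' : x 0 0 - (X : ℍ[ℝ]) * x 1 0 = -((X : ℍ[ℝ]) * x 1 0 - x 0 0) := (neg_sub _ _).symm
  rw [e, der_transpose, fderiv_eq_der (f j) X (map_ev_vec_transpose x X), ev_mult_transpose,
    ev_mult_transpose, ev_mult_transpose, ev_mult_transpose, e', toMat_neg, Matrix.trace_neg,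
    Matrix.trace_fin_two, Matrix.neg_apply, Matrix.neg_apply]
  ring

theorem hasDerivAt_actV (f : Fin 2 → smooth) :
    HasDerivAt (fun t : ℝ => actV (expGL (t • x)) (ext (inclV f)) (X : ℍ[ℝ]))
      (inclV (calculus.repV (ι x) f) X) 0 := by
  rw [inclV_repV]
  exact hasDerivAt_lact X f (hasDerivAt_denom_l x X) (by simp [expGL_zero])
    (hasDerivAt_point_l x X) (by simp [expGL_zero])

theorem hasDerivAt_actV' (f : Fin 2 → smooth) :
    HasDerivAt (fun t : ℝ => actV' (expGL (t • x)) (ext (inclV f)) (X : ℍ[ℝ]))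
      (inclV (calculus.transpose.repV (theta (ι x)) f) X) 0 := by
  rw [inclV_transpose_repV]
  exact hasDerivAt_ract X f (hasDerivAt_denom_r x X) (by simp [expGL_zero])
    (hasDerivAt_point_r x X) (by simp [expGL_zero])

end QuatConf
end
noncomputable section
namespace QuatConf

/-! ### Irreducible unitary submodules and their transport to spaces of functions -/

/-- With J = diag(1, 1, -1, -1), the adjoint of x is -J x J, so the trace is purely imaginary. This
keeps the twisted action skew. -/
theorem star_trace_of_mem_u22 {x : gl4} (hx : x ∈ u22) : star x.trace = -x.trace := by
  let J : gl4 := Matrix.fromBlocks 1 0 0 (-1)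
  have hJ : J * J = 1 := by
    simp [J, Matrix.fromBlocks_multiply]
  have h : xᴴ * J = -(J * x) := eq_neg_of_add_eq_zero_left hx
  calc star x.trace = xᴴ.trace := (Matrix.trace_conjTranspose x).symm
    _ = (xᴴ * J * J).trace := by rw [mul_assoc, hJ, mul_one]
    _ = -x.trace := by
      rw [h, neg_mul, Matrix.trace_neg, Matrix.trace_mul_comm, ← mul_assoc, hJ, one_mul]

theorem theta_mem_u22 {x : gl4} (hx : x ∈ u22) : theta x ∈ u22 := by
  have h (i j : Fin 2 ⊕ Fin 2) := congrFun (congrFun (hx : _ = (0 : gl4)) i) j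
  show _ = (0 : gl4)
  ext (a | a) (b | b)
  · have := h (.inr b) (.inr a)
    fin_cases a <;> fin_cases b <;>
      simpa [theta, Matrix.mul_apply, Matrix.fromBlocks, Matrix.toBlocks₁₁, Matrix.toBlocks₁₂,
        Matrix.toBlocks₂₁, Matrix.toBlocks₂₂] using this
  · have := h (.inl b) (.inr a)
    fin_cases a <;> fin_cases b <;>
      simpa [theta, Matrix.mul_apply, Matrix.fromBlocks, Matrix.toBlocks₁₁, Matrix.toBlocks₁₂,
        Matrix.toBlocks₂₁, Matrix.toBlocks₂₂] using this
  · have := h (.inr b) (.inl a)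
    fin_cases a <;> fin_cases b <;>
      simpa [theta, Matrix.mul_apply, Matrix.fromBlocks, Matrix.toBlocks₁₁, Matrix.toBlocks₁₂,
        Matrix.toBlocks₂₁, Matrix.toBlocks₂₂] using this
  · have := h (.inl b) (.inl a)
    fin_cases a <;> fin_cases b <;>
      simpa [theta, Matrix.mul_apply, Matrix.fromBlocks, Matrix.toBlocks₁₁, Matrix.toBlocks₁₂,
        Matrix.toBlocks₂₁, Matrix.toBlocks₂₂] using this

theorem theta_mem_sl4 {x : gl4} (hx : x ∈ sl4) : theta x ∈ sl4 := by
  have h : x.trace = 0 := hx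
  show (theta x).trace = 0
  simp [theta, Matrix.trace, Matrix.toBlocks₁₁, Matrix.toBlocks₂₂] at h ⊢
  linear_combination -h

/-- The subspace `S` is stable and irreducible under `ρ`, also restricted to `𝔰𝔩(4, ℂ)`, and `B`
restricts to a Hermitian inner product on `S` for which `𝔲(2, 2)` acts by skew operators. -/
structure UnitaryIrrep {E : Type*} [AddCommGroup E] [Module ℂ E] (S : Submodule ℂ E)
    (ρ : gl4 →ₗ⁅ℂ⁆ Module.End ℂ E) (B : E → E → ℂ) : Prop where
  stable : ∀ x, ∀ f ∈ S, ρ x f ∈ S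
  ne_bot : S ≠ ⊥
  eq_bot_or_le : ∀ U ≤ S, (∀ x ∈ sl4, ∀ f ∈ U, ρ x f ∈ U) → U = ⊥ ∨ S ≤ U
  add_left : ∀ f g h, B (f + g) h = B f h + B g h
  smul_left : ∀ (c : ℂ) f h, B (c • f) h = c * B f h
  conj_symm : ∀ f ∈ S, ∀ h ∈ S, B h f = star (B f h)
  pos : ∀ f ∈ S, f ≠ 0 → 0 < (B f f).re
  skew : ∀ x ∈ u22, ∀ f ∈ S, ∀ h ∈ S, B (ρ x f) h + B f (ρ x h) = 0

namespace UnitaryIrrep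

variable {E : Type*} [AddCommGroup E] [Module ℂ E] {S : Submodule ℂ E}
  {ρ : gl4 →ₗ⁅ℂ⁆ Module.End ℂ E} {B : E → E → ℂ}

theorem twist (h : UnitaryIrrep S ρ B) : UnitaryIrrep S (QuatConf.twist ρ) B where
  stable x f hf := sub_mem (h.stable x f hf) (S.smul_mem _ hf)
  ne_bot := h.ne_bot
  eq_bot_or_le U hU hs := h.eq_bot_or_le U hU fun x hx f hf => by
    have h1 : x.trace = 0 := hx
    have := hs x hx f hf
    rwa [twist_apply, h1, zero_smul, sub_zero] at this
  add_left := h.add_left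
  smul_left := h.smul_left
  conj_symm := h.conj_symm
  pos := h.pos
  skew x hx f hf k hk := by
    have h1 := h.skew x hx f hf k hk
    have h2 := h.stable x f hf
    have h3 := h.stable x k hk
    have sub_left (f g k : E) (c : ℂ) : B (f - c • g) k = B f k - c * B g k := by
      rw [sub_eq_add_neg, ← neg_smul, h.add_left, h.smul_left]; ring
    -- Conjugate linearity in the second argument is not assumed; it follows from `conj_symm` on S.
    -- As tr x is imaginary, the two scalar terms cancel.
    have sub_right : B f (ρ x k - x.trace • k) = B f (ρ x k) + x.trace * B f k := by
      rw [h.conj_symm _ (sub_mem h3 (S.smul_mem _ hk)) _ hf, sub_left, star_sub, star_mul',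
        star_trace_of_mem_u22 hx, ← h.conj_symm _ h3 _ hf, ← h.conj_symm _ hk _ hf]
      ring
    rw [twist_apply, twist_apply, sub_left, sub_right]
    linear_combination h1

theorem comp_theta (h : UnitaryIrrep S ρ B) : UnitaryIrrep S (ρ.comp theta) B where
  stable x := h.stable (theta x)
  ne_bot := h.ne_bot
  eq_bot_or_le U hU hs := h.eq_bot_or_le U hU fun x hx f hf => by
    have := hs (theta x) (theta_mem_sl4 hx) f hf
    rwa [LieHom.comp_apply, theta_theta] at this
  add_left := h.add_left
  smul_left := h.smul_left
  conj_symm := h.conj_symm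
  pos := h.pos
  skew x hx := h.skew (theta x) (theta_mem_u22 hx)

end UnitaryIrrep

/-! ### Transport of representations and forms along an injective linear map -/

section Transport

variable {E T : Type*} [AddCommGroup E] [Module ℂ E] [AddCommGroup T] [Module ℂ T]
  {j : E →ₗ[ℂ] T} (hj : Function.Injective j) {S : Submodule ℂ E} {W : Submodule ℂ T}
  (hW : S.map j = W)

/-- The inverse of an injective linear map on the image of a subspace. -/
def lift : W →ₗ[ℂ] E :=
  S.subtype ∘ₗ ((S.equivMapOfInjective j hj).trans (LinearEquiv.ofEq _ _ hW)).symm.toLinearMap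

theorem lift_mem (w : W) : lift hj hW w ∈ S := Subtype.coe_prop _

theorem apply_lift (w : W) : j (lift hj hW w) = w :=
  congrArg Subtype.val
    (((S.equivMapOfInjective j hj).trans (LinearEquiv.ofEq _ _ hW)).apply_symm_apply w)

theorem lift_eq {w : W} {f : E} (h : j f = w) : lift hj hW w = f :=
  hj ((apply_lift hj hW w).trans h.symm)

theorem apply_mem_of_map_eq (hW : S.map j = W) {f : E} (hf : f ∈ S) : j f ∈ W := hW ▸ Submodule.mem_map_of_mem hf

/-- The representation on the image of a stable subspace. -/
def transport (ρ : gl4 →ₗ⁅ℂ⁆ Module.End ℂ E) (hS : ∀ x, ∀ f ∈ S, ρ x f ∈ S) :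
    gl4 →ₗ⁅ℂ⁆ Module.End ℂ W where
  toFun x := (j ∘ₗ ρ x ∘ₗ lift hj hW).codRestrict W
    fun w => apply_mem_of_map_eq hW (hS x _ (lift_mem hj hW w))
  map_add' x y := by
    ext w
    simp
  map_smul' c x := by
    ext w
    simp
  map_lie' {x y} := by
    have h (x : gl4) (w : W) (hw : j (ρ x (lift hj hW w)) ∈ W) :
        lift hj hW ⟨j (ρ x (lift hj hW w)), hw⟩ = ρ x (lift hj hW w) := lift_eq hj hW rfl
    have hρ : ρ ⁅x, y⁆ = ρ x * ρ y - ρ y * ρ x := LieHom.map_lie ρ x y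
    ext w
    simp only [hρ, Ring.lie_def (LinearMap.codRestrict W _ _), LinearMap.codRestrict_apply, LinearMap.comp_apply,
      LinearMap.sub_apply, Module.End.mul_apply, map_sub, Submodule.coe_sub]
    congr 2
    · exact congrArg (ρ x) (h y w _).symm
    · exact congrArg (ρ y) (h x w _).symm

variable {ρ : gl4 →ₗ⁅ℂ⁆ Module.End ℂ E} (hS : ∀ x, ∀ f ∈ S, ρ x f ∈ S)

theorem lift_transport (x : gl4) (w : W) :
    lift hj hW (transport hj hW ρ hS x w) = ρ x (lift hj hW w) := lift_eq hj hW rfl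

theorem isIrreducibleUnder_transport {B : E → E → ℂ} (h : UnitaryIrrep S ρ B) {s : Set gl4}
    (hs : s = Set.univ ∨ s = sl4) : IsIrreducibleUnder s (transport hj hW ρ h.stable) := by
  have hinj : Function.Injective (lift hj hW) := fun w w' e => Subtype.ext (by
    rw [← apply_lift hj hW w, e, apply_lift])
  refine ⟨?_, fun U hU => ?_⟩
  · obtain ⟨f, hf, hf0⟩ := (Submodule.ne_bot_iff _).1 h.ne_bot
    refine ⟨⟨⟨j f, apply_mem_of_map_eq hW hf⟩, 0, fun e => hf0 (hj ?_)⟩⟩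
    rw [map_zero]
    exact congrArg Subtype.val e
  -- Stability under either set includes stability under 𝔰𝔩(4, ℂ), so irreducibility there settles
  -- both cases.
  · have hsl : sl4 ⊆ s := by
      rcases hs with rfl | rfl
      exacts [Set.subset_univ _, subset_rfl]
    rcases h.eq_bot_or_le (U.map (lift hj hW))
      (by rintro _ ⟨w, _, rfl⟩; exact lift_mem hj hW w)
      (by
        rintro x hx _ ⟨w, hw, rfl⟩
        exact ⟨_, hU x (hsl hx) w hw, lift_transport hj hW h.stable x w⟩) with h0 | h1
    · left
      rw [eq_bot_iff]
      intro w hw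
      have : lift hj hW w ∈ U.map (lift hj hW) := Submodule.mem_map_of_mem hw
      rw [h0, Submodule.mem_bot] at this
      exact hinj (this.trans (map_zero _).symm)
    · right
      rw [eq_top_iff]
      rintro w -
      obtain ⟨w', hw', e⟩ := h1 (lift_mem hj hW w)
      rwa [← hinj e]

theorem isUnitaryStructure_transport {B : E → E → ℂ} (h : UnitaryIrrep S ρ B) {B' : T → T → ℂ}
    (hB : ∀ f g, B' (j f) (j g) = B f g) :
    IsUnitaryStructure (transport hj hW ρ h.stable) (fun f g : W => B' f g) := by
  have hB' (f g : W) : B' f g = B (lift hj hW f) (lift hj hW g) := by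
    rw [← hB, apply_lift, apply_lift]
  refine ⟨fun f g k => ?_, fun c f k => ?_, fun f k => ?_, fun f hf => ?_, fun x hx f k => ?_⟩
  · simp only [hB', map_add]; exact h.add_left _ _ _
  · simp only [hB', map_smul]; exact h.smul_left _ _ _
  · simp only [hB']; exact h.conj_symm _ (lift_mem hj hW f) _ (lift_mem hj hW k)
  · simp only [hB']
    refine h.pos _ (lift_mem hj hW f) fun e => hf (Subtype.ext ?_)
    rw [← apply_lift hj hW f, e, map_zero]; rfl
  · simp only [hB', lift_transport]
    exact h.skew x hx _ (lift_mem hj hW f) _ (lift_mem hj hW k)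

end Transport

theorem isDerivedRep_transport {E F : Type*} [AddCommGroup E] [Module ℂ E] [NormedAddCommGroup F]
    [NormedSpace ℂ F] {j : E →ₗ[ℂ] (ℍ[ℝ]ˣ → F)} (hj : Function.Injective j) {S : Submodule ℂ E}
    {W : Submodule ℂ (ℍ[ℝ]ˣ → F)} (hW : S.map j = W) {ρ : gl4 →ₗ⁅ℂ⁆ Module.End ℂ E}
    (hS : ∀ x, ∀ f ∈ S, ρ x f ∈ S) {act : GLH → (ℍ[ℝ] → F) → ℍ[ℝ] → F}
    (h : ∀ (x : glH) (X : ℍ[ℝ]ˣ) (f : E), HasDerivAt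
      (fun t : ℝ => act (expGL (t • x)) (ext (j f)) (X : ℍ[ℝ])) (j (ρ (ι x) f) X) 0) :
    IsDerivedRep act W (transport hj hW ρ hS) := fun x f X => by
  have := h x X (lift hj hW f)
  rw [apply_lift] at this
  exact this

/-! ### The spaces of harmonic and regular functions -/

theorem map_gspan {E T : Type*} [AddCommGroup E] [Module ℂ E] [AddCommGroup T] [Module ℂ T]
    (j : E →ₗ[ℂ] T) (W : ℤ → Submodule ℂ E) (V : ℤ → Set T) (h : ∀ n, j '' (W n) = V n)
    (s : Set ℤ) : (gspan W s).map j = Submodule.span ℂ {f | ∃ n, n ∈ s ∧ f ∈ V n} := by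
  rw [gspan, Submodule.map_span]
  congr 1
  ext f
  simp only [← h]
  constructor
  · rintro ⟨g, ⟨n, hn, hg⟩, rfl⟩
    exact ⟨n, hn, g, hg, rfl⟩
  · rintro ⟨n, hn, g, hg, rfl⟩
    exact ⟨g, ⟨n, hn, hg⟩, rfl⟩

theorem sum_D_D (f : smooth) : ∑ i, D i (D i f) =
    4 * (calculus.P 0 0 (calculus.P 1 1 f) - calculus.P 0 1 (calculus.P 1 0 f)) := by
  show _ = 4 * (Pc 0 0 (Pc 1 1 f) - Pc 0 1 (Pc 1 0 f))
  have h := two_mul_cHalf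
  have h' : (4 : smooth) * (cHalf * cHalf) = 1 := by linear_combination (2 * cHalf + 1) * h
  simp only [Pc00, Pc11, Pc01, Pc10, Derivation.leibniz, map_add, map_sub, D_cI, D_cHalf,
    smul_eq_mul, Fin.sum_univ_four]
  rw [D_comm 3 0, D_comm 2 1]
  linear_combination -(D 0 (D 0 f) + D 1 (D 1 f) + D 2 (D 2 f) + D 3 (D 3 f)) * h' +
    (4 * (cHalf * cHalf) * (D 1 (D 1 f) + D 3 (D 3 f))) * cI_sq

theorem laplacian_eq (f : smooth) (X : ℍ[ℝ]ˣ) : laplacian f.1 X = (∑ i, D i (D i f)).1 X := by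
  rw [laplacian, Fin.sum_univ_four, Fin.sum_univ_four]
  rfl

theorem eq_zero_iff_forall (f : smooth) : f = 0 ↔ ∀ X, f.1 X = 0 :=
  ⟨fun h X => by rw [h]; rfl, fun h => Subtype.ext (funext h)⟩

theorem incl_harmonic (n : ℤ) : incl '' (calculus.harmonic n) = harm n := by
  have h4 : (4 : smooth) = algebraMap ℂ smooth 4 := (map_ofNat _ 4).symm
  have key (f : smooth) : (∀ X, laplacian f.1 X = 0) ↔
      calculus.P 0 0 (calculus.P 1 1 f) = calculus.P 0 1 (calculus.P 1 0 f) := by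
    simp only [laplacian_eq]
    rw [← eq_zero_iff_forall, sum_D_D, ← sub_eq_zero (a := calculus.P 0 0 _), h4,
      ← Algebra.smul_def, smul_eq_zero_iff_right (by norm_num)]
  ext φ
  constructor
  · rintro ⟨f, hf, rfl⟩
    exact ⟨mem_laurent_iff.1 hf.1, (key f).2 hf.2⟩
  · rintro ⟨h1, h2⟩
    rw [← map_laurent] at h1
    obtain ⟨f, hf, rfl⟩ := h1
    exact ⟨f, ⟨hf, (key f).1 h2⟩, rfl⟩

theorem pd_inclV (i : Fin 4) (f : Fin 2 → smooth) (X : ℍ[ℝ]ˣ) :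
    pd i (inclV f) X = fun j => (D i (f j)).1 X := by
  have h : HasFDerivAt (ext (inclV f))
      (ContinuousLinearMap.pi fun j => fderiv ℝ (ext (f j).1) (X : ℍ[ℝ])) (X : ℍ[ℝ]) := by
    refine hasFDerivAt_pi.2 fun j => ?_
    have := (smooth.differentiableAt_coe (f j) X).hasFDerivAt
    have e : (fun Y => ext (inclV f) Y j) = ext (f j).1 := funext fun Y => ext_inclV f Y j
    rw [e]
    exact this
  rw [pd, h.fderiv]
  rfl

/-- In matrix coordinates the components of the Dirac-type operator are, up to the factor 2 and
order, the two equations defining `regular`. -/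
theorem sum_lact_pd (f : Fin 2 → smooth) (X : ℍ[ℝ]ˣ) : ∑ i, lact (e i) (pd i (inclV f) X) =
    ![(2 * (Pc 1 1 (f 0) - Pc 1 0 (f 1))).1 X, (2 * (Pc 0 0 (f 1) - Pc 0 1 (f 0))).1 X] := by
  have hI2 := Complex.I_sq
  have hI : ev X cI = Complex.I := rfl
  funext j
  simp only [Finset.sum_apply, lact, Matrix.mulVec, dotProduct, Fin.sum_univ_two,
    Fin.sum_univ_four, pd_inclV, toMat_eq_sum, coord_e]
  have hj : j = 0 ∨ j = 1 := by fin_cases j <;> simp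
  simp only [← ev_apply]
  rw [D0_eq, D1_eq, D2_eq, D3_eq, D0_eq, D1_eq, D2_eq, D3_eq]
  simp only [map_mul, map_add, map_sub, map_neg, hI, map_ofNat]
  rcases hj with rfl | rfl <;> simp <;> grind

theorem sum_ract_pd (f : Fin 2 → smooth) (X : ℍ[ℝ]ˣ) : ∑ i, ract (pd i (inclV f) X) (e i) =
    ![(2 * (Pc 1 1 (f 0) - Pc 0 1 (f 1))).1 X, (2 * (Pc 0 0 (f 1) - Pc 1 0 (f 0))).1 X] := by
  have hI2 := Complex.I_sq
  have hI : ev X cI = Complex.I := rfl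
  funext j
  simp only [Finset.sum_apply, ract, Matrix.vecMul, dotProduct, Fin.sum_univ_two,
    Fin.sum_univ_four, pd_inclV, toMat_eq_sum, coord_e]
  have hj : j = 0 ∨ j = 1 := by fin_cases j <;> simp
  simp only [← ev_apply]
  rw [D0_eq, D1_eq, D2_eq, D3_eq, D0_eq, D1_eq, D2_eq, D3_eq]
  simp only [map_mul, map_add, map_sub, map_neg, hI, map_ofNat]
  rcases hj with rfl | rfl <;> simp <;> grind

theorem forall_vec_eq_zero (f g : smooth) :
    (∀ X, ![(2 * f).1 X, (2 * g).1 X] = (0 : Spinor)) ↔ f = 0 ∧ g = 0 := by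
  rw [eq_zero_iff_forall, eq_zero_iff_forall, ← forall_and]
  refine forall_congr' fun X => ?_
  have h2 (f : smooth) : (2 * f).1 X = 2 * f.1 X := rfl
  rw [h2, h2, funext_iff, Fin.forall_fin_two]
  simp

theorem exists_inclV {n : ℤ} {f : ℍ[ℝ]ˣ → Spinor}
    (h : ∀ j, (fun X => f X j) ∈ laurentDeg n) :
    ∃ g : Fin 2 → smooth, (∀ j, g j ∈ laurent n) ∧ inclV g = f := by
  have h' (j : Fin 2) : ∃ g ∈ laurent n, incl g = fun X => f X j := by
    have := h j
    rwa [← map_laurent] at this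
  choose g hg hgf using h'
  exact ⟨g, hg, funext fun X => funext fun j => congrFun (hgf j) X⟩

theorem inclV_regular (n : ℤ) : inclV '' (calculus.regular n) = leftReg n := by
  have key (f : Fin 2 → smooth) : LeftRegular (inclV f) ↔
      ∀ c, calculus.P c 1 (f 0) = calculus.P c 0 (f 1) := by
    unfold LeftRegular
    simp only [sum_lact_pd]
    rw [forall_vec_eq_zero, Fin.forall_fin_two, sub_eq_zero, sub_eq_zero]
    exact ⟨fun h => ⟨h.2.symm, h.1⟩, fun h => ⟨h.2, h.1.symm⟩⟩
  ext φ
  constructor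
  · rintro ⟨f, hf, rfl⟩
    exact ⟨fun j => mem_laurent_iff.1 (hf.1 j), (key f).2 hf.2⟩
  · rintro ⟨h1, h2⟩
    obtain ⟨f, hf, rfl⟩ := exists_inclV h1
    exact ⟨f, ⟨hf, (key f).1 h2⟩, rfl⟩

theorem inclV_transpose_regular (n : ℤ) :
    inclV '' (calculus.transpose.regular n) = rightReg n := by
  have key (f : Fin 2 → smooth) : RightRegular (inclV f) ↔
      ∀ c, calculus.transpose.P c 1 (f 0) = calculus.transpose.P c 0 (f 1) := by
    unfold RightRegular
    simp only [sum_ract_pd]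
    rw [forall_vec_eq_zero, Fin.forall_fin_two, sub_eq_zero, sub_eq_zero]
    exact ⟨fun h => ⟨h.2.symm, h.1⟩, fun h => ⟨h.2, h.1.symm⟩⟩
  ext φ
  constructor
  · rintro ⟨f, hf, rfl⟩
    exact ⟨fun j => mem_laurent_iff.1 (hf.1 j), (key f).2 hf.2⟩
  · rintro ⟨h1, h2⟩
    obtain ⟨f, hf, rfl⟩ := exists_inclV h1
    exact ⟨f, ⟨hf, (key f).1 h2⟩, rfl⟩

theorem map_HPlus : (gspan calculus.harmonic {n | 0 ≤ n}).map incl = HPlus :=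
  map_gspan incl _ _ incl_harmonic _

theorem map_HMinus : (gspan calculus.harmonic {n | n < 0}).map incl = HMinus :=
  map_gspan incl _ _ incl_harmonic _

theorem map_VPlus : (gspan calculus.regular {n | 0 ≤ n}).map inclV = VPlus :=
  map_gspan inclV _ _ inclV_regular _

theorem map_VMinus : (gspan calculus.regular {n | n < 0}).map inclV = VMinus :=
  map_gspan inclV _ _ inclV_regular _

theorem map_VPlus' : (gspan calculus.transpose.regular {n | 0 ≤ n}).map inclV = VPlus' :=
  map_gspan inclV _ _ inclV_transpose_regular _

theorem map_VMinus' : (gspan calculus.transpose.regular {n | n < 0}).map inclV = VMinus' :=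
  map_gspan inclV _ _ inclV_transpose_regular _

end QuatConf
end
noncomputable section
namespace QuatConf

/-! ### The forms -/

section Forms

open MeasureTheory

theorem degT_eq (f : smooth) : degT f.1 = (calculus.degOp f).1 := by
  have e : calculus.degOp f = f + ∑ i, x i * D i f := by
    rw [← zc_mul_Pc]
    show f + (zc 0 0 * Pc 0 0 f + zc 0 1 * Pc 0 1 f + (zc 1 0 * Pc 1 0 f + zc 1 1 * Pc 1 1 f)) = _
    ring
  funext X
  rw [e, degT, Fin.sum_univ_four, Fin.sum_univ_four]
  rfl

theorem formH_eq (f g : smooth) : formH f.1 g.1 = calculus.formB f (star g) := by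
  rw [formH, degT_eq, sphereIntegral_one, ConformalCalculus.formB_def]
  refine integral_congr_ae (Filter.Eventually.of_forall fun ω => ?_)
  show _ = ext ((calculus.degOp f).1 * star g.1) (pt ω)
  rw [ext_mul, ext_star]
  rfl

theorem formH_eq_one_mul (f g : smooth) :
    formH (incl f) (incl g) = ((1 : ℝ) : ℂ) * calculus.formB f (star g) := by
  rw [Complex.ofReal_one, one_mul]
  exact formH_eq f g

theorem neg_formH_eq (f g : smooth) :
    -formH (incl f) (incl g) = ((-1 : ℝ) : ℂ) * calculus.formB f (star g) := by
  rw [Complex.ofReal_neg, Complex.ofReal_one, neg_one_mul]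
  exact congrArg _ (formH_eq f g)

theorem formV_eq (f g : Fin 2 → smooth) :
    formV (inclV f) (inclV g) = calculus.formW f (ConformalCalculus.sstar g) := by
  rw [formV, sphereIntegral_one, ConformalCalculus.formW_sstar, ← map_add]
  refine integral_congr_ae (Filter.Eventually.of_forall fun ω => ?_)
  show _ = ext ((f 0).1 * star (g 0).1 + (f 1).1 * star (g 1).1) (pt ω)
  rw [ext_add, ext_mul, ext_mul, ext_star, ext_star]
  simp only [ext_inclV, Fin.sum_univ_two, Pi.add_apply, Pi.mul_apply, mul_comm]

/-- The mean value functional of the sphere of radius `R`. -/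
def sphIR (R : ℝ) (hR : 0 < R) : smooth →ₗ[ℂ] ℂ where
  toFun f := ∫ ω, ext f.1 (R • pt ω) ∂surf
  map_add' f g := by
    have h (f : smooth) : Integrable (fun ω => ext f.1 (R • pt ω)) surf :=
      ((smooth.continuousOn f).comp_continuous (continuous_pt.const_smul R)
        fun ω => smul_ne_zero hR.ne' (pt_ne_zero ω)).integrable_of_hasCompactSupport
          (HasCompactSupport.of_compactSpace _)
    rw [← integral_add (h f) (h g)]
    exact integral_congr_ae (Filter.Eventually.of_forall fun ω => congrFun (ext_add f.1 g.1) _)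
  map_smul' c f := by
    rw [RingHom.id_apply, smul_eq_mul, ← integral_const_mul]
    exact integral_congr_ae (Filter.Eventually.of_forall fun ω => congrFun (ext_smul c f.1) _)

theorem sphIR_of_mem_laurent {R : ℝ} (hR : 0 < R) {n : ℤ} {f : smooth} (hf : f ∈ laurent n) :
    sphIR R hR f = (R : ℂ) ^ n * sphI f := by
  rw [sphI_apply, ← integral_const_mul]
  exact integral_congr_ae (Filter.Eventually.of_forall fun ω =>
    ext_smul_of_mem_laurent hf hR.ne' (pt_ne_zero ω))

theorem pairingH_eq_sphIR {R : ℝ} (hR : 0 < R) (f g : smooth) :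
    pairingH R f.1 g.1 = 1 / (2 * (Real.pi : ℂ) ^ 2) *
      ((R : ℂ) ^ 2 * sphIR R hR (calculus.degOp f * g)) := by
  have hR' : (R : ℂ) ≠ 0 := Complex.ofReal_ne_zero.2 hR.ne'
  have h : (∫ ω : S3, ext (degT f.1) (Quaternion.linearIsometryEquivTuple.symm
        (R • (ω : EuclideanSpace ℝ (Fin 4)))) * ext g.1 (Quaternion.linearIsometryEquivTuple.symm
        (R • (ω : EuclideanSpace ℝ (Fin 4)))) / (R : ℂ) ∂surf) =
      sphIR R hR (calculus.degOp f * g) / R := by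
    rw [integral_div]
    congr 1
    refine integral_congr_ae (Filter.Eventually.of_forall fun ω => ?_)
    show _ = ext ((calculus.degOp f).1 * g.1) (R • pt ω)
    have e : Quaternion.linearIsometryEquivTuple.symm (R • (ω : EuclideanSpace ℝ (Fin 4))) =
      R • pt ω := map_smul _ _ _
    simp only [ext_mul, degT_eq, e]
    rfl
  rw [pairingH, sphereIntegral]
  congr 1
  refine (congrArg ((R : ℂ) ^ 3 * ·) h).trans ?_
  field_simp

/-- On `𝓗⁺ × 𝓗⁻` the integral over the sphere of radius `R` does not depend on `R`. -/
theorem pairingH_eq {R : ℝ} (hR : 0 < R) {f g : smooth}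
    (hf : f ∈ gspan calculus.harmonic {n | 0 ≤ n}) (hg : g ∈ gspan calculus.harmonic {n | n < 0}) :
    pairingH R f.1 g.1 = 1 / (2 * (Real.pi : ℂ) ^ 2) * calculus.formB f g := by
  have hR' : (R : ℂ) ≠ 0 := Complex.ofReal_ne_zero.2 hR.ne'
  -- The difference of the forms for radius R and radius 1; the factor R² is the area factor R³
  -- divided by R. It is enough to check homogeneous arguments.
  let β : smooth →ₗ[ℂ] smooth →ₗ[ℂ] ℂ :=
    (R : ℂ) ^ 2 • (((LinearMap.mul ℂ smooth).compr₂ (sphIR R hR)).comp calculus.degOp)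
      - calculus.formB
  have hβ : β f g = 0 := by
    refine bilinear_span_eq_zero β ?_ hf hg
    rintro φ ⟨n, hn, hφ⟩ ψ ⟨m, hm, hψ⟩
    have hφψ : calculus.degOp φ * ψ = (n + 1 : ℂ) • (φ * ψ) := by
      rw [ConformalCalculus.degOp_apply hφ.1, mul_assoc, Algebra.smul_def]
      congr 1
      simp
    have h1 : β φ ψ = (n + 1 : ℂ) * (((R : ℂ) ^ 2 * (R : ℂ) ^ (n + m) - 1) * sphI (φ * ψ)) := by
      show (R : ℂ) ^ 2 * sphIR R hR (calculus.degOp φ * ψ) - calculus.formB φ ψ = _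
      rw [hφψ, map_smul, sphIR_of_mem_laurent hR (mul_mem_laurent hφ.1 hψ.1),
        ConformalCalculus.formB_apply hφ.1, smul_eq_mul]
      show _ - _ * sphI _ = _
      ring
    have h2 : ((n : ℂ) + m + 2) * sphI (φ * ψ) = 0 :=
      ConformalCalculus.I_mul_of_pairing hφ hψ hn hm
    rw [h1]
    -- For n + m = -2 the powers of R cancel; otherwise the integral itself is zero.
    by_cases hnm : n + m = -2
    · rw [hnm, zpow_neg, zpow_ofNat, mul_inv_cancel₀ (pow_ne_zero 2 hR')]
      ring
    · have h3 : (n : ℂ) + m + 2 ≠ 0 := by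
        intro h
        apply hnm
        have : ((n + m + 2 : ℤ) : ℂ) = 0 := by push_cast; exact h
        have := Int.cast_eq_zero.1 this
        omega
      rw [(mul_eq_zero.1 h2).resolve_left h3]
      ring
  have h : (R : ℂ) ^ 2 * sphIR R hR (calculus.degOp f * g) - calculus.formB f g = 0 := hβ
  rw [pairingH_eq_sphIR hR, sub_eq_zero.1 h]

end Forms

/-! ### The irreducible unitary representations -/

variable {A : Type*} [CommRing A] [StarRing A] [Algebra ℂ A] [StarModule ℂ A] [Nontrivial A]
  (𝒟 : ConformalCalculus A)

theorem unitaryIrrep_repH {s : Set ℤ} (hs : IsHalf s) {ε : ℝ}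
    (hε : ∀ n ∈ s, n ≠ -1 → 0 < ε * ((n : ℝ) + 1)) :
    UnitaryIrrep (gspan 𝒟.harmonic s) 𝒟.repH fun f h => ε * 𝒟.formB f (star h) where
  stable x _ hf := ConformalCalculus.repH_mem hs x hf
  ne_bot := ConformalCalculus.gspan_harmonic_ne_bot hs
  eq_bot_or_le := ConformalCalculus.eq_bot_or_le_repH hs
  add_left f g h := by simp [mul_add]
  smul_left c f h := by simp; ring
  conj_symm f hf h hh := by
    rw [ConformalCalculus.formB_conj_symm hs hf hh, star_mul']
    congr 1
    exact (Complex.conj_ofReal ε).symm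
  pos f hf h0 := by
    rw [Complex.re_ofReal_mul]
    exact ConformalCalculus.formB_pos hs hε hf h0
  skew x hx f hf h hh := by
    rw [ConformalCalculus.star_repH hx, ← mul_add,
      ConformalCalculus.formB_repH hs x hf (ConformalCalculus.star_mem_gspan hh), mul_zero]

theorem unitaryIrrep_repV {s : Set ℤ} (hs : IsHalf s) :
    UnitaryIrrep (gspan 𝒟.regular s) 𝒟.repV fun f h => 𝒟.formW f (ConformalCalculus.sstar h) where
  stable x _ hf := ConformalCalculus.repV_mem hs x hf
  ne_bot := ConformalCalculus.gspan_regular_ne_bot hs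
  eq_bot_or_le := ConformalCalculus.eq_bot_or_le_repV hs
  add_left f g h := by simp
  smul_left c f h := by simp
  conj_symm f _ h _ := ConformalCalculus.formW_conj_symm f h
  pos f hf h0 := ConformalCalculus.formW_pos hs hf h0
  skew x hx f hf h hh := by
    rw [ConformalCalculus.sstar_repV hx]
    exact ConformalCalculus.formW_repV hs x hf (ConformalCalculus.sstar_mem_gspan hh)

theorem isHalf_nonneg : IsHalf {n | 0 ≤ n} := Or.inl rfl

theorem isHalf_neg : IsHalf {n | n < 0} := Or.inr rfl

theorem unitaryIrrep_HPlus : UnitaryIrrep (gspan calculus.harmonic {n | 0 ≤ n}) calculus.repH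
    fun f h => ((1 : ℝ) : ℂ) * calculus.formB f (star h) :=
  unitaryIrrep_repH calculus isHalf_nonneg fun n hn _ => by
    have : (0 : ℝ) ≤ n := Int.cast_nonneg hn
    linarith

theorem unitaryIrrep_HMinus : UnitaryIrrep (gspan calculus.harmonic {n | n < 0}) calculus.repH
    fun f h => ((-1 : ℝ) : ℂ) * calculus.formB f (star h) :=
  unitaryIrrep_repH calculus isHalf_neg fun n hn h => by
    have hn : n < 0 := hn
    -- With degree -1 excluded, n + 1 is strictly negative.
    have : (n : ℝ) ≤ -2 := by exact_mod_cast (by omega : n ≤ -2)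
    linarith

theorem unitaryIrrep_V {s : Set ℤ} (hs : IsHalf s) :
    UnitaryIrrep (gspan calculus.regular s) calculus.repV
      fun f h => calculus.formW f (ConformalCalculus.sstar h) :=
  unitaryIrrep_repV calculus hs

theorem unitaryIrrep_V' {s : Set ℤ} (hs : IsHalf s) :
    UnitaryIrrep (gspan calculus.transpose.regular s) (calculus.transpose.repV.comp theta)
      fun f h => calculus.formW f (ConformalCalculus.sstar h) :=
  (unitaryIrrep_repV calculus.transpose hs).comp_theta

theorem pairingH_coe {R : ℝ} (hR : 0 < R) (f : HPlus) (g : HMinus) :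
    pairingH R f g = 1 / (2 * (Real.pi : ℂ) ^ 2) *
      calculus.formB (lift incl_injective map_HPlus f) (lift incl_injective map_HMinus g) := by
  rw [← pairingH_eq hR (lift_mem incl_injective map_HPlus f)
    (lift_mem incl_injective map_HMinus g)]
  congr 1
  · exact (apply_lift incl_injective map_HPlus f).symm
  · exact (apply_lift incl_injective map_HMinus g).symm

theorem isInvariantPairing_transport {R : ℝ} (hR : 0 < R) :
    IsInvariantPairing (transport incl_injective map_HPlus _ unitaryIrrep_HPlus.stable)
      (transport incl_injective map_HMinus _ unitaryIrrep_HMinus.twist.stable)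
      (fun φ₁ φ₂ => pairingH R φ₁ φ₂) := by
  have hc : 1 / (2 * (Real.pi : ℂ) ^ 2) ≠ 0 := by
    have : (Real.pi : ℂ) ≠ 0 := Complex.ofReal_ne_zero.2 Real.pi_ne_zero
    simp [this]
  have e := pairingH_coe hR
  refine ⟨fun f g k => ?_, fun c f k => ?_, fun f g k => ?_, fun c f k => ?_, fun f hf => ?_,
    fun g hg => ?_, fun x _ f k => ?_⟩
  · simp only [e, map_add, LinearMap.add_apply, mul_add]
  · simp only [e, map_smul, LinearMap.smul_apply, smul_eq_mul]; ring
  · simp only [e, map_add, mul_add]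
  · simp only [e, map_smul, smul_eq_mul]; ring
  · have h := ConformalCalculus.pairing_nondeg_left (lift_mem incl_injective map_HPlus f)
      fun k hk => by
        have := hf ⟨incl k, apply_mem_of_map_eq map_HMinus hk⟩
        rw [e] at this
        have h2 := (mul_eq_zero.1 this).resolve_left hc
        rwa [lift_eq incl_injective map_HMinus rfl] at h2
    refine Subtype.ext ?_
    rw [← apply_lift incl_injective map_HPlus f, h]
    rfl
  · have h := ConformalCalculus.pairing_nondeg_right (lift_mem incl_injective map_HMinus g)
      fun k hk => by
        have := hg ⟨incl k, apply_mem_of_map_eq map_HPlus hk⟩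
        rw [e] at this
        have h2 := (mul_eq_zero.1 this).resolve_left hc
        rwa [lift_eq incl_injective map_HPlus rfl] at h2
    refine Subtype.ext ?_
    rw [← apply_lift incl_injective map_HMinus g, h]
    rfl
  · simp only [e, lift_transport]
    rw [← mul_add, ConformalCalculus.pairing_repH x (lift_mem incl_injective map_HPlus f)
      (lift_mem incl_injective map_HMinus k), mul_zero]

/-! ### The complexification of `𝔤𝔩(2, ℍ)` -/

/-- The complex coordinates of a complex `2 × 2` matrix in the basis of the quaternions. -/
def cCoord (M : Matrix (Fin 2) (Fin 2) ℂ) : Fin 4 → ℂ :=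
  ![(M 0 0 + M 1 1) / 2, Complex.I * (M 0 1 + M 1 0) / 2, (M 1 0 - M 0 1) / 2,
    Complex.I * (M 0 0 - M 1 1) / 2]

/-- The quaternion with given coordinates. -/
def ofCoord (c : Fin 4 → ℝ) : ℍ[ℝ] := ⟨c 0, c 1, c 2, c 3⟩

/-- The matrices of the quaternion units form a complex basis of the 2 × 2 matrices; the coordinates
are split into real and imaginary parts. -/
theorem toMat_add_I_smul (M : Matrix (Fin 2) (Fin 2) ℂ) :
    toMat (ofCoord fun i => (cCoord M i).re) +
      Complex.I • toMat (ofCoord fun i => (cCoord M i).im) = M := by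
  have hI := Complex.I_sq
  have h (i : Fin 4) : ((cCoord M i).re : ℂ) + Complex.I * (cCoord M i).im = cCoord M i := by
    rw [mul_comm]; exact Complex.re_add_im _
  have h0 := h 0
  have h1 := h 1
  have h2 := h 2
  have h3 := h 3
  have c0 : cCoord M 0 = (M 0 0 + M 1 1) / 2 := rfl
  have c1 : cCoord M 1 = Complex.I * (M 0 1 + M 1 0) / 2 := rfl
  have c2 : cCoord M 2 = (M 1 0 - M 0 1) / 2 := rfl
  have c3 : cCoord M 3 = Complex.I * (M 0 0 - M 1 1) / 2 := rfl
  ext a b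
  simp only [Matrix.add_apply, Matrix.smul_apply, toMat_eq_sum, smul_eq_mul]
  fin_cases a <;> fin_cases b <;> simp [coord, ofCoord] <;> grind

theorem cCoord_toMat (p q : ℍ[ℝ]) (i : Fin 4) :
    cCoord (toMat p + Complex.I • toMat q) i = coord i p + Complex.I * coord i q := by
  have hI := Complex.I_sq
  simp only [cCoord, Matrix.add_apply, Matrix.smul_apply, toMat_eq_sum, smul_eq_mul]
  fin_cases i <;> simp <;> grind

theorem ofCoord_coord (p : ℍ[ℝ]) : ofCoord (fun i => coord i p) = p := rfl

theorem existsUnique_toMat (M : Matrix (Fin 2) (Fin 2) ℂ) (p q : ℍ[ℝ]) :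
    M = toMat p + Complex.I • toMat q ↔
      p = ofCoord (fun i => (cCoord M i).re) ∧ q = ofCoord (fun i => (cCoord M i).im) := by
  constructor
  · rintro rfl
    simp only [cCoord_toMat]
    simp [ofCoord_coord]
  · rintro ⟨rfl, rfl⟩
    exact (toMat_add_I_smul M).symm

theorem ι_isLinearMap : IsLinearMap ℝ ι where
  map_add x y := by
    simp only [ι, Matrix.fromBlocks_add, ← toMatHom_apply, ← map_add]; rfl
  map_smul c x := by
    simp only [ι, Matrix.fromBlocks_smul, ← toMatHom_apply, ← map_smul]; rfl

theorem ι_mul (x y : glH) : ι (x * y) = ι x * ι y := by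
  simp only [ι, Matrix.fromBlocks_multiply, ← toMatHom_apply, ← map_add, ← map_mul,
    Matrix.mul_apply, Fin.sum_univ_two]

theorem ι_lie (x y : glH) : ι ⁅x, y⁆ = ⁅ι x, ι y⁆ := by
  rw [Ring.lie_def, Ring.lie_def, ← ι_mul, ← ι_mul]
  exact ι_isLinearMap.map_sub _ _

theorem existsUnique_ι (z : gl4) : ∃! p : glH × glH, z = ι p.1 + Complex.I • ι p.2 := by
  let M : Fin 2 → Fin 2 → Matrix (Fin 2) (Fin 2) ℂ :=
    ![![z.toBlocks₁₁, z.toBlocks₁₂], ![z.toBlocks₂₁, z.toBlocks₂₂]]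
  have key (p : glH × glH) : z = ι p.1 + Complex.I • ι p.2 ↔
      ∀ a b, M a b = toMat (p.1 a b) + Complex.I • toMat (p.2 a b) := by
    conv_lhs => rw [← Matrix.fromBlocks_toBlocks z]
    rw [ι, ι, Matrix.fromBlocks_smul, Matrix.fromBlocks_add, Matrix.fromBlocks_inj]
    simp only [Fin.forall_fin_two]
    exact ⟨fun h => ⟨⟨h.1, h.2.1⟩, h.2.2⟩, fun h => ⟨h.1.1, h.1.2, h.2⟩⟩
  refine ⟨(Matrix.of fun a b => ofCoord fun i => (cCoord (M a b) i).re,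
    Matrix.of fun a b => ofCoord fun i => (cCoord (M a b) i).im), ?_, fun p hp => ?_⟩
  · exact (key _).2 fun a b => (existsUnique_toMat _ _ _).2 ⟨rfl, rfl⟩
  · have h a b := (existsUnique_toMat _ _ _).1 ((key p).1 hp a b)
    exact Prod.ext (Matrix.ext fun a b => (h a b).1) (Matrix.ext fun a b => (h a b).2)

theorem ι_mem_sl4 (x : glH) : ι x ∈ sl4 ↔ x.trace.re = 0 := by
  show (ι x).trace = 0 ↔ _
  rw [trace_ι, trace_toMat, trace_toMat, ← Complex.ofReal_add, Complex.ofReal_eq_zero,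
    Matrix.trace_fin_two, Quaternion.re_add]
  constructor <;> intro h <;> linarith

end QuatConf
end
-- The theorem
open QuatConf in
theorem mainTheorem7 :
    -- the identification of the complexification of `𝔤𝔩(2, ℍ)` with `𝔤𝔩(4, ℂ)`
    -- (and of `𝔰𝔩(2, ℍ)` with `𝔰𝔩(4, ℂ)`)
    (IsLinearMap ℝ ι ∧ (∀ x y : glH, ι ⁅x, y⁆ = ⁅ι x, ι y⁆) ∧
      (∀ z : gl4, ∃! p : glH × glH, z = ι p.1 + Complex.I • ι p.2) ∧
      (∀ x : glH, ι x ∈ sl4 ↔ x.trace.re = 0)) ∧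
    ∃ (ρHpl ρHpr : gl4 →ₗ⁅ℂ⁆ Module.End ℂ HPlus) (ρHml ρHmr : gl4 →ₗ⁅ℂ⁆ Module.End ℂ HMinus)
      (ρVp : gl4 →ₗ⁅ℂ⁆ Module.End ℂ VPlus) (ρVm : gl4 →ₗ⁅ℂ⁆ Module.End ℂ VMinus)
      (ρVp' : gl4 →ₗ⁅ℂ⁆ Module.End ℂ VPlus') (ρVm' : gl4 →ₗ⁅ℂ⁆ Module.End ℂ VMinus'),
      -- the representations are the complexified derivatives of the group actions
      (IsDerivedRep actH_l HPlus ρHpl ∧ IsDerivedRep actH_r HPlus ρHpr ∧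
        IsDerivedRep actH_l HMinus ρHml ∧ IsDerivedRep actH_r HMinus ρHmr ∧
        IsDerivedRep actV VPlus ρVp ∧ IsDerivedRep actV VMinus ρVm ∧
        IsDerivedRep actV' VPlus' ρVp' ∧ IsDerivedRep actV' VMinus' ρVm') ∧
      -- they are irreducible, under `𝔤𝔩(4, ℂ)` and under `𝔰𝔩(4, ℂ)`
      (∀ s : Set gl4, s = Set.univ ∨ s = sl4 →
        IsIrreducibleUnder s ρHpl ∧ IsIrreducibleUnder s ρHpr ∧
        IsIrreducibleUnder s ρHml ∧ IsIrreducibleUnder s ρHmr ∧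
        IsIrreducibleUnder s ρVp ∧ IsIrreducibleUnder s ρVm ∧
        IsIrreducibleUnder s ρVp' ∧ IsIrreducibleUnder s ρVm') ∧
      -- unitary structures (on `𝓗⁻` the integral is negative definite)
      (IsUnitaryStructure ρHpl (fun φ₁ φ₂ => formH φ₁ φ₂) ∧
        IsUnitaryStructure ρHpr (fun φ₁ φ₂ => formH φ₁ φ₂) ∧
        IsUnitaryStructure ρHml (fun φ₁ φ₂ => -formH φ₁ φ₂) ∧
        IsUnitaryStructure ρHmr (fun φ₁ φ₂ => -formH φ₁ φ₂) ∧
        IsUnitaryStructure ρVp (fun f₁ f₂ => formV f₁ f₂) ∧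
        IsUnitaryStructure ρVm (fun f₁ f₂ => formV f₁ f₂) ∧
        IsUnitaryStructure ρVp' (fun g₁ g₂ => formV g₁ g₂) ∧
        IsUnitaryStructure ρVm' (fun g₁ g₂ => formV g₁ g₂)) ∧
      -- the invariant pairing of `(π_l⁰, 𝓗⁺)` and `(π_r⁰, 𝓗⁻)`, independent of the radius
      (∀ R : ℝ, 0 < R → IsInvariantPairing ρHpl ρHmr (fun φ₁ φ₂ => pairingH R φ₁ φ₂)) ∧
      (∀ R R' : ℝ, 0 < R → 0 < R' → ∀ (φ₁ : HPlus) (φ₂ : HMinus),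
        pairingH R φ₁ φ₂ = pairingH R' φ₁ φ₂) := by
  refine ⟨⟨ι_isLinearMap, ι_lie, existsUnique_ι, ι_mem_sl4⟩,
    transport incl_injective map_HPlus _ unitaryIrrep_HPlus.stable,
    -- π_r⁰ is realized on the same space by the twisted operators; the row representations below
    -- use the transposed calculus composed with `theta`.
    transport incl_injective map_HPlus _ unitaryIrrep_HPlus.twist.stable,
    transport incl_injective map_HMinus _ unitaryIrrep_HMinus.stable,
    transport incl_injective map_HMinus _ unitaryIrrep_HMinus.twist.stable,
    transport inclV_injective map_VPlus _ (unitaryIrrep_V isHalf_nonneg).stable,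
    transport inclV_injective map_VMinus _ (unitaryIrrep_V isHalf_neg).stable,
    transport inclV_injective map_VPlus' _ (unitaryIrrep_V' isHalf_nonneg).stable,
    transport inclV_injective map_VMinus' _ (unitaryIrrep_V' isHalf_neg).stable,
    ⟨isDerivedRep_transport _ _ _ hasDerivAt_actH_l, isDerivedRep_transport _ _ _ hasDerivAt_actH_r,
      isDerivedRep_transport _ _ _ hasDerivAt_actH_l, isDerivedRep_transport _ _ _ hasDerivAt_actH_r,
      isDerivedRep_transport _ _ _ hasDerivAt_actV, isDerivedRep_transport _ _ _ hasDerivAt_actV,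
      isDerivedRep_transport _ _ _ hasDerivAt_actV', isDerivedRep_transport _ _ _ hasDerivAt_actV'⟩,
    fun s hs => ⟨isIrreducibleUnder_transport _ _ unitaryIrrep_HPlus hs,
      isIrreducibleUnder_transport _ _ unitaryIrrep_HPlus.twist hs,
      isIrreducibleUnder_transport _ _ unitaryIrrep_HMinus hs,
      isIrreducibleUnder_transport _ _ unitaryIrrep_HMinus.twist hs,
      isIrreducibleUnder_transport _ _ (unitaryIrrep_V isHalf_nonneg) hs,
      isIrreducibleUnder_transport _ _ (unitaryIrrep_V isHalf_neg) hs,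
      isIrreducibleUnder_transport _ _ (unitaryIrrep_V' isHalf_nonneg) hs,
      isIrreducibleUnder_transport _ _ (unitaryIrrep_V' isHalf_neg) hs⟩,
    ⟨isUnitaryStructure_transport _ _ unitaryIrrep_HPlus formH_eq_one_mul,
      isUnitaryStructure_transport _ _ unitaryIrrep_HPlus.twist formH_eq_one_mul,
      isUnitaryStructure_transport (B' := fun φ₁ φ₂ => -formH φ₁ φ₂) _ _ unitaryIrrep_HMinus
        neg_formH_eq,
      isUnitaryStructure_transport (B' := fun φ₁ φ₂ => -formH φ₁ φ₂) _ _ unitaryIrrep_HMinus.twist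
        neg_formH_eq,
      isUnitaryStructure_transport _ _ (unitaryIrrep_V isHalf_nonneg) formV_eq,
      isUnitaryStructure_transport _ _ (unitaryIrrep_V isHalf_neg) formV_eq,
      isUnitaryStructure_transport _ _ (unitaryIrrep_V' isHalf_nonneg) formV_eq,
      isUnitaryStructure_transport _ _ (unitaryIrrep_V' isHalf_neg) formV_eq⟩,
    fun R hR => isInvariantPairing_transport hR, fun R R' hR hR' φ₁ φ₂ => ?_⟩
  rw [pairingH_coe hR, pairingH_coe hR']
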